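/- Let $n\ge 2$ be an even integer, let $b<0$, put $a=\tfrac23(-b)^{3/2}$, and for $(x,y)\in\mathbb R^n\times\mathbb R$ with $y<b$ let $$u=9(|x|^2-a^2)+12a(-y)^{3/2}+4y^3,\qquad v=9(|x|^2-a^2)-12a(-y)^{3/2}+4y^3 .$$ Let $D^n_{b,-}=\{(x,y)\in\mathbb R^{n+1}: u<0,\ y<b\}$ be the forward conoid region with vertex $(0,b)$ (there $v<u<0$), and let $\chi_{D^n_{b,-}}$ be its characteristic function. Let $F(\alpha,\beta,\gamma;z)=\sum_{k\ge0}\frac{(\alpha)_k(\beta)_k}{(\gamma)_k\,k!}z^k$ be the hypergeometric series and $$c(n)=\frac{\pi^{1/2-n/2}}{2^{1/3}\,3^{1-n}\,\Gamma(\frac32-\frac n2)} .$$ Let $$E_-(x,y;0,b)=c(n)\,\chi_{D^n_{b,-}}(x,y)\,(-u)^{1/2-n/2}(-v)^{-1/6}F\!\left(\tfrac23-\tfrac n2,\tfrac16,\tfrac32-\tfrac n2;\tfrac uv\right),$$ where the power of $-u$ (not locally integrable when $n\ge4$) is understood by analytic continuation in the exponent: for a test function $\varphi\in C_c^\infty(\mathbb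 R^{n+1})$, $$\langle E_-,\varphi\rangle=c(n)\,\Gamma(\tfrac32-\tfrac n2)\,Z_\varphi(\tfrac12-\tfrac n2),$$ where $Z_\varphi$ is the holomorphic function on $\{\operatorname{Re}s>-\frac{n+1}2\}$ that for $\operatorname{Re}s>-1$ is given by the absolutely convergent integral $$Z_\varphi(s)=\int_{D^n_{b,-}}\frac{(-u)^s}{\Gamma(s+1)}\,(-v)^{-1/6}F\!\left(\tfrac23-\tfrac n2,\tfrac16,\tfrac32-\tfrac n2;\tfrac uv\right)\varphi(x,y)\,dx\,dy .$$ Then $E_-$ is a well-defined (real-valued) distribution on $\mathbb R^{n+1}$, it is a fundamental solution relative to the point $(0,b)$ of the generalized Tricomi operator $\mathcal T=y\Delta_x+\partial_y^2$, $\Delta_x=\sum_{j=1}^n\partial_{x_j}^2$, that is, $\mathcal T E_-=\delta_{(0,b)}$ in the sense of distributions, and the support of the distribution $E_-$ is the closure of $D^n_{b,-}$. -/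

import Mathlib

open MeasureTheory TopologicalSpace
open scoped Distributions LineDeriv ContDiff

namespace Tricomi

/-- The space `ℝⁿ⁺¹ = ℝⁿ × ℝ` of points `(x, y)`, where `ℝⁿ` carries the Euclidean norm. -/
abbrev Space (n : ℕ) : Type := EuclideanSpace ℝ (Fin n) × ℝ

/-- Real-valued test functions on `ℝⁿ⁺¹`. -/
abbrev Test (n : ℕ) : Type := 𝓓((⊤ : Opens (Space n)), ℝ)

/-- Real-valued distributions on `ℝⁿ⁺¹`. -/
abbrev Distr (n : ℕ) : Type := 𝓓'((⊤ : Opens (Space n)), ℝ)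

/-- The unit vector in the direction `x_j`. -/
noncomputable def ex {n : ℕ} (j : Fin n) : Space n := (EuclideanSpace.single j 1, 0)

/-- The unit vector in the direction `y`. -/
def ey (n : ℕ) : Space n := (0, 1)

/-- Multiplication of test functions by the coordinate function `y`. -/
noncomputable def mulYTest (n : ℕ) : Test n →L[ℝ] Test n :=
  TestFunction.limitCLM ℝ
    (fun φ => ⟨fun p => p.2 * φ p, contDiff_snd.mul φ.contDiff, φ.hasCompactSupport.mul_left,
      fun _ _ => trivial⟩)
    (fun _ hK => TestFunction.ofSupportedInCLM ℝ hK ∘L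
      ContDiffMapSupportedIn.bilinLeftCLM (ContinuousLinearMap.mul ℝ ℝ)
        (g := fun p : Space n => p.2) contDiff_snd)
    (fun K hK f => by
      ext p
      simp [mul_comm])

theorem mulYTest_apply {n : ℕ} (φ : Test n) (p : Space n) : mulYTest n φ p = p.2 * φ p := rfl

/-- Multiplication of distributions by the coordinate function `y`: `(y E)(φ) = E(y φ)`. -/
noncomputable def mulY {n : ℕ} (E : Distr n) : Distr n :=
  (mulYTest n).precompCompactConvergenceCLM _ E

theorem mulY_apply {n : ℕ} (E : Distr n) (φ : Test n) : mulY E φ = E (mulYTest n φ) := rfl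

/-- The generalized Tricomi operator `y Δ_x + ∂_y²`, acting on distributions
(`∂_{v}` is the distributional derivative along the vector `v`). -/
noncomputable def tricomi {n : ℕ} (E : Distr n) : Distr n :=
  mulY (∑ j : Fin n, ∂_{ex j} (∂_{ex j} E)) + ∂_{ey n} (∂_{ey n} E)

/-- `E` is a fundamental solution of the generalized Tricomi operator relative to `p`. -/
def IsFundamentalSolution {n : ℕ} (E : Distr n) (p : Space n) : Prop :=
  tricomi E = Distribution.delta p

/-- `a = 2 (-b)^{3/2} / 3`. -/
noncomputable def a (b : ℝ) : ℝ := 2 * (-b) ^ (3 / 2 : ℝ) / 3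

/-- `u = 9(|x|² - a²) + 12 a (-y)^{3/2} + 4y³`. -/
noncomputable def u {n : ℕ} (b : ℝ) (p : Space n) : ℝ :=
  9 * (‖p.1‖ ^ 2 - a b ^ 2) + 12 * a b * (-p.2) ^ (3 / 2 : ℝ) + 4 * p.2 ^ 3

/-- `v = 9(|x|² - a²) - 12 a (-y)^{3/2} + 4y³`. -/
noncomputable def v {n : ℕ} (b : ℝ) (p : Space n) : ℝ :=
  9 * (‖p.1‖ ^ 2 - a b ^ 2) - 12 * a b * (-p.2) ^ (3 / 2 : ℝ) + 4 * p.2 ^ 3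

/-- The forward conoid region with vertex `(0, b)`. -/
def D (n : ℕ) (b : ℝ) : Set (Space n) := {p | u b p < 0 ∧ p.2 < b}

/-- `c(n) = π^{1/2 - n/2} / (2^{1/3} 3^{1-n} Γ(3/2 - n/2))`. -/
noncomputable def c (n : ℕ) : ℝ :=
  Real.pi ^ (1 / 2 - n / 2 : ℝ) /
    (2 ^ (1 / 3 : ℝ) * 3 ^ (1 - n : ℝ) * Real.Gamma (3 / 2 - n / 2))

/-- The factor `(-v)^{-1/6} F(2/3 - n/2, 1/6, 3/2 - n/2; u/v)`; in the region `D n b` one has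
`0 < u/v < 1`, so `F` is the sum of the hypergeometric series. -/
noncomputable def amplitude {n : ℕ} (b : ℝ) (p : Space n) : ℝ :=
  (-v b p) ^ (-(1 / 6) : ℝ) *
    ordinaryHypergeometric (2 / 3 - n / 2 : ℝ) (1 / 6 : ℝ) (3 / 2 - n / 2 : ℝ) (u b p / v b p)

/-- The pairing with `φ` of `χ_s(-u) (-v)^{-1/6} F(2/3 - n/2, 1/6, 3/2 - n/2; u/v)` on `D n b`,
where `χ_s(r) = r^s / Γ(s + 1)` for `r > 0`; the integral converges for `Re s > -1`. -/
noncomputable def pairing {n : ℕ} (b : ℝ) (φ : Test n) (s : ℂ) : ℂ :=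
  ∫ p in D n b, ((-u b p : ℝ) : ℂ) ^ s / Complex.Gamma (s + 1) * ((amplitude b p * φ p : ℝ) : ℂ)

/-- `Z` is the analytic continuation of `s ↦ pairing b φ s` from the half-plane `Re s > -1`, where
the integral converges absolutely, to the half-plane `Re s > -(n+1)/2`, which contains the point
`1/2 - n/2`. -/
def IsContinuation {n : ℕ} (b : ℝ) (φ : Test n) (Z : ℂ → ℂ) : Prop :=
  DifferentiableOn ℂ Z {s : ℂ | -((n : ℝ) + 1) / 2 < s.re} ∧
    ∀ s : ℂ, -1 < s.re →
      IntegrableOn (fun p : Space n => ((-u b p : ℝ) : ℂ) ^ s / Complex.Gamma (s + 1) *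
        ((amplitude b p * φ p : ℝ) : ℂ)) (D n b) ∧
      Z s = pairing b φ s

/-- `E` is the distribution
`c(n) χ_D (-u)^{1/2 - n/2} (-v)^{-1/6} F(2/3 - n/2, 1/6, 3/2 - n/2; u/v)`, where the power
`(-u)^q = Γ(q + 1) χ_q(-u)`, `q = 1/2 - n/2`, not locally integrable for `n ≥ 4`, is understood by
analytic continuation of `χ_s(-u)` in the exponent `s`. -/
def IsForwardDistribution {n : ℕ} (b : ℝ) (E : Distr n) : Prop :=
  ∀ φ : Test n, ∃ Z : ℂ → ℂ, IsContinuation b φ Z ∧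
    ((E φ : ℝ) : ℂ) = ((c n * Real.Gamma (3 / 2 - n / 2) : ℝ) : ℂ) * Z (1 / 2 - n / 2)

end Tricomi

/-!
# Forward fundamental solution of the generalized Tricomi operator

Let `q = 1/2 - n/2`, let `A` be the amplitude `(-v)^{-1/6} F(u/v)`, extended smoothly to the whole
space, and let `R_s(ψ)` be the integral of `ψ` against `(-u)^s / Γ(s+1)` over the conoid. The forward
distribution is `φ ↦ c(n) Γ(3/2 - n/2) R_q(A φ)`, with `R_q` defined by continuation in `s`.

*Continuation.* Below `y = b` one has `u = 9|x|² - tau(y)²`, where `tau` vanishes at `y = b`, so that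
`x = tau η / 3` carries the conoid to the cylinder `|η| < 1` and `(-u)^s dx` to
`3⁻ⁿ tau^{2s+n} (1-|η|²)^s dη` (`integral_D_eq_K`). The factor in `tau` is integrable for
`Re s > -(n+1)/2`. Integration by parts against `η · ∇_η` raises the exponent of `1-|η|²` by one
(`K_eq_succ`), and `n` such steps (`cont`) make that factor harmless in the same half-plane. At its
edge the exponent of `tau` is `-1`, which gives a simple pole with residue a multiple of the Dirac
measure at the vertex (`tendsto_cont`).

*The equation.* The function `u` satisfies the eikonal equation `⟨∇u, ∇u⟩ = 36 y u` for the form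
`y dx² + dy²` (`gradForm_u_u`), and the hypergeometric equation for `F` says that `(-u)^q A` solves the
Tricomi equation in the conoid (`tricomi_amplitude`). With `R_s(∂ψ) = R_{s-1}(∂u ψ)`
(`K_lineDeriv`) this yields, for the operator `T` and large `Re s`,
`R_s(A Tφ) = (s - q) (R_{s-1}(-36 y A φ) - q⁻¹ R_s((T A) φ))` (`K_tricomiTest`). By
the identity theorem it persists for `Re s > q`. As `s → q`, the factor `s - q` removes the second term
and meets the pole of `R_{s-1}` at `s - 1 = -(n+1)/2`; what remains is a multiple of `φ(0, b)`
(`riesz_tricomiTest_eq`), which `c(n)` normalizes to `φ(0, b)` itself (`normalization`).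

*The support.* Since `R_s(u ψ) = -(s+1) R_{s+1}(ψ)` and `q` is a half-integer, powers of `u` in the
test function move `R_q`, up to a nonzero factor, to a convergent integral with a positive weight
(`riesz_iterate_mul_u_ne_zero`). It is nonzero for suitable test functions near any point of the
closed conoid, because `A` vanishes on no open subset of the conoid (`exists_amplitude_ne_zero`).
-/

namespace Tricomi
/-! ### The hypergeometric equation -/

theorem hasFPowerSeriesOnBall_deriv_ofScalars {f : ℝ → ℝ} {w : ℕ → ℝ} {r : ENNReal}
    (h : HasFPowerSeriesOnBall f (FormalMultilinearSeries.ofScalars ℝ w) 0 r) :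
    HasFPowerSeriesOnBall (deriv f)
      (FormalMultilinearSeries.ofScalars ℝ fun k => ((k : ℝ) + 1) * w (k + 1)) 0 r := by
  have h1 := (ContinuousLinearMap.apply ℝ ℝ (1 : ℝ)).comp_hasFPowerSeriesOnBall h.fderiv
  have h2 : (ContinuousLinearMap.apply ℝ ℝ (1 : ℝ)).compFormalMultilinearSeries
      (FormalMultilinearSeries.ofScalars ℝ w).derivSeries =
      FormalMultilinearSeries.ofScalars ℝ fun k => ((k : ℝ) + 1) * w (k + 1) := by
    ext k
    rw [FormalMultilinearSeries.apply_eq_prod_smul_coeff,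
      FormalMultilinearSeries.apply_eq_prod_smul_coeff]
    congr 1
    rw [FormalMultilinearSeries.coeff_ofScalars]
    have := FormalMultilinearSeries.derivSeries_coeff_one
      (FormalMultilinearSeries.ofScalars ℝ w) k
    rw [FormalMultilinearSeries.coeff_ofScalars] at this
    change ((FormalMultilinearSeries.ofScalars ℝ w).derivSeries.coeff k) 1 = _
    rw [this]; simp [add_mul]
  rw [h2] at h1
  refine h1.congr fun x _ => ?_
  simp

theorem hasSum_of_ofScalars {f : ℝ → ℝ} {w : ℕ → ℝ} {r : ENNReal}
    (h : HasFPowerSeriesOnBall f (FormalMultilinearSeries.ofScalars ℝ w) 0 r) {z : ℝ}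
    (hz : z ∈ Metric.eball (0 : ℝ) r) : HasSum (fun k => w k * z ^ k) (f z) := by
  have := h.hasSum hz
  simpa [FormalMultilinearSeries.ofScalars_apply_eq, mul_comm] using this

/-- A power series whose coefficients satisfy the two-term recursion of the hypergeometric series
solves the hypergeometric equation. -/
theorem hypergeometric_ode_of_recursion {f : ℝ → ℝ} {w : ℕ → ℝ} {r : ENNReal} {α β γ : ℝ}
    (h : HasFPowerSeriesOnBall f (FormalMultilinearSeries.ofScalars ℝ w) 0 r)
    (hw : ∀ k : ℕ, ((k : ℝ) + 1) * (k + γ) * w (k + 1) = (k + α) * (k + β) * w k) {z : ℝ}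
    (hz : z ∈ Metric.eball (0 : ℝ) r) :
    z * (1 - z) * deriv (deriv f) z + (γ - (α + β + 1) * z) * deriv f z - α * β * f z = 0 := by
  have h1 := hasFPowerSeriesOnBall_deriv_ofScalars h
  have h2 := hasFPowerSeriesOnBall_deriv_ofScalars h1
  have s0 := hasSum_of_ofScalars h hz
  have s1 := hasSum_of_ofScalars h1 hz
  have s2 := hasSum_of_ofScalars h2 hz
  -- multiplication by `z` shifts the coefficients
  have shift : ∀ {p : ℕ → ℝ} {S : ℝ}, HasSum (fun k => p (k + 1) * z ^ k) S → p 0 = 0 →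
      HasSum (fun k => p k * z ^ k) (z * S) := by
    intro p S hS hp
    rw [← hasSum_nat_add_iff' 1]
    simp only [Finset.range_one, Finset.sum_singleton, hp, zero_mul, sub_zero]
    refine (hS.mul_left z).congr_fun fun k => ?_
    ring
  have t1 : HasSum (fun k : ℕ => ((k : ℝ) * w k) * z ^ k) (z * deriv f z) := by
    refine shift (p := fun k : ℕ => (k : ℝ) * w k) ?_ (by simp)
    simpa using s1
  have t2 : HasSum (fun k : ℕ => ((k : ℝ) * ((k + 1) * w (k + 1))) * z ^ k)
      (z * deriv (deriv f) z) := by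
    refine shift (p := fun k : ℕ => (k : ℝ) * ((k + 1) * w (k + 1))) ?_ (by simp)
    simpa using s2
  have t3 : HasSum (fun k : ℕ => ((k : ℝ) * ((k - 1) * w k)) * z ^ k)
      (z * (z * deriv (deriv f) z)) := by
    refine shift (p := fun k : ℕ => (k : ℝ) * ((k - 1) * w k)) ?_ (by simp)
    refine t2.congr_fun fun k => ?_
    push_cast; ring
  have := (((t2.sub t3).add (s1.mul_left γ)).sub (t1.mul_left (α + β + 1))).sub
    (s0.mul_left (α * β))
  have h0 := this.unique (hasSum_zero.congr_fun fun k => ?_ : HasSum _ (0 : ℝ))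
  · linear_combination h0
  · have := hw k
    linear_combination (z ^ k) * this

theorem ordinaryHypergeometricCoefficient_succ (α β γ : ℝ) (k : ℕ) (hk : (k : ℝ) + γ ≠ 0) :
    ((k : ℝ) + 1) * (k + γ) * ordinaryHypergeometricCoefficient α β γ (k + 1) =
      (k + α) * (k + β) * ordinaryHypergeometricCoefficient α β γ k := by
  have hk1 : (k : ℝ) + 1 ≠ 0 := by positivity
  have hk' : γ + k ≠ 0 := by rwa [add_comm]
  simp only [ordinaryHypergeometricCoefficient, ascPochhammer_succ_eval, Nat.factorial_succ,
    Nat.cast_mul, Nat.cast_add, Nat.cast_one, mul_inv]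
  rw [add_comm (k : ℝ) γ]
  generalize (Polynomial.eval γ (ascPochhammer ℝ k))⁻¹ = R
  field_simp
  ring

section
variable (n : ℕ)

/-- The hypergeometric function `F(2/3 - n/2, 1/6, 3/2 - n/2; ·)` of the amplitude. -/
noncomputable def hyp (z : ℝ) : ℝ :=
  ordinaryHypergeometric (2 / 3 - n / 2 : ℝ) (1 / 6 : ℝ) (3 / 2 - n / 2 : ℝ) z

theorem hyp_zero : hyp n 0 = 1 := ordinaryHypergeometric_zero _ _ _

variable {n}

/-- For even `m` the number `3/2 - m/2` is a half-integer, so it is no pole of `Γ` and no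
exceptional third parameter of the hypergeometric series. -/
theorem half_even_ne {m : ℕ} (hm : Even m) (k : ℤ) : (3 / 2 - m / 2 : ℝ) ≠ k := by
  obtain ⟨j, rfl⟩ := hm
  intro h
  have : (3 : ℝ) - 2 * j = 2 * k := by push_cast at h; linarith
  have h2 : (3 : ℤ) - 2 * j = 2 * k := by exact_mod_cast this
  omega

theorem hyp_hasFPowerSeriesOnBall (hn : Even n) :
    HasFPowerSeriesOnBall (hyp n) (FormalMultilinearSeries.ofScalars ℝ
      (ordinaryHypergeometricCoefficient (2 / 3 - n / 2 : ℝ) (1 / 6 : ℝ) (3 / 2 - n / 2 : ℝ)))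
      0 1 := by
  have hr := ordinaryHypergeometricSeries_radius_eq_one ℝ (2 / 3 - n / 2 : ℝ) (1 / 6 : ℝ)
    (3 / 2 - n / 2 : ℝ) (fun k => ⟨?_, ?_, ?_⟩)
  · have := (ordinaryHypergeometricSeries ℝ (2 / 3 - n / 2 : ℝ) (1 / 6 : ℝ)
      (3 / 2 - n / 2 : ℝ)).hasFPowerSeriesOnBall (by rw [hr]; exact one_pos)
    rw [hr] at this
    exact this
  · intro h
    obtain ⟨j, rfl⟩ := hn
    have : (3 : ℝ) * k + 2 = 3 * j := by push_cast at h; linarith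
    have h2 : 3 * k + 2 = 3 * j := by exact_mod_cast this
    omega
  · intro h
    have : (0 : ℝ) ≤ k := k.cast_nonneg
    linarith
  · intro h
    exact half_even_ne hn (-k) (by push_cast; linarith)

theorem hyp_ode (hn : Even n) {z : ℝ} (hz : |z| < 1) :
    z * (1 - z) * deriv (deriv (hyp n)) z +
      ((3 / 2 - n / 2) - ((2 / 3 - n / 2) + 1 / 6 + 1) * z) * deriv (hyp n) z -
      (2 / 3 - n / 2) * (1 / 6) * hyp n z = 0 := by
  refine hypergeometric_ode_of_recursion (hyp_hasFPowerSeriesOnBall hn) (fun k => ?_) (r := 1)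
    (by simpa [Metric.mem_eball, edist_dist, Real.dist_eq] using hz)
  exact ordinaryHypergeometricCoefficient_succ _ _ _ k
    fun h => half_even_ne hn (-k) (by push_cast; linarith)

theorem hyp_analyticOnNhd (hn : Even n) : AnalyticOnNhd ℝ (hyp n) (Set.Ioo (-1) 1) := by
  have := (hyp_hasFPowerSeriesOnBall hn).analyticOnNhd
  refine this.mono fun z hz => ?_
  have : |z| < 1 := abs_lt.2 hz
  simpa [Metric.mem_eball, edist_dist, Real.dist_eq] using this

end

open Set Filter Topology

variable {n : ℕ} {b : ℝ}

/-! ### Geometry of the conoid and smoothness of the amplitude -/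

/-- The distance `2(-y)^{3/2} - 2(-b)^{3/2}` to the vertex in characteristic time, so that
`u = 9|x|² - tau²`. -/
noncomputable def tau (b y : ℝ) : ℝ := 2 * (-y) ^ (3 / 2 : ℝ) - 3 * a b

theorem a_pos (hb : b < 0) : 0 < a b := by
  have : 0 < (-b) ^ (3 / 2 : ℝ) := Real.rpow_pos_of_pos (by linarith) _
  unfold a; positivity

theorem three_mul_a : 3 * a b = 2 * (-b) ^ (3 / 2 : ℝ) := by unfold a; ring

theorem rpow_three_halves_sq {y : ℝ} (hy : y ≤ 0) : ((-y) ^ (3 / 2 : ℝ)) ^ 2 = -y ^ 3 := by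
  rw [← Real.rpow_natCast, ← Real.rpow_mul (by linarith)]
  norm_num
  ring

theorem u_eq {p : Space n} (hp : p.2 ≤ 0) : u b p = 9 * ‖p.1‖ ^ 2 - tau b p.2 ^ 2 := by
  have := rpow_three_halves_sq hp
  unfold u tau
  linear_combination 4 * this

theorem u_sub_v (p : Space n) : u b p - v b p = 24 * a b * (-p.2) ^ (3 / 2 : ℝ) := by
  unfold u v; ring

theorem tau_self : tau b b = 0 := by
  unfold tau; rw [three_mul_a]; ring

theorem tau_pos {y : ℝ} (hb : b < 0) (hy : y < b) : 0 < tau b y := by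
  unfold tau
  rw [three_mul_a]
  have : (-b) ^ (3 / 2 : ℝ) < (-y) ^ (3 / 2 : ℝ) :=
    Real.rpow_lt_rpow (by linarith) (by linarith) (by norm_num)
  linarith

theorem continuous_tau : Continuous (tau b) := by
  unfold tau
  exact ((continuous_const.mul ((Real.continuous_rpow_const (by norm_num)).comp
    continuous_neg))).sub continuous_const

theorem continuous_u : Continuous (u b : Space n → ℝ) := by
  unfold u
  have h : Continuous fun p : Space n => (-p.2) ^ (3 / 2 : ℝ) :=
    (Real.continuous_rpow_const (by norm_num)).comp continuous_snd.neg
  fun_prop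

theorem continuous_v : Continuous (v b : Space n → ℝ) := by
  unfold v
  have h : Continuous fun p : Space n => (-p.2) ^ (3 / 2 : ℝ) :=
    (Real.continuous_rpow_const (by norm_num)).comp continuous_snd.neg
  fun_prop

theorem isOpen_D : IsOpen (D n b) :=
  (isOpen_lt continuous_u continuous_const).inter (isOpen_lt continuous_snd continuous_const)

theorem mem_D_iff (hb : b < 0) {p : Space n} : p ∈ D n b ↔ p.2 < b ∧ 3 * ‖p.1‖ < tau b p.2 := by
  constructor
  · rintro ⟨h1, h2⟩
    rw [u_eq (by linarith)] at h1
    refine ⟨h2, lt_of_pow_lt_pow_left₀ 2 (tau_pos hb h2).le ?_⟩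
    linarith
  · rintro ⟨h1, h2⟩
    refine ⟨?_, h1⟩
    rw [u_eq (by linarith)]
    have := pow_lt_pow_left₀ h2 (by positivity) two_ne_zero
    linarith

theorem axis_mem_D (hb : b < 0) {y : ℝ} (hy : y < b) : ((0, y) : Space n) ∈ D n b := by
  rw [mem_D_iff hb]
  exact ⟨hy, by simpa using tau_pos hb hy⟩

theorem vertex_mem_closure_D (hb : b < 0) : ((0, b) : Space n) ∈ closure (D n b) := by
  have h : Tendsto (fun y : ℝ => ((0, y) : Space n)) (𝓝[<] b) (𝓝 (0, b)) :=
    ((continuous_const.prodMk continuous_id).tendsto b).mono_left nhdsWithin_le_nhds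
  exact mem_closure_of_tendsto h (eventually_nhdsWithin_of_forall fun y hy => axis_mem_D hb hy)

theorem closure_D_subset : closure (D n b) ⊆ {p | u b p ≤ 0 ∧ p.2 ≤ b} :=
  closure_minimal (fun _ hp => ⟨hp.1.le, hp.2.le⟩)
    ((isClosed_le continuous_u continuous_const).inter
      (isClosed_le continuous_snd continuous_const))

theorem u_eq_zero_of_mem_closure (hb : b < 0) {p : Space n} (hp : p ∈ closure (D n b))
    (hp' : p ∉ D n b) : u b p = 0 := by
  obtain ⟨h1, h2⟩ := closure_D_subset hp
  refine le_antisymm h1 ?_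
  by_contra! h
  rcases h2.lt_or_eq with h3 | h3
  · exact hp' ⟨h, h3⟩
  · rw [u_eq (by linarith), h3, tau_self] at h
    nlinarith [sq_nonneg ‖p.1‖]

/-- An open neighbourhood of the closed conoid on which the amplitude is smooth. -/
def ampDomain (n : ℕ) (b : ℝ) : Set (Space n) := {p | p.2 < 0 ∧ v b p < 0 ∧ |u b p| < -v b p}

theorem isOpen_ampDomain : IsOpen (ampDomain n b) :=
  (isOpen_lt continuous_snd continuous_const).inter
    ((isOpen_lt continuous_v continuous_const).inter
      (isOpen_lt continuous_u.abs continuous_v.neg))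

theorem closure_D_subset_ampDomain (hb : b < 0) : closure (D n b) ⊆ ampDomain n b := by
  intro p hp
  obtain ⟨h1, h2⟩ := closure_D_subset hp
  have h3 : 0 < 24 * a b * (-p.2) ^ (3 / 2 : ℝ) := by
    have := Real.rpow_pos_of_pos (show 0 < -p.2 by linarith) (3 / 2)
    have := a_pos hb
    positivity
  rw [← u_sub_v] at h3
  refine ⟨by linarith, by linarith, ?_⟩
  rw [abs_of_nonpos h1]; linarith

theorem contDiffOn_u {b : ℝ} : ContDiffOn ℝ ∞ (u b : Space n → ℝ) {p | p.2 < 0} := by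
  unfold u
  have h : ContDiffOn ℝ ∞ (fun p : Space n => (-p.2) ^ (3 / 2 : ℝ)) {p | p.2 < 0} :=
    (contDiff_snd.neg.contDiffOn).rpow_const_of_ne fun p hp => by
      have : p.2 < 0 := hp
      linarith
  have h1 : ContDiff ℝ ∞ fun p : Space n => ‖p.1‖ ^ 2 := contDiff_fst.norm_sq ℝ
  exact (((contDiff_const.mul (h1.sub contDiff_const)).contDiffOn).add
    (contDiffOn_const.mul h)).add (contDiff_const.mul (contDiff_snd.pow 3)).contDiffOn

theorem contDiffOn_v {b : ℝ} : ContDiffOn ℝ ∞ (v b : Space n → ℝ) {p | p.2 < 0} := by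
  unfold v
  have h : ContDiffOn ℝ ∞ (fun p : Space n => (-p.2) ^ (3 / 2 : ℝ)) {p | p.2 < 0} :=
    (contDiff_snd.neg.contDiffOn).rpow_const_of_ne fun p hp => by
      have : p.2 < 0 := hp
      linarith
  have h1 : ContDiff ℝ ∞ fun p : Space n => ‖p.1‖ ^ 2 := contDiff_fst.norm_sq ℝ
  exact (((contDiff_const.mul (h1.sub contDiff_const)).contDiffOn).sub
    (contDiffOn_const.mul h)).add (contDiff_const.mul (contDiff_snd.pow 3)).contDiffOn

theorem ratio_mem {p : Space n} (hp : p ∈ ampDomain n b) : u b p / v b p ∈ Ioo (-1 : ℝ) 1 := by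
  obtain ⟨-, h2, h3⟩ := hp
  rw [abs_lt] at h3
  constructor
  · rw [lt_div_iff_of_neg h2]; linarith
  · rw [div_lt_iff_of_neg h2]; linarith

theorem contDiffOn_amplitude (hn : Even n) :
    ContDiffOn ℝ ∞ (amplitude b : Space n → ℝ) (ampDomain n b) := by
  have hv : ContDiffOn ℝ ∞ (v b : Space n → ℝ) (ampDomain n b) :=
    contDiffOn_v.mono fun p hp => hp.1
  have hu : ContDiffOn ℝ ∞ (u b : Space n → ℝ) (ampDomain n b) :=
    contDiffOn_u.mono fun p hp => hp.1
  refine (hv.neg.rpow_const_of_ne fun p hp => ?_).mul ?_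
  · have := hp.2.1
    linarith
  · exact ((hyp_analyticOnNhd hn).contDiffOn (uniqueDiffOn_Ioo _ _)).comp
      (hu.div hv fun p hp => hp.2.1.ne) fun p hp => ratio_mem hp

/-- A function that is smooth near a closed set agrees on it with a function that is smooth on the
whole space. -/
theorem exists_smooth_extension {f : Space n → ℝ} {C O : Set (Space n)} (hC : IsClosed C)
    (hO : IsOpen O) (hCO : C ⊆ O) (hf : ContDiffOn ℝ ∞ f O) :
    ∃ A : Space n → ℝ, ContDiff ℝ ∞ A ∧ ∀ p ∈ C, A p = f p := by
  obtain ⟨U, hU, hCU, hUO⟩ := normal_exists_closure_subset hC hO hCO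
  obtain ⟨χ, hχ1, hχ0, -⟩ := exists_contMDiffMap_one_nhds_of_subset_interior (n := ⊤)
    (modelWithCornersSelf ℝ (Space n)) (s := C) (t := closure U) hC
    (hCU.trans (hU.subset_interior_iff.2 subset_closure))
  have hχ : ContDiff ℝ ∞ χ := χ.contMDiff.contDiff
  refine ⟨fun p => χ p * f p, contDiff_iff_contDiffAt.2 fun p => ?_, fun p hp => ?_⟩
  · by_cases hp : p ∈ O
    · exact hχ.contDiffAt.mul (hf.contDiffAt (hO.mem_nhds hp))
    · refine (contDiffAt_const (c := (0 : ℝ))).congr_of_eventuallyEq ?_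
      filter_upwards [isClosed_closure.isOpen_compl.mem_nhds fun h => hp (hUO h)] with x hx
      rw [hχ0 x hx, zero_mul]
  · simp only [hχ1.self_of_nhdsSet p hp, one_mul]

theorem exists_smooth_amplitude (hn : Even n) (hb : b < 0) :
    ∃ A : Space n → ℝ, ContDiff ℝ ∞ A ∧ ∀ p ∈ closure (D n b), A p = amplitude b p :=
  exists_smooth_extension isClosed_closure isOpen_ampDomain (closure_D_subset_ampDomain hb)
    (contDiffOn_amplitude hn)

theorem exists_smooth_u (hb : b < 0) :
    ∃ U : Space n → ℝ, ContDiff ℝ ∞ U ∧ ∀ p ∈ closure (D n b), U p = u b p :=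
  exists_smooth_extension isClosed_closure isOpen_ampDomain (closure_D_subset_ampDomain hb)
    (contDiffOn_u.mono fun _ hp => hp.1)

/-! ### Derivatives along lines -/

/-- The derivative of `g` in the direction `e`. -/
noncomputable def dir {n : ℕ} (e : Space n) (g : Space n → ℝ) : Space n → ℝ :=
  fun p => fderiv ℝ g p e

/-- The quadratic form `y ∇_x g · ∇_x h + ∂_y g ∂_y h` of the Tricomi operator. -/
noncomputable def gradForm {n : ℕ} (g h : Space n → ℝ) (p : Space n) : ℝ :=
  p.2 * ∑ j : Fin n, dir (ex j) g p * dir (ex j) h p + dir (ey n) g p * dir (ey n) h p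

/-- The Tricomi operator on functions. -/
noncomputable def tricomiFun {n : ℕ} (g : Space n → ℝ) (p : Space n) : ℝ :=
  p.2 * ∑ j : Fin n, dir (ex j) (dir (ex j) g) p + dir (ey n) (dir (ey n) g) p

/-- The lower half-space `y < 0`. -/
def lowerHalf (n : ℕ) : Set (Space n) := {p | p.2 < 0}

theorem isOpen_lowerHalf : IsOpen (lowerHalf n) := isOpen_lt continuous_snd continuous_const

theorem ContDiffOn.dir {g : Space n → ℝ} {s : Set (Space n)} (hs : IsOpen s)
    (hg : ContDiffOn ℝ ∞ g s) (e : Space n) : ContDiffOn ℝ ∞ (dir e g) s :=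
  (hg.fderiv_of_isOpen hs (by simp)).clm_apply contDiffOn_const

theorem ContDiff.dir {g : Space n → ℝ} (hg : ContDiff ℝ ∞ g) (e : Space n) :
    ContDiff ℝ ∞ (dir e g) :=
  (hg.fderiv_right (by simp)).clm_apply contDiff_const

theorem ContDiff.tricomiFun {g : Space n → ℝ} (hg : ContDiff ℝ ∞ g) :
    ContDiff ℝ ∞ (tricomiFun g) :=
  (contDiff_snd.mul (ContDiff.sum fun _ _ => ContDiff.dir (ContDiff.dir hg _) _)).add
    (ContDiff.dir (ContDiff.dir hg _) _)

theorem dir_congr {g h : Space n → ℝ} {p : Space n} (hgh : g =ᶠ[𝓝 p] h) (e : Space n) :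
    dir e g =ᶠ[𝓝 p] dir e h := by
  filter_upwards [hgh.fderiv (𝕜 := ℝ)] with x hx
  simp only [dir, hx]

theorem dir_eq_of_hasDerivAt {g : Space n → ℝ} {p e : Space n} {c t : ℝ}
    (hg : DifferentiableAt ℝ g (p + t • e)) (h : HasDerivAt (fun t : ℝ => g (p + t • e)) c t) :
    dir e g (p + t • e) = c := by
  have h1 : HasDerivAt (fun t : ℝ => p + t • e) e t := by
    simpa using ((hasDerivAt_id' t).smul_const e).const_add p
  exact (hg.hasFDerivAt.comp_hasDerivAt t h1).unique h

/-- First and second derivatives in the direction `e` may be computed along the line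
`t ↦ p + t e`. -/
theorem dir_dir_eq_of_hasDerivAt {g : Space n → ℝ} {p e : Space n} {s : Set (Space n)}
    (hs : IsOpen s) (hp : p ∈ s) (hg : ContDiffOn ℝ ∞ g s) {g1 : ℝ → ℝ} {g2 : ℝ}
    (h1 : ∀ᶠ t in 𝓝 (0 : ℝ), HasDerivAt (fun t : ℝ => g (p + t • e)) (g1 t) t)
    (h2 : HasDerivAt g1 g2 0) :
    dir e g p = g1 0 ∧ dir e (dir e g) p = g2 := by
  have hc : Tendsto (fun t : ℝ => p + t • e) (𝓝 0) (𝓝 p) := by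
    have : Continuous fun t : ℝ => p + t • e := by fun_prop
    simpa using this.tendsto 0
  have hmem : ∀ᶠ t in 𝓝 (0 : ℝ), p + t • e ∈ s := hc (hs.mem_nhds hp)
  have hd : ∀ᶠ t in 𝓝 (0 : ℝ), dir e g (p + t • e) = g1 t := by
    filter_upwards [h1, hmem] with t ht hts
    exact dir_eq_of_hasDerivAt ((hg.contDiffAt (hs.mem_nhds hts)).differentiableAt (by simp)) ht
  refine ⟨by simpa using hd.self_of_nhds, ?_⟩
  have h3 := dir_eq_of_hasDerivAt (g := dir e g) (p := p) (e := e) (t := 0) (c := g2)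
    (by
      have h := ((ContDiffOn.dir hs hg e).contDiffAt (hs.mem_nhds hp)).differentiableAt (by simp)
      rwa [zero_smul, add_zero]) (h2.congr_of_eventuallyEq hd)
  simpa using h3

section lines

/-- First derivative of `(-V)^{-1/6} f(U/V)` along a curve, up to the factor `(-V)^{-1/6}`. -/
noncomputable def chain1 (f0 f1 u v U1 V1 : ℝ) : ℝ :=
  -(V1 / v) / 6 * f0 + (U1 * v - u * V1) / v ^ 2 * f1

/-- Second derivative of `(-V)^{-1/6} f(U/V)` along a curve, up to the factor `(-V)^{-1/6}`. -/
noncomputable def chain2 (f0 f1 f2 u v U1 V1 U2 V2 : ℝ) : ℝ :=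
  -(V1 / v) / 6 * (-(V1 / v) / 6 * f0 + (U1 * v - u * V1) / v ^ 2 * f1) +
    (-(V2 / v - (V1 / v) ^ 2) / 6 * f0 - (V1 / v) / 6 * (f1 * ((U1 * v - u * V1) / v ^ 2)) +
      ((U2 * v - u * V2) / v ^ 2 - 2 * (V1 / v) * ((U1 * v - u * V1) / v ^ 2)) * f1 +
      ((U1 * v - u * V1) / v ^ 2) ^ 2 * f2)

variable {f f1 f2 U V U1 V1 : ℝ → ℝ} {U2 V2 t : ℝ}

theorem hasDerivAt_prefactor (hV : HasDerivAt V (V1 t) t) (hneg : V t < 0) :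
    HasDerivAt (fun t => (-V t) ^ (-(1 / 6) : ℝ))
      ((-V t) ^ (-(1 / 6) : ℝ) * (-(V1 t / V t) / 6)) t := by
  have h := hV.fun_neg.rpow_const (p := -(1 / 6)) (Or.inl (by linarith))
  refine h.congr_deriv ?_
  rw [Real.rpow_sub_one (by linarith)]
  field_simp [hneg.ne]

theorem hasDerivAt_ratio (hU : HasDerivAt U (U1 t) t) (hV : HasDerivAt V (V1 t) t)
    (hneg : V t < 0) :
    HasDerivAt (fun t => U t / V t) ((U1 t * V t - U t * V1 t) / V t ^ 2) t :=
  hU.fun_div hV hneg.ne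

theorem hasDerivAt_chain1 (hU : HasDerivAt U (U1 t) t) (hV : HasDerivAt V (V1 t) t)
    (hneg : V t < 0) (hf : HasDerivAt f (f1 (U t / V t)) (U t / V t)) :
    HasDerivAt (fun t => (-V t) ^ (-(1 / 6) : ℝ) * f (U t / V t))
      ((-V t) ^ (-(1 / 6) : ℝ) *
        chain1 (f (U t / V t)) (f1 (U t / V t)) (U t) (V t) (U1 t) (V1 t)) t := by
  have h := (hasDerivAt_prefactor hV hneg).mul (hf.comp t (hasDerivAt_ratio hU hV hneg))
  refine h.congr_deriv ?_
  simp only [chain1, Function.comp_apply]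
  ring

theorem hasDerivAt_chain2 (hU : HasDerivAt U (U1 t) t) (hV : HasDerivAt V (V1 t) t)
    (hU1 : HasDerivAt U1 U2 t) (hV1 : HasDerivAt V1 V2 t)
    (hneg : V t < 0) (hf : HasDerivAt f (f1 (U t / V t)) (U t / V t))
    (hf1 : HasDerivAt f1 (f2 (U t / V t)) (U t / V t)) :
    HasDerivAt (fun t => (-V t) ^ (-(1 / 6) : ℝ) *
        chain1 (f (U t / V t)) (f1 (U t / V t)) (U t) (V t) (U1 t) (V1 t))
      ((-V t) ^ (-(1 / 6) : ℝ) * chain2 (f (U t / V t)) (f1 (U t / V t)) (f2 (U t / V t))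
        (U t) (V t) (U1 t) (V1 t) U2 V2) t := by
  have hz := hasDerivAt_ratio hU hV hneg
  have hw : HasDerivAt (fun t => -(V1 t / V t) / 6) _ t :=
    ((hV1.fun_div hV hneg.ne).fun_neg).div_const 6
  have hz1 : HasDerivAt (fun t => (U1 t * V t - U t * V1 t) / V t ^ 2) _ t :=
    ((hU1.fun_mul hV).fun_sub (hU.fun_mul hV1)).fun_div (hV.fun_pow 2) (pow_ne_zero 2 hneg.ne)
  have h := (hasDerivAt_prefactor hV hneg).fun_mul
    ((hw.fun_mul (hf.comp t hz)).fun_add (hz1.fun_mul (hf1.comp t hz)))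
  refine h.congr_deriv ?_
  simp only [chain2, Function.comp_apply]
  field_simp [hneg.ne]
  ring

end lines

/-- The algebra behind the transport equation: once all derivatives are expressed through `u`, `v`
and `s = √(-y)`, its left side is `54 a u / (s v)` times the left side of the hypergeometric
equation. -/
theorem tricomi_algebra {a s v N f0 f1 f2 u X : ℝ} (hv : v ≠ 0) (hs : s ≠ 0)
    (hu : u = v + 24 * a * s ^ 3) (hX : X = (u + 9 * a ^ 2 - 12 * a * s ^ 3 + 4 * s ^ 6) / 9)
    {lap gx : ℝ}
    (hlap : lap = N * chain2 f0 f1 f2 u v 0 0 18 18 + X * chain2 f0 f1 f2 u v 18 18 0 0)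
    (hgx : gx = X * 18 * chain1 f0 f1 u v 18 18)
    (hode : (u / v) * (1 - (u / v)) * f2 +
      ((3 / 2 - N / 2) - ((2 / 3 - N / 2) + 1 / 6 + 1) * (u / v)) * f1 -
      (2 / 3 - N / 2) * (1 / 6) * f0 = 0)
    {uy vy uyy vyy q : ℝ} (hq : q = 1 / 2 - N / 2)
    (huy : uy = 12 * s ^ 4 - 18 * a * s) (hvy : vy = 12 * s ^ 4 + 18 * a * s)
    (huyy : uyy = 9 * a / s - 24 * s ^ 2) (hvyy : vyy = -9 * a / s - 24 * s ^ 2) :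
    36 * s ^ 2 * (q * (q - 1)) * f0 -
      q * ((-s ^ 2 * (18 * N) + uyy) * f0 + 2 * (-s ^ 2 * gx + uy * chain1 f0 f1 u v uy vy)) -
      u * (-s ^ 2 * lap + chain2 f0 f1 f2 u v uy vy uyy vyy) = 0 := by
  rw [← mul_zero (54 * a * u / (s * v)), ← hode]
  subst hlap hgx hq huy hvy huyy hvyy hX hu
  simp only [chain1, chain2]
  field_simp
  ring

/-! ### Derivatives of `u` and `v` along coordinate lines -/

theorem line_ex (p : Space n) (j : Fin n) (t : ℝ) :
    ‖(p + t • ex j).1‖ ^ 2 = ‖p.1‖ ^ 2 + 2 * t * p.1 j + t ^ 2 := by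
  have : (p + t • ex j).1 = p.1 + t • EuclideanSpace.single j (1 : ℝ) := by simp [ex]
  rw [this, norm_add_sq_real, inner_smul_right, norm_smul]
  simp [EuclideanSpace.inner_single_right]
  ring

theorem line_ex_snd (p : Space n) (j : Fin n) (t : ℝ) : (p + t • ex j).2 = p.2 := by simp [ex]

theorem line_ey_fst (p : Space n) (t : ℝ) : (p + t • ey n).1 = p.1 := by simp [ey]

theorem line_ey_snd (p : Space n) (t : ℝ) : (p + t • ey n).2 = p.2 + t := by simp [ey]

theorem hasDerivAt_u_ex (p : Space n) (j : Fin n) (t : ℝ) :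
    HasDerivAt (fun t : ℝ => u b (p + t • ex j)) (18 * (p.1 j + t)) t := by
  have : (fun t : ℝ => u b (p + t • ex j)) = fun t => u b p + 9 * (2 * p.1 j * t + t ^ 2) := by
    ext t; simp only [u, line_ex, line_ex_snd]; ring
  rw [this]
  refine (((((hasDerivAt_id' t).const_mul (2 * p.1 j)).add ((hasDerivAt_id' t).pow 2)).const_mul
    9).const_add (u b p)).congr_deriv ?_
  norm_num
  ring

theorem hasDerivAt_v_ex (p : Space n) (j : Fin n) (t : ℝ) :
    HasDerivAt (fun t : ℝ => v b (p + t • ex j)) (18 * (p.1 j + t)) t := by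
  have : (fun t : ℝ => v b (p + t • ex j)) = fun t => v b p + 9 * (2 * p.1 j * t + t ^ 2) := by
    ext t; simp only [v, line_ex, line_ex_snd]; ring
  rw [this]
  refine (((((hasDerivAt_id' t).const_mul (2 * p.1 j)).add ((hasDerivAt_id' t).pow 2)).const_mul
    9).const_add (v b p)).congr_deriv ?_
  norm_num
  ring

theorem hasDerivAt_rpow_line {y t r : ℝ} (h : y + t < 0) :
    HasDerivAt (fun t : ℝ => (-(y + t)) ^ r) (-r * (-(y + t)) ^ (r - 1)) t := by
  have := (((hasDerivAt_id' t).const_add y).fun_neg).rpow_const (p := r)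
    (Or.inl (by simp; linarith))
  refine this.congr_deriv ?_
  simp

theorem hasDerivAt_u_ey (p : Space n) {t : ℝ} (h : p.2 + t < 0) :
    HasDerivAt (fun t : ℝ => u b (p + t • ey n))
      (-18 * a b * (-(p.2 + t)) ^ (1 / 2 : ℝ) + 12 * (p.2 + t) ^ 2) t := by
  simp only [u, line_ey_fst, line_ey_snd]
  have := (((hasDerivAt_rpow_line (r := 3 / 2) h).const_mul (12 * a b)).const_add
    (9 * (‖p.1‖ ^ 2 - a b ^ 2))).fun_add ((((hasDerivAt_id' t).const_add p.2).pow 3).const_mul 4)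
  refine this.congr_deriv ?_
  norm_num
  ring

theorem hasDerivAt_v_ey (p : Space n) {t : ℝ} (h : p.2 + t < 0) :
    HasDerivAt (fun t : ℝ => v b (p + t • ey n))
      (18 * a b * (-(p.2 + t)) ^ (1 / 2 : ℝ) + 12 * (p.2 + t) ^ 2) t := by
  simp only [v, line_ey_fst, line_ey_snd]
  have := (((hasDerivAt_rpow_line (r := 3 / 2) h).const_mul (12 * a b)).const_sub
    (9 * (‖p.1‖ ^ 2 - a b ^ 2))).fun_add ((((hasDerivAt_id' t).const_add p.2).pow 3).const_mul 4)
  refine this.congr_deriv ?_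
  norm_num
  ring

theorem hasDerivAt_ey_second (c : ℝ) {y t : ℝ} (h : y + t < 0) :
    HasDerivAt (fun t : ℝ => c * (-(y + t)) ^ (1 / 2 : ℝ) + 12 * (y + t) ^ 2)
      (-(c / 2) * (-(y + t)) ^ (-(1 / 2) : ℝ) + 24 * (y + t)) t := by
  have := ((hasDerivAt_rpow_line (r := 1 / 2) h).const_mul c).fun_add
    ((((hasDerivAt_id' t).const_add y).pow 2).const_mul 12)
  refine this.congr_deriv ?_
  norm_num
  ring

/-! ### The transport equation for the amplitude -/

theorem eventually_line_lt (p : Space n) (hp : p.2 < 0) : ∀ᶠ t in 𝓝 (0 : ℝ), p.2 + t < 0 := by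
  have : Continuous fun t : ℝ => p.2 + t := by fun_prop
  exact this.continuousAt.eventually_lt continuousAt_const (by simpa using hp)

theorem dir_u_ex {p : Space n} (hp : p.2 < 0) (j : Fin n) :
    dir (ex j) (u b) p = 18 * p.1 j ∧ dir (ex j) (dir (ex j) (u b)) p = 18 := by
  have h := dir_dir_eq_of_hasDerivAt (e := ex j) isOpen_lowerHalf hp (contDiffOn_u (b := b))
    (Eventually.of_forall fun t => hasDerivAt_u_ex p j t)
    (((hasDerivAt_id' (0 : ℝ)).const_add (p.1 j)).const_mul 18)
  simpa using h

theorem dir_u_ey {p : Space n} (hp : p.2 < 0) :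
    dir (ey n) (u b) p = -18 * a b * (-p.2) ^ (1 / 2 : ℝ) + 12 * p.2 ^ 2 ∧
    dir (ey n) (dir (ey n) (u b)) p = 9 * a b * (-p.2) ^ (-(1 / 2) : ℝ) + 24 * p.2 := by
  have h := dir_dir_eq_of_hasDerivAt (e := ey n) isOpen_lowerHalf hp (contDiffOn_u (b := b))
    ((eventually_line_lt p hp).mono fun t ht => hasDerivAt_u_ey p ht)
    (hasDerivAt_ey_second (-18 * a b) (by simpa using hp))
  refine ⟨by simpa using h.1, ?_⟩
  rw [h.2, add_zero]; ring

theorem sum_sq (x : EuclideanSpace ℝ (Fin n)) : ∑ j, x j ^ 2 = ‖x‖ ^ 2 := by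
  simp [EuclideanSpace.norm_sq_eq]

/-- The eikonal equation: `u` is a characteristic function of the Tricomi operator. -/
theorem gradForm_u_u {p : Space n} (hp : p.2 < 0) :
    gradForm (u b) (u b) p = 36 * p.2 * u b p := by
  have hs : ((-p.2) ^ (1 / 2 : ℝ)) ^ 2 = -p.2 := by
    rw [← Real.sqrt_eq_rpow, Real.sq_sqrt (by linarith)]
  have h3 : (-p.2) ^ (3 / 2 : ℝ) = -p.2 * (-p.2) ^ (1 / 2 : ℝ) := by
    rw [show (3 / 2 : ℝ) = 1 + 1 / 2 by norm_num, Real.rpow_add (by linarith), Real.rpow_one]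
  have h1 : ∑ j : Fin n, dir (ex j) (u b) p * dir (ex j) (u b) p = 324 * ‖p.1‖ ^ 2 := by
    rw [← sum_sq, Finset.mul_sum]
    refine Finset.sum_congr rfl fun j _ => ?_
    rw [(dir_u_ex hp j).1]; ring
  rw [gradForm, h1, (dir_u_ey hp).1, u, h3]
  linear_combination 324 * a b ^ 2 * hs

theorem tricomiFun_u {p : Space n} (hp : p.2 < 0) :
    tricomiFun (u b) p = p.2 * (18 * n) + (9 * a b * (-p.2) ^ (-(1 / 2) : ℝ) + 24 * p.2) := by
  have h1 : ∑ j : Fin n, dir (ex j) (dir (ex j) (u b)) p = 18 * n := by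
    simp only [(dir_u_ex hp _).2]
    simp [mul_comm]
  rw [tricomiFun, h1, (dir_u_ey hp).2]

/-- First and second derivatives of the amplitude in a direction in which those of `u` and `v` are
known. -/
theorem dir_amplitude (hn : Even n) {p e : Space n} (hp : p ∈ ampDomain n b)
    {U1 V1 : ℝ → ℝ} {U2 V2 : ℝ}
    (hU : ∀ᶠ t in 𝓝 (0 : ℝ), HasDerivAt (fun t : ℝ => u b (p + t • e)) (U1 t) t)
    (hV : ∀ᶠ t in 𝓝 (0 : ℝ), HasDerivAt (fun t : ℝ => v b (p + t • e)) (V1 t) t)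
    (hU1 : HasDerivAt U1 U2 0) (hV1 : HasDerivAt V1 V2 0) :
    dir e (amplitude b) p = (-v b p) ^ (-(1 / 6) : ℝ) *
        chain1 (hyp n (u b p / v b p)) (deriv (hyp n) (u b p / v b p)) (u b p) (v b p)
          (U1 0) (V1 0) ∧
      dir e (dir e (amplitude b)) p = (-v b p) ^ (-(1 / 6) : ℝ) *
        chain2 (hyp n (u b p / v b p)) (deriv (hyp n) (u b p / v b p))
          (deriv (deriv (hyp n)) (u b p / v b p)) (u b p) (v b p) (U1 0) (V1 0) U2 V2 := by
  have hc : Continuous fun t : ℝ => p + t • e := by fun_prop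
  have hmem : ∀ᶠ t in 𝓝 (0 : ℝ), p + t • e ∈ ampDomain n b :=
    hc.continuousAt.eventually_mem (isOpen_ampDomain.mem_nhds (by simpa using hp))
  have hd : ∀ z ∈ Ioo (-1 : ℝ) 1, HasDerivAt (hyp n) (deriv (hyp n) z) z := fun z hz =>
    ((hyp_analyticOnNhd hn) z hz).differentiableAt.hasDerivAt
  have hd2 : ∀ z ∈ Ioo (-1 : ℝ) 1, HasDerivAt (deriv (hyp n)) (deriv (deriv (hyp n)) z) z :=
    fun z hz => ((hyp_analyticOnNhd hn).deriv z hz).differentiableAt.hasDerivAt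
  have h1 : ∀ᶠ t in 𝓝 (0 : ℝ), HasDerivAt (fun t : ℝ => amplitude b (p + t • e))
      ((-v b (p + t • e)) ^ (-(1 / 6) : ℝ) *
        chain1 (hyp n (u b (p + t • e) / v b (p + t • e)))
          (deriv (hyp n) (u b (p + t • e) / v b (p + t • e))) (u b (p + t • e)) (v b (p + t • e))
          (U1 t) (V1 t)) t := by
    filter_upwards [hU, hV, hmem] with t h1 h2 h3
    exact hasDerivAt_chain1 h1 h2 h3.2.1 (hd _ (ratio_mem h3))
  have h0 : p + (0 : ℝ) • e = p := by simp
  have h2 := hasDerivAt_chain2 (f2 := deriv (deriv (hyp n))) hU.self_of_nhds hV.self_of_nhds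
    hU1 hV1 (by rw [h0]; exact hp.2.1)
    (hd _ (by rw [h0]; exact ratio_mem hp)) (hd2 _ (by rw [h0]; exact ratio_mem hp))
  have h := dir_dir_eq_of_hasDerivAt isOpen_ampDomain hp (contDiffOn_amplitude hn) h1 h2
  simpa only [h0] using h

/-- On the conoid, `(-u)^{1/2 - n/2} A` is annihilated by the Tricomi operator, where `A` is the
amplitude; written without the power of `-u`. -/
theorem tricomi_amplitude (hn : Even n) {p : Space n} (hp : p ∈ ampDomain n b)
    {q : ℝ} (hq : q = 1 / 2 - n / 2) :
    36 * (-p.2) * (q * (q - 1)) * amplitude b p -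
      q * (tricomiFun (u b) p * amplitude b p + 2 * gradForm (u b) (amplitude b) p) -
      u b p * tricomiFun (amplitude b) p = 0 := by
  have hy : p.2 < 0 := hp.1
  have hx (j : Fin n) := dir_amplitude hn hp (e := ex j)
    (Eventually.of_forall fun t => hasDerivAt_u_ex p j t)
    (Eventually.of_forall fun t => hasDerivAt_v_ex p j t)
    (((hasDerivAt_id' (0 : ℝ)).const_add (p.1 j)).const_mul 18)
    (((hasDerivAt_id' (0 : ℝ)).const_add (p.1 j)).const_mul 18)
  have hyy := dir_amplitude hn hp (e := ey n)
    ((eventually_line_lt p hy).mono fun t ht => hasDerivAt_u_ey p ht)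
    ((eventually_line_lt p hy).mono fun t ht => hasDerivAt_v_ey p ht)
    (hasDerivAt_ey_second (-18 * a b) (by simpa using hy))
    (hasDerivAt_ey_second (18 * a b) (by simpa using hy))
  simp only [add_zero, mul_one] at hx hyy
  have hode := hyp_ode hn (abs_lt.2 (ratio_mem hp))
  have hA : amplitude b p = (-v b p) ^ (-(1 / 6) : ℝ) * hyp n (u b p / v b p) := rfl
  rw [hA]
  generalize (-v b p) ^ (-(1 / 6) : ℝ) = P at *
  generalize hyp n (u b p / v b p) = f0 at *
  generalize deriv (hyp n) (u b p / v b p) = f1 at *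
  generalize deriv (deriv (hyp n)) (u b p / v b p) = f2 at *
  obtain ⟨s, hs, hsy⟩ : ∃ s : ℝ, 0 < s ∧ p.2 = -s ^ 2 :=
    ⟨√(-p.2), Real.sqrt_pos.2 (by linarith), by rw [Real.sq_sqrt (by linarith)]; ring⟩
  have hpow (r : ℝ) : (-p.2) ^ r = s ^ (2 * r) := by
    rw [hsy, neg_neg, ← Real.rpow_natCast, ← Real.rpow_mul hs.le]; norm_num
  have e1 : (-p.2) ^ (1 / 2 : ℝ) = s := by rw [hpow]; norm_num
  have e2 : (-p.2) ^ (-(1 / 2) : ℝ) = s⁻¹ := by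
    rw [hpow, show (2 * -(1 / 2) : ℝ) = -1 by norm_num, Real.rpow_neg_one]
  have e3 : (-p.2) ^ (3 / 2 : ℝ) = s ^ 3 := by
    rw [hpow, show (2 * (3 / 2) : ℝ) = (3 : ℕ) by norm_num, Real.rpow_natCast]
  have hu : u b p = v b p + 24 * a b * s ^ 3 := by
    rw [← e3, ← u_sub_v]; ring
  have hX : ‖p.1‖ ^ 2 = (u b p + 9 * a b ^ 2 - 12 * a b * s ^ 3 + 4 * s ^ 6) / 9 := by
    rw [u, e3, hsy]; ring
  have hlap : ∑ j : Fin n, dir (ex j) (dir (ex j) (amplitude b)) p =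
      P * (n * chain2 f0 f1 f2 (u b p) (v b p) 0 0 18 18 +
        ‖p.1‖ ^ 2 * chain2 f0 f1 f2 (u b p) (v b p) 18 18 0 0) := by
    rw [← sum_sq, Finset.sum_mul, mul_add, Finset.mul_sum,
      show P * (n * chain2 f0 f1 f2 (u b p) (v b p) 0 0 18 18) =
        ∑ _j : Fin n, P * chain2 f0 f1 f2 (u b p) (v b p) 0 0 18 18 by simp; ring,
      ← Finset.sum_add_distrib]
    refine Finset.sum_congr rfl fun j _ => ?_
    rw [(hx j).2]
    simp only [chain2]
    ring
  have hgx : ∑ j : Fin n, dir (ex j) (u b) p * dir (ex j) (amplitude b) p =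
      P * (‖p.1‖ ^ 2 * 18 * chain1 f0 f1 (u b p) (v b p) 18 18) := by
    rw [← sum_sq, Finset.sum_mul, Finset.sum_mul, Finset.mul_sum]
    refine Finset.sum_congr rfl fun j _ => ?_
    rw [(hx j).1, (dir_u_ex hy j).1]
    simp only [chain1]
    ring
  rw [tricomiFun_u hy, tricomiFun, gradForm, hlap, hgx, hyy.1, hyy.2, (dir_u_ey hy).1, e1, e2]
  have key := tricomi_algebra (uy := -18 * a b * s + 12 * p.2 ^ 2)
    (vy := 18 * a b * s + 12 * p.2 ^ 2) (uyy := 9 * a b * s⁻¹ + 24 * p.2)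
    (vyy := -9 * a b * s⁻¹ + 24 * p.2) hp.2.1.ne hs.ne' hu hX rfl rfl hode hq
    (by rw [hsy]; ring) (by rw [hsy]; ring) (by rw [hsy]; ring) (by rw [hsy]; ring)
  have c1 : -(-18 * a b / 2) * s⁻¹ + 24 * p.2 = 9 * a b * s⁻¹ + 24 * p.2 := by ring
  have c2 : -(18 * a b / 2) * s⁻¹ + 24 * p.2 = -9 * a b * s⁻¹ + 24 * p.2 := by ring
  rw [c1, c2]
  have hy2 : s ^ 2 = -p.2 := by rw [hsy]; ring
  rw [hy2] at key
  linear_combination P * key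

/-! ### The ball integral -/

theorem integral_betaPDFReal {α β : ℝ} (hα : 0 < α) (hβ : 0 < β) :
    Integrable (ProbabilityTheory.betaPDFReal α β) ∧
      ∫ x, ProbabilityTheory.betaPDFReal α β x = 1 := by
  have h0 : ∀ x, 0 ≤ ProbabilityTheory.betaPDFReal α β x := fun x => by
    by_cases hx : 0 < x ∧ x < 1
    · exact (ProbabilityTheory.betaPDFReal_pos hx.1 hx.2 hα hβ).le
    · rw [ProbabilityTheory.betaPDFReal, if_neg hx]
  have h1 : ∫⁻ x, ENNReal.ofReal (ProbabilityTheory.betaPDFReal α β x) = 1 :=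
    ProbabilityTheory.lintegral_betaPDF_eq_one hα hβ
  constructor
  · refine ⟨(ProbabilityTheory.measurable_betaPDFReal α β).aestronglyMeasurable, ?_⟩
    rw [hasFiniteIntegral_iff_ofReal (Eventually.of_forall h0), h1]
    exact ENNReal.one_lt_top
  · rw [integral_eq_lintegral_of_nonneg_ae (Eventually.of_forall h0)
      (ProbabilityTheory.measurable_betaPDFReal α β).aestronglyMeasurable, h1, ENNReal.toReal_one]

/-- The radial integrand of the ball integral, as a multiple of a beta density in `r²`. -/
theorem radial_eq_beta {n : ℕ} (hn : 0 < n) {s r : ℝ} (hs : -1 < s) (hr : r ∈ Ioi (0 : ℝ)) :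
    r ^ (n - 1) • (Iio (1 : ℝ)).indicator (fun r => (1 - r ^ 2) ^ s) r =
      (ProbabilityTheory.beta (n / 2) (s + 1) / 2) * (((2 : ℝ) * r ^ ((2 : ℝ) - 1)) •
        ProbabilityTheory.betaPDFReal (n / 2) (s + 1) (r ^ (2 : ℝ))) := by
  have hr0 : (0 : ℝ) < r := hr
  have hB := ProbabilityTheory.beta_pos (α := n / 2) (β := s + 1) (by positivity) (by linarith)
  by_cases h1 : r < 1
  · have h2 : 0 < r ^ (2 : ℝ) ∧ r ^ (2 : ℝ) < 1 :=
      ⟨Real.rpow_pos_of_pos hr0 _, Real.rpow_lt_one hr0.le h1 (by norm_num)⟩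
    rw [indicator_of_mem (by exact h1), ProbabilityTheory.betaPDFReal, if_pos h2,
      ← Real.rpow_mul hr0.le]
    have e : r ^ (n - 1) = r ^ ((2 : ℝ) - 1) * r ^ ((2 : ℝ) * (n / 2 - 1)) := by
      rw [← Real.rpow_add hr0, ← Real.rpow_natCast, Nat.cast_sub hn]
      congr 1; push_cast; ring
    rw [e, Real.rpow_two]
    simp only [smul_eq_mul, add_sub_cancel_right]
    field_simp
  · have h2 : ¬ (0 < r ^ (2 : ℝ) ∧ r ^ (2 : ℝ) < 1) := fun h =>
      h.2.not_ge (Real.one_le_rpow (not_lt.1 h1) (by norm_num))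
    rw [indicator_of_notMem (by exact h1), ProbabilityTheory.betaPDFReal, if_neg h2]
    simp

/-- In polar coordinates the integral becomes a beta integral in `r²`. -/
theorem ball_weight {n : ℕ} (hn : 0 < n) {s : ℝ} (hs : -1 < s) :
    IntegrableOn (fun x : EuclideanSpace ℝ (Fin n) => (1 - ‖x‖ ^ 2) ^ s) (Metric.ball 0 1) ∧
      ∫ x in Metric.ball (0 : EuclideanSpace ℝ (Fin n)) 1, (1 - ‖x‖ ^ 2) ^ s =
        Real.pi ^ (n / 2 : ℝ) * Real.Gamma (s + 1) / Real.Gamma (s + 1 + n / 2) := by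
  have : Nonempty (Fin n) := ⟨⟨0, hn⟩⟩
  have hβ := integral_betaPDFReal (α := n / 2) (β := s + 1) (by positivity) (by linarith)
  have hind (x : EuclideanSpace ℝ (Fin n)) :
      (Metric.ball (0 : EuclideanSpace ℝ (Fin n)) 1).indicator (fun x => (1 - ‖x‖ ^ 2) ^ s) x =
        (Iio (1 : ℝ)).indicator (fun r => (1 - r ^ 2) ^ s) ‖x‖ := by
    simp [indicator]
  have hcongr := fun r hr => radial_eq_beta hn hs (r := r) hr
  constructor
  · rw [← integrable_indicator_iff measurableSet_ball]
    rw [integrable_congr (Eventually.of_forall hind), integrable_fun_norm_addHaar volume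
      (f := (Iio (1 : ℝ)).indicator (fun r => (1 - r ^ 2) ^ s)), finrank_euclideanSpace_fin,
      integrableOn_congr_fun hcongr measurableSet_Ioi]
    refine Integrable.const_mul ?_ _
    have := (integrableOn_Ioi_comp_rpow_iff (ProbabilityTheory.betaPDFReal (n / 2) (s + 1))
      two_ne_zero).2 hβ.1.integrableOn
    simpa [IntegrableOn] using this
  · rw [← integral_indicator measurableSet_ball]
    rw [integral_congr_ae (Eventually.of_forall hind), integral_fun_norm_addHaar volume
      (f := (Iio (1 : ℝ)).indicator (fun r => (1 - r ^ 2) ^ s)), finrank_euclideanSpace_fin,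
      setIntegral_congr_fun measurableSet_Ioi hcongr, integral_const_mul,
      integral_comp_rpow_Ioi_of_pos two_pos]
    have hsupp : ∫ y in Ioi (0 : ℝ), ProbabilityTheory.betaPDFReal (n / 2) (s + 1) y = 1 := by
      refine Eq.trans ?_ hβ.2
      refine setIntegral_eq_integral_of_forall_compl_eq_zero fun x hx => ?_
      rw [ProbabilityTheory.betaPDFReal, if_neg fun h => hx h.1]
    have hn2 : (0 : ℝ) < n / 2 := by positivity
    have hG := Real.Gamma_pos_of_pos hn2
    have hG2 : 0 < Real.Gamma (s + 1 + n / 2) := Real.Gamma_pos_of_pos (by linarith)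
    have hvol : volume.real (Metric.ball (0 : EuclideanSpace ℝ (Fin n)) 1) =
        Real.pi ^ (n / 2 : ℝ) / (n / 2 * Real.Gamma (n / 2)) := by
      rw [measureReal_def, EuclideanSpace.volume_ball, Real.Gamma_add_one (by simpa using hn2.ne')]
      simp only [Fintype.card_fin, ENNReal.ofReal_one, one_pow, one_mul]
      rw [ENNReal.toReal_ofReal (by positivity), Real.sqrt_eq_rpow, ← Real.rpow_natCast,
        ← Real.rpow_mul Real.pi_pos.le]
      congr 2; ring
    rw [hsupp, hvol, ProbabilityTheory.beta, nsmul_eq_mul, smul_eq_mul, mul_one,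
      add_comm (n / 2 : ℝ)]
    have : (n : ℝ) ≠ 0 := by positivity
    field_simp

/-! ### Powers of `tau` -/

theorem hasDerivAt_tau {y : ℝ} (hy : y < 0) :
    HasDerivAt (tau b) (-3 * √(-y)) y := by
  have := ((hasDerivAt_rpow_line (y := 0) (t := y) (r := 3 / 2) (by simpa)).const_mul 2).sub_const
    (3 * a b)
  simp only [zero_add] at this
  refine this.congr_deriv ?_
  rw [Real.sqrt_eq_rpow]
  norm_num
  ring

theorem tau_antitone {y y' : ℝ} (hy : y ≤ y') (hy' : y' ≤ 0) : tau b y' ≤ tau b y := by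
  unfold tau
  have : (-y') ^ (3 / 2 : ℝ) ≤ (-y) ^ (3 / 2 : ℝ) :=
    Real.rpow_le_rpow (by linarith) (by linarith) (by norm_num)
  linarith

/-- A lower bound for `tau`, linear near the vertex, from Bernoulli's inequality. -/
theorem three_sqrt_mul_le_tau (hb : b < 0) {y : ℝ} (hy : y ≤ b) : 3 * √(-b) * (b - y) ≤ tau b y := by
  have h := one_add_mul_self_le_rpow_one_add (s := (b - y) / (-b)) (p := 3 / 2)
    (by rw [le_div_iff₀ (by linarith)]; linarith) (by norm_num)
  have hb' : 0 < -b := by linarith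
  have hb0 : b ≠ 0 := hb.ne
  have e : 1 + (b - y) / (-b) = (-y) / (-b) := by field_simp; ring
  rw [e, Real.div_rpow (by linarith) hb'.le, le_div_iff₀ (Real.rpow_pos_of_pos hb' _)] at h
  have e2 : (-b) ^ (3 / 2 : ℝ) = -b * √(-b) := by
    rw [show (3 / 2 : ℝ) = 1 + 1 / 2 by norm_num, Real.rpow_add hb', Real.rpow_one,
      Real.sqrt_eq_rpow]
  unfold tau
  rw [three_mul_a]
  have e3 : (1 + 3 / 2 * ((b - y) / -b)) * (-b) ^ (3 / 2 : ℝ) =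
      (-b) ^ (3 / 2 : ℝ) + 3 / 2 * (b - y) * √(-b) := by
    rw [e2]; field_simp; ring
  rw [e3] at h
  linarith

/-- Integrals of powers of `tau` against `|tau'|`. -/
theorem integral_tau_rpow_mul (hb : b < 0) {c p : ℝ} (hc : c < b) (hp : -1 < p) :
    IntegrableOn (fun y => tau b y ^ p * (3 * √(-y))) (Ioo c b) ∧
      ∫ y in Ioo c b, tau b y ^ p * (3 * √(-y)) = tau b c ^ (p + 1) / (p + 1) := by
  have hcont : ContinuousOn (fun y => -(tau b y ^ (p + 1) / (p + 1))) (Icc c b) :=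
    (((Real.continuous_rpow_const (by linarith)).comp continuous_tau).div_const _).neg.continuousOn
  have hderiv : ∀ y ∈ Ioo c b, HasDerivAt (fun y => -(tau b y ^ (p + 1) / (p + 1)))
      (tau b y ^ p * (3 * √(-y))) y := fun y hy => by
    have h := (((hasDerivAt_tau (b := b) (hy.2.trans hb)).rpow_const (p := p + 1)
      (Or.inl (tau_pos hb hy.2).ne')).div_const (p + 1)).fun_neg
    refine h.congr_deriv ?_
    have : p + 1 ≠ 0 := by linarith
    rw [add_sub_cancel_right]
    field_simp
  have hpos : ∀ y ∈ Ioo c b, 0 ≤ tau b y ^ p * (3 * √(-y)) := fun y hy => by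
    have := Real.rpow_nonneg (tau_pos hb hy.2).le p
    positivity
  have hint := intervalIntegral.integrableOn_deriv_of_nonneg hcont hderiv hpos
  refine ⟨hint.mono_set Ioo_subset_Ioc_self, ?_⟩
  rw [← integral_Ioc_eq_integral_Ioo, ← intervalIntegral.integral_of_le hc.le,
    intervalIntegral.integral_eq_sub_of_hasDerivAt_of_le hc.le hcont hderiv
      ((intervalIntegrable_iff_integrableOn_Ioc_of_le hc.le).2 hint), tau_self,
    Real.zero_rpow (by linarith)]
  ring

theorem integrableOn_tau_rpow (hb : b < 0) {c p : ℝ} (hp : -1 < p) :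
    IntegrableOn (fun y => tau b y ^ p) (Ioo c b) := by
  rcases lt_or_ge c b with hc | hc
  · refine Integrable.mono' ((integral_tau_rpow_mul hb hc hp).1.const_mul (3 * √(-b))⁻¹)
      ?_ ?_
    · exact (continuous_tau.measurable.pow_const p).aestronglyMeasurable
    · refine ae_restrict_of_forall_mem measurableSet_Ioo fun y hy => ?_
      have h0 := Real.rpow_nonneg (tau_pos hb hy.2).le p
      have h1 : 0 < √(-b) := Real.sqrt_pos.2 (by linarith)
      have h2 : √(-b) ≤ √(-y) := Real.sqrt_le_sqrt (by linarith [hy.2])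
      rw [Real.norm_of_nonneg h0, inv_mul_eq_div, le_div_iff₀ (by positivity)]
      gcongr
  · simp [Ioo_eq_empty_of_le hc]

/-! ### The functionals with weight `tau^{2s+n} (1-|η|²)^{s+m}` on the cylinder -/

/-- `∫ e^{sX} g` is holomorphic on a half-plane where it converges absolutely. -/
theorem differentiableOn_integral_cexp {Ω : Type*} [MeasurableSpace Ω] {μ : Measure Ω}
    {X : Ω → ℝ} {g : Ω → ℂ} {σ₀ : ℝ} (hX : AEMeasurable X μ) (hg : AEStronglyMeasurable g μ)
    (hint : ∀ σ > σ₀, Integrable (fun x => Real.exp (σ * X x) * ‖g x‖) μ) :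
    DifferentiableOn ℂ (fun s : ℂ => ∫ x, Complex.exp (s * X x) * g x ∂μ) {s | σ₀ < s.re} := by
  intro s (hs : σ₀ < s.re)
  obtain ⟨δ, hδ, hδs⟩ : ∃ δ > 0, σ₀ < s.re - 2 * δ := ⟨(s.re - σ₀) / 4, by linarith, by linarith⟩
  have hmeas (z : ℂ) : AEStronglyMeasurable (fun x => Complex.exp (z * X x)) μ := by
    have : AEMeasurable (fun x => Complex.exp (z * X x)) μ :=
      Complex.measurable_exp.comp_aemeasurable
        ((Complex.measurable_ofReal.comp_aemeasurable hX).const_mul z)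
    exact this.aestronglyMeasurable
  have hXm : AEStronglyMeasurable (fun x => (X x : ℂ)) μ :=
    (Complex.measurable_ofReal.comp_aemeasurable hX).aestronglyMeasurable
  have hbound : Integrable (fun x => δ⁻¹ * (Real.exp ((s.re + 2 * δ) * X x) * ‖g x‖ +
      Real.exp ((s.re - 2 * δ) * X x) * ‖g x‖)) μ :=
    ((hint _ (by linarith)).add (hint _ hδs)).const_mul _
  refine (hasDerivAt_integral_of_dominated_loc_of_deriv_le (Metric.ball_mem_nhds s hδ)
    (Eventually.of_forall fun z => (hmeas z).mul hg) ?_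
    (F' := fun z x => Complex.exp (z * X x) * X x * g x)
    (((hmeas s).mul hXm).mul hg) (Eventually.of_forall fun x z hz => ?_) hbound
    (Eventually.of_forall fun x z hz => ?_)).2.differentiableAt.differentiableWithinAt
  · refine (hint s.re hs).mono' ((hmeas s).mul hg) (Eventually.of_forall fun x => ?_)
    simp [Complex.norm_exp]
  · have hz' : |z.re - s.re| < δ := by
      have := Complex.abs_re_le_norm (z - s)
      rw [Metric.mem_ball, Complex.dist_eq] at hz
      rw [Complex.sub_re] at this
      linarith
    rw [abs_lt] at hz'
    rw [norm_mul, norm_mul, Complex.norm_exp, Complex.norm_real, ← add_mul, ← mul_assoc]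
    refine mul_le_mul_of_nonneg_right ?_ (norm_nonneg _)
    simp only [Complex.mul_re, Complex.ofReal_re, Complex.ofReal_im, mul_zero, sub_zero]
    rw [inv_mul_eq_div, le_div_iff₀ hδ, Real.norm_eq_abs]
    have h1 : |X x| * δ ≤ Real.exp (δ * |X x|) := by
      have := Real.add_one_le_exp (δ * |X x|)
      linarith
    have h2 : z.re * X x + δ * |X x| ≤ s.re * X x + 2 * δ * |X x| := by
      have : (z.re - s.re) * X x ≤ δ * |X x| := by
        refine (le_abs_self _).trans ?_
        rw [abs_mul]
        exact mul_le_mul_of_nonneg_right (abs_le.2 ⟨by linarith, by linarith⟩) (abs_nonneg _)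
      linarith
    calc Real.exp (z.re * X x) * |X x| * δ
        ≤ Real.exp (z.re * X x) * Real.exp (δ * |X x|) := by
          rw [mul_assoc]; exact mul_le_mul_of_nonneg_left h1 (Real.exp_nonneg _)
      _ ≤ Real.exp (s.re * X x + 2 * δ * |X x|) := by
          rw [← Real.exp_add]; exact Real.exp_le_exp.2 h2
      _ ≤ _ := by
          rcases abs_cases (X x) with ⟨h, -⟩ | ⟨h, -⟩
          · rw [h, ← add_mul]
            exact le_add_of_nonneg_right (Real.exp_nonneg _)
          · rw [h, show s.re * X x + 2 * δ * -X x = (s.re - 2 * δ) * X x by ring]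
            exact le_add_of_nonneg_left (Real.exp_nonneg _)
  · have h : HasDerivAt (fun z : ℂ => z * X x) (X x) z := by
      simpa using (hasDerivAt_id z).mul_const (X x : ℂ)
    exact h.cexp.mul_const (g x)

/-- The map `(η, y) ↦ (tau(y) η / 3, y)` from the cylinder `|η| < 1, y < b` onto the conoid. -/
noncomputable def scale (b : ℝ) (p : Space n) : Space n := ((tau b p.2 / 3) • p.1, p.2)

/-- The cylinder `|η| < 1`, `y < b`. -/
def cyl (n : ℕ) (b : ℝ) : Set (Space n) := Metric.ball 0 1 ×ˢ Iio b

theorem measurableSet_cyl : MeasurableSet (cyl n b) := measurableSet_ball.prod measurableSet_Iio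

theorem continuous_scale : Continuous (scale b : Space n → Space n) := by
  unfold scale
  have : Continuous fun p : Space n => tau b p.2 := continuous_tau.comp continuous_snd
  fun_prop

/-- The weight `tau^{2s+n} (1-|η|²)^{s+m}` on the cylinder, for real exponents. -/
noncomputable def weight (n : ℕ) (b : ℝ) (m : ℕ) (s : ℝ) (p : Space n) : ℝ :=
  tau b p.2 ^ (2 * s + n) * (1 - ‖p.1‖ ^ 2) ^ (s + m)

/-- The weight `tau^{2s+n} (1-|η|²)^{s+m}` on the cylinder, for complex exponents. -/
noncomputable def cweight (n : ℕ) (b : ℝ) (m : ℕ) (s : ℂ) (p : Space n) : ℂ :=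
  (tau b p.2 : ℂ) ^ (2 * s + n) * ((1 - ‖p.1‖ ^ 2 : ℝ) : ℂ) ^ (s + m)

theorem one_sub_pos {p : Space n} (hp : p ∈ cyl n b) : 0 < 1 - ‖p.1‖ ^ 2 := by
  have h : ‖p.1‖ < 1 := by simpa using hp.1
  nlinarith [norm_nonneg p.1]

theorem cweight_ofReal (hb : b < 0) {m : ℕ} {s : ℝ} {p : Space n} (hp : p ∈ cyl n b) :
    cweight n b m s p = weight n b m s p := by
  unfold cweight weight
  rw [Complex.ofReal_mul, Complex.ofReal_cpow (tau_pos hb hp.2).le,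
    Complex.ofReal_cpow (one_sub_pos hp).le]
  push_cast
  rfl

theorem norm_cweight (hb : b < 0) {m : ℕ} {s : ℂ} {p : Space n} (hp : p ∈ cyl n b) :
    ‖cweight n b m s p‖ = weight n b m s.re p := by
  unfold cweight weight
  rw [norm_mul, Complex.norm_cpow_eq_rpow_re_of_pos (tau_pos hb hp.2),
    Complex.norm_cpow_eq_rpow_re_of_pos (one_sub_pos hp)]
  simp

theorem weight_nonneg (hb : b < 0) {m : ℕ} {s : ℝ} {p : Space n} (hp : p ∈ cyl n b) :
    0 ≤ weight n b m s p :=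
  mul_nonneg (Real.rpow_nonneg (tau_pos hb hp.2).le _) (Real.rpow_nonneg (one_sub_pos hp).le _)

theorem measurable_cweight {m : ℕ} {s : ℂ} : Measurable (cweight n b m s) := by
  unfold cweight
  have h : Measurable fun p : Space n => tau b p.2 := (continuous_tau.comp continuous_snd).measurable
  have h2 : Measurable fun p : Space n => 1 - ‖p.1‖ ^ 2 := by fun_prop
  exact ((Complex.measurable_ofReal.comp h).pow_const _).mul
    ((Complex.measurable_ofReal.comp h2).pow_const _)

/-- The part of the cylinder above height `c`. -/
def cylFrom (n : ℕ) (c b : ℝ) : Set (Space n) := Metric.ball 0 1 ×ˢ Ioo c b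

theorem measurableSet_cylFrom {c : ℝ} : MeasurableSet (cylFrom n c b) :=
  measurableSet_ball.prod measurableSet_Ioo

theorem cylFrom_subset {c : ℝ} : cylFrom n c b ⊆ cyl n b := prod_mono subset_rfl Ioo_subset_Iio_self

theorem restrict_cylFrom {c : ℝ} : (volume : Measure (Space n)).restrict (cylFrom n c b) =
    (volume.restrict (Metric.ball 0 1)).prod (volume.restrict (Ioo c b)) := by
  rw [Measure.prod_restrict]; rfl

/-- Abscissa of convergence of the integrals of `cweight n b m s`: the exponents `2s+n` of `tau` and
`s+m` of `1-|η|²` both have to exceed `-1`. -/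
noncomputable def abscissa (n m : ℕ) : ℝ := max (-((n : ℝ) + 1) / 2) (-1 - m)

theorem integrableOn_weight (hn : 0 < n) (hb : b < 0) {m : ℕ} {s c : ℝ} (hs : abscissa n m < s) :
    IntegrableOn (weight n b m s) (cylFrom n c b) := by
  rw [abscissa, max_lt_iff] at hs
  rw [IntegrableOn, restrict_cylFrom]
  have := (ball_weight hn (s := s + m) (by linarith)).1.integrable.mul_prod
    (integrableOn_tau_rpow hb (c := c) (p := 2 * s + n) (by linarith)).integrable
  refine this.congr (Eventually.of_forall fun p => ?_)
  simp only [weight]; ring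

theorem exists_lower_bound (b : ℝ) (ψ : Test n) : ∃ c < b, ∀ p : Space n, p.2 ≤ c → ψ p = 0 := by
  obtain ⟨R, hR⟩ := (ψ.hasCompactSupport.isCompact.image continuous_snd).bddBelow
  refine ⟨min (R - 1) (b - 1), by linarith [min_le_right (R - 1) (b - 1)], fun p hp => ?_⟩
  by_contra h
  have := hR (mem_image_of_mem _ (subset_tsupport _ h))
  linarith [min_le_left (R - 1) (b - 1)]

theorem exists_bound (ψ : Test n) : ∃ M, ∀ p, |ψ p| ≤ M :=
  ψ.continuous.bounded_above_of_compact_support ψ.hasCompactSupport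

theorem aestronglyMeasurable_comp_scale (ψ : Test n) {μ : Measure (Space n)} :
    AEStronglyMeasurable (fun p => ((ψ (scale b p) : ℝ) : ℂ)) μ :=
  (Complex.continuous_ofReal.comp (ψ.continuous.comp continuous_scale)).aestronglyMeasurable

theorem integrableOn_cweight (hn : 0 < n) (hb : b < 0) {m : ℕ} {s : ℂ} (hs : abscissa n m < s.re)
    (ψ : Test n) :
    IntegrableOn (fun p => cweight n b m s p * (ψ (scale b p) : ℝ)) (cyl n b) := by
  obtain ⟨c, -, hc⟩ := exists_lower_bound b ψ
  obtain ⟨M, hM⟩ := exists_bound ψ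
  have h : IntegrableOn (fun p => cweight n b m s p * (ψ (scale b p) : ℝ)) (cylFrom n c b) := by
    refine Integrable.mono' ((integrableOn_weight hn hb hs (c := c)).mul_const M)
      (measurable_cweight.aestronglyMeasurable.mul (aestronglyMeasurable_comp_scale ψ)) ?_
    refine ae_restrict_of_forall_mem measurableSet_cylFrom fun p hp => ?_
    rw [norm_mul, norm_cweight hb (cylFrom_subset hp), Complex.norm_real]
    exact mul_le_mul_of_nonneg_left (hM _) (weight_nonneg hb (cylFrom_subset hp))
  refine h.of_forall_sdiff_eq_zero measurableSet_cyl fun p hp => ?_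
  have : p.2 ≤ c := by
    by_contra! h
    exact hp.2 ⟨hp.1.1, h, hp.1.2⟩
  rw [hc (scale b p) this]; simp

/-- The functional `ψ ↦ 3⁻ⁿ ∫∫ tau^{2s+n} (1-|η|²)^{s+m} / Γ(s+m+1) ψ(tau η / 3, y) dη dy`.
For `m = 0` it is integration against `(-u)^s / Γ(s+1)` over the conoid in the coordinates
`x = tau η / 3`; the shift `m` makes the integral converge at smaller `Re s`. -/
noncomputable def K (b : ℝ) (m : ℕ) (s : ℂ) (ψ : Test n) : ℂ :=
  (3 ^ n : ℂ)⁻¹ * (Complex.Gamma (s + m + 1))⁻¹ *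
    ∫ p in cyl n b, cweight n b m s p * (ψ (scale b p) : ℝ)

/-- The dependence on `s` in exponential form, for the holomorphy of the integral. -/
theorem cweight_eq_exp (hb : b < 0) {m : ℕ} {s : ℂ} {p : Space n} (hp : p ∈ cyl n b) :
    cweight n b m s p =
      Complex.exp (s * (2 * Real.log (tau b p.2) + Real.log (1 - ‖p.1‖ ^ 2) : ℝ)) *
        cweight n b m 0 p := by
  have h1 : (tau b p.2 : ℂ) ≠ 0 := by exact_mod_cast (tau_pos hb hp.2).ne'
  have h2 : ((1 - ‖p.1‖ ^ 2 : ℝ) : ℂ) ≠ 0 := by exact_mod_cast (one_sub_pos hp).ne'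
  unfold cweight
  rw [Complex.cpow_def_of_ne_zero h1, Complex.cpow_def_of_ne_zero h2,
    Complex.cpow_def_of_ne_zero h1, Complex.cpow_def_of_ne_zero h2, ← Complex.exp_add,
    ← Complex.exp_add, ← Complex.exp_add, Complex.ofReal_add, Complex.ofReal_mul,
    Complex.ofReal_log (tau_pos hb hp.2).le, Complex.ofReal_log (one_sub_pos hp).le]
  congr 1
  push_cast
  ring

theorem differentiableOn_K (hn : 0 < n) (hb : b < 0) (m : ℕ) (ψ : Test n) :
    DifferentiableOn ℂ (fun s => K b m s ψ) {s | abscissa n m < s.re} := by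
  have hΓ : DifferentiableOn ℂ (fun s : ℂ => (Complex.Gamma (s + m + 1))⁻¹)
      {s | abscissa n m < s.re} :=
    (Complex.differentiable_one_div_Gamma.comp
      (f := fun s : ℂ => s + m + 1) (by fun_prop)).differentiableOn
  refine (hΓ.const_mul _).mul ?_
  have h := differentiableOn_integral_cexp (μ := volume.restrict (cyl n b)) (σ₀ := abscissa n m)
    (X := fun p : Space n => 2 * Real.log (tau b p.2) + Real.log (1 - ‖p.1‖ ^ 2))
    (g := fun p => cweight n b m 0 p * (ψ (scale b p) : ℝ)) ?_ ?_ ?_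
  · refine h.congr fun s _ => setIntegral_congr_fun measurableSet_cyl fun p hp => ?_
    rw [← mul_assoc, ← cweight_eq_exp hb hp]
  · have h : Measurable fun p : Space n => tau b p.2 :=
      (continuous_tau.comp continuous_snd).measurable
    have h2 : Measurable fun p : Space n => 1 - ‖p.1‖ ^ 2 := by fun_prop
    exact ((h.log.const_mul 2).add h2.log).aemeasurable
  · exact measurable_cweight.aestronglyMeasurable.mul (aestronglyMeasurable_comp_scale ψ)
  · intro σ hσ
    have h := (integrableOn_cweight hn hb (m := m) (s := σ) (by simpa using hσ) ψ).norm
    refine h.congr (ae_restrict_of_forall_mem measurableSet_cyl fun p hp => ?_)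
    simp only
    rw [cweight_eq_exp hb hp, mul_assoc, norm_mul, Complex.norm_exp]
    congr 2
    simp

/-! ### Operations on test functions and the functionals as distributions -/

/-- Multiplication of test functions by a smooth function. -/
noncomputable def mulTest (g : Space n → ℝ) (hg : ContDiff ℝ ∞ g) : Test n →L[ℝ] Test n :=
  TestFunction.limitCLM ℝ
    (fun φ => ⟨fun p => g p * φ p, hg.mul φ.contDiff, φ.hasCompactSupport.mul_left,
      fun _ _ => trivial⟩)
    (fun _ hK => TestFunction.ofSupportedInCLM ℝ hK ∘L
      ContDiffMapSupportedIn.bilinLeftCLM (ContinuousLinearMap.mul ℝ ℝ) (g := g) hg)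
    (fun K hK f => by
      ext p
      simp [mul_comm])

theorem mulTest_apply {g : Space n → ℝ} (hg : ContDiff ℝ ∞ g) (φ : Test n) (p : Space n) :
    mulTest g hg φ p = g p * φ p := rfl

theorem lineDeriv_test_apply (φ : Test n) (e p : Space n) : (∂_{e} φ : Test n) p = dir e φ p := by
  rw [TestFunction.lineDerivOp_eq_lineDerivCLM ℝ, TestFunction.lineDerivCLM_eq_fderivCLM,
    TestFunction.fderivCLM_apply_of_le _ (by simp)]
  rfl

theorem contDiff_coord (j : Fin n) : ContDiff ℝ ∞ (fun p : Space n => p.1 j) :=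
  (EuclideanSpace.proj (𝕜 := ℝ) j : EuclideanSpace ℝ (Fin n) →L[ℝ] ℝ).contDiff.comp contDiff_fst

/-- The operator `x · ∇_x` on test functions. -/
noncomputable def euler (n : ℕ) : Test n →L[ℝ] Test n :=
  ∑ j : Fin n, mulTest (fun p => p.1 j) (contDiff_coord j) ∘L TestFunction.lineDerivCLM ℝ (ex j)

theorem euler_apply (φ : Test n) (p : Space n) :
    euler n φ p = ∑ j : Fin n, p.1 j * dir (ex j) φ p := by
  have h : euler n φ = ∑ j : Fin n, mulTest (fun p => p.1 j) (contDiff_coord j) (∂_{ex j} φ) := by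
    simp only [euler, sum_apply]
    rfl
  have h2 (s : Finset (Fin n)) (F : Fin n → Test n) : (∑ j ∈ s, F j) p = ∑ j ∈ s, F j p := by
    classical
    induction s using Finset.induction_on with
    | empty => simp
    | insert i s hi ih => rw [Finset.sum_insert hi, Finset.sum_insert hi, ← ih]; rfl
  rw [h, h2]
  refine Finset.sum_congr rfl fun j _ => ?_
  rw [mulTest_apply, lineDeriv_test_apply]

theorem euler_axis (φ : Test n) (y : ℝ) : euler n φ (0, y) = 0 := by
  simp [euler_apply]

/-- The real form of the functional `K` at a real exponent. -/
noncomputable def realK (b : ℝ) (m : ℕ) (s : ℝ) (ψ : Test n) : ℝ :=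
  (3 ^ n : ℝ)⁻¹ * (Real.Gamma (s + m + 1))⁻¹ * ∫ p in cyl n b, weight n b m s p * ψ (scale b p)

theorem K_ofReal (hb : b < 0) (m : ℕ) (s : ℝ) (ψ : Test n) : K b m s ψ = realK b m s ψ := by
  have h : ∫ p in cyl n b, cweight n b m s p * (ψ (scale b p) : ℝ) =
      ((∫ p in cyl n b, weight n b m s p * ψ (scale b p) : ℝ) : ℂ) := by
    rw [← integral_complex_ofReal]
    refine setIntegral_congr_fun measurableSet_cyl fun p hp => ?_
    simp only [cweight_ofReal hb hp, Complex.ofReal_mul]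
  rw [K, realK, h, Complex.ofReal_mul, Complex.ofReal_mul, Complex.ofReal_inv,
    Complex.ofReal_inv, ← Complex.Gamma_ofReal]
  push_cast
  rfl

theorem integrableOn_weight_mul (hn : 0 < n) (hb : b < 0) {m : ℕ} {s : ℝ} (hs : abscissa n m < s)
    (ψ : Test n) : IntegrableOn (fun p => weight n b m s p * ψ (scale b p)) (cyl n b) := by
  have h := (integrableOn_cweight hn hb (m := m) (s := s) (by simpa using hs) ψ).re
  refine h.congr (ae_restrict_of_forall_mem measurableSet_cyl fun p hp => ?_)
  simp only [cweight_ofReal hb hp]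
  rw [← Complex.ofReal_mul]
  rfl

/-- At a real exponent in the domain of convergence, `K` is a distribution. -/
theorem exists_distribution_K (hn : 0 < n) (hb : b < 0) {m : ℕ} {s : ℝ} (hs : abscissa n m < s) :
    ∃ T : Distr n, ∀ ψ : Test n, K b m s ψ = (T ψ : ℝ) := by
  have hint := fun ψ => integrableOn_weight_mul hn hb hs ψ (b := b)
  have hadd : ∀ f g : Test n, realK b m s (f + g) = realK b m s f + realK b m s g := fun f g => by
    unfold realK
    rw [← mul_add, ← integral_add (hint f) (hint g)]
    congr 2 with p
    rw [← mul_add]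
    rfl
  have hsmul : ∀ (c : ℝ) (f : Test n), realK b m s (c • f) = c • realK b m s f := fun c f => by
    unfold realK
    rw [smul_eq_mul, mul_left_comm, ← integral_const_mul c]
    refine congrArg _ (integral_congr_ae (Eventually.of_forall fun p => ?_))
    simp only
    rw [show (c • f) (scale b p) = c * f (scale b p) from rfl]
    ring
  have hcont : ∀ (C : Compacts (Space n)) (hC : (C : Set (Space n)) ⊆ (⊤ : Opens (Space n))),
      Continuous (realK b m s ∘ TestFunction.ofSupportedIn (n := ⊤) (F := ℝ) hC) := by
    intro C hC
    obtain ⟨R, hR⟩ := (C.isCompact.image continuous_snd).bddBelow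
    set c := R - 1
    have hw : IntegrableOn (weight n b m s) (cylFrom n c b) := integrableOn_weight hn hb hs
    have hmeas (g : BoundedContinuousFunction (Space n) ℝ) : AEStronglyMeasurable
        (fun p => g (scale b p)) (volume.restrict (cylFrom n c b)) :=
      (g.continuous.comp continuous_scale).aestronglyMeasurable
    have hI (g : BoundedContinuousFunction (Space n) ℝ) :
        IntegrableOn (fun p => weight n b m s p * g (scale b p)) (cylFrom n c b) :=
      hw.mul_bdd (hmeas g) (c := ‖g‖) (Eventually.of_forall fun p => g.norm_coe_le_norm _)
    let L₀ : BoundedContinuousFunction (Space n) ℝ →ₗ[ℝ] ℝ :=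
      { toFun := fun g => (3 ^ n : ℝ)⁻¹ * (Real.Gamma (s + m + 1))⁻¹ *
          ∫ p in cylFrom n c b, weight n b m s p * g (scale b p)
        map_add' := fun f g => by
          rw [← mul_add, ← integral_add (hI f) (hI g)]
          congr 2 with p
          rw [← mul_add]
          rfl
        map_smul' := fun a f => by
          rw [RingHom.id_apply, smul_eq_mul, mul_left_comm, ← integral_const_mul a]
          refine congrArg _ (integral_congr_ae (Eventually.of_forall fun p => ?_))
          simp only
          rw [show (a • f) (scale b p) = a * f (scale b p) from rfl]
          ring }
    have hL₀ (g : BoundedContinuousFunction (Space n) ℝ) : L₀ g = (3 ^ n : ℝ)⁻¹ *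
        (Real.Gamma (s + m + 1))⁻¹ * ∫ p in cylFrom n c b, weight n b m s p * g (scale b p) := rfl
    have hL : Continuous L₀ := by
      refine AddMonoidHomClass.continuous_of_bound L₀
        (|(3 ^ n : ℝ)⁻¹ * (Real.Gamma (s + m + 1))⁻¹| *
          ∫ p in cylFrom n c b, weight n b m s p) fun g => ?_
      rw [hL₀, norm_mul, Real.norm_eq_abs, mul_assoc]
      refine mul_le_mul_of_nonneg_left ?_ (abs_nonneg _)
      rw [← integral_mul_const]
      refine norm_integral_le_of_norm_le (hw.mul_const _)
        (ae_restrict_of_forall_mem measurableSet_cylFrom fun p hp => ?_)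
      rw [norm_mul, Real.norm_of_nonneg (weight_nonneg hb (cylFrom_subset hp))]
      exact mul_le_mul_of_nonneg_left (g.norm_coe_le_norm _)
        (weight_nonneg hb (cylFrom_subset hp))
    refine (hL.comp (ContDiffMapSupportedIn.toBoundedContinuousFunctionCLM ℝ
      (n := ⊤) (K := C) (F := ℝ)).continuous).congr fun f => ?_
    rw [Function.comp_apply, hL₀, Function.comp_apply, realK]
    refine congrArg _ (Eq.symm ?_)
    refine setIntegral_eq_of_subset_of_forall_sdiff_eq_zero measurableSet_cyl cylFrom_subset
      fun p hp => ?_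
    have hp2 : p.2 ≤ c := by
      by_contra! h
      exact hp.2 ⟨hp.1.1, h, hp.1.2⟩
    have : scale b p ∉ (C : Set (Space n)) := fun h => by
      have := hR (mem_image_of_mem _ h)
      simp only [scale, c] at this hp2
      linarith
    change _ * f (scale b p) = 0
    rw [f.zero_on_compl this]
    simp
  exact ⟨TestFunction.mkCLM ℝ (realK b m s) hadd hsmul hcont, fun ψ => K_ofReal hb m s ψ⟩

/-! ### The residue -/

/-- Up to an error of order `tau`, a test function in the coordinates of the cylinder equals its value
at the vertex. The factor `√(-y)` is inserted because `3√(-y)` is `|tau'|`, which makes the integral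
of the main term explicit. -/
theorem dist_axis_le (hb : b < 0) (ψ : Test n) {c : ℝ} :
    ∃ C, 0 ≤ C ∧ ∀ p ∈ cylFrom n c b,
      |ψ (scale b p) - ψ (0, b) / √(-b) * √(-p.2)| ≤ C * tau b p.2 := by
  obtain ⟨L, hL⟩ := ContDiff.lipschitzWith_of_hasCompactSupport ψ.hasCompactSupport ψ.contDiff
    (by simp)
  have hs : 0 < √(-b) := Real.sqrt_pos.2 (by linarith)
  refine ⟨L * (1 / 3 + 1 / (3 * √(-b))) + |ψ (0, b)| / √(-b) * (1 / √(-b)) * (1 / (3 * √(-b))),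
    by positivity, fun p hp => ?_⟩
  have hp2 : p.2 < b := hp.2.2
  have hp1 : ‖p.1‖ < 1 := by simpa using hp.1
  have ht := tau_pos hb hp2
  have h1 : b - p.2 ≤ 1 / (3 * √(-b)) * tau b p.2 := by
    rw [one_div, inv_mul_eq_div, le_div_iff₀ (by positivity)]
    linarith [three_sqrt_mul_le_tau hb hp2.le]
  have h2 : |ψ (scale b p) - ψ (0, b)| ≤ L * (1 / 3 + 1 / (3 * √(-b))) * tau b p.2 := by
    have := hL.dist_le_mul (scale b p) (0, b)
    rw [Real.dist_eq] at this
    refine this.trans ?_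
    rw [mul_assoc]
    refine mul_le_mul_of_nonneg_left ?_ L.2
    rw [Prod.dist_eq]
    refine max_le ?_ ?_
    · rw [dist_zero_right]
      change ‖(tau b p.2 / 3) • p.1‖ ≤ _
      rw [norm_smul, Real.norm_of_nonneg (by positivity)]
      have : tau b p.2 / 3 * ‖p.1‖ ≤ tau b p.2 / 3 := mul_le_of_le_one_right (by positivity) hp1.le
      have : 0 ≤ 1 / (3 * √(-b)) * tau b p.2 := by positivity
      linarith
    · change dist p.2 b ≤ _
      rw [dist_comm, Real.dist_eq, abs_of_pos (by linarith)]
      linarith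
  have h3 : |√(-p.2) - √(-b)| ≤ 1 / √(-b) * (1 / (3 * √(-b)) * tau b p.2) := by
    have h4 : √(-b) ≤ √(-p.2) := Real.sqrt_le_sqrt (by linarith)
    rw [abs_of_nonneg (by linarith), one_div_mul_eq_div, le_div_iff₀ hs]
    have e1 := Real.sq_sqrt (show 0 ≤ -p.2 by linarith)
    have e2 := Real.sq_sqrt (show 0 ≤ -b by linarith)
    nlinarith
  have e : ψ (scale b p) - ψ (0, b) / √(-b) * √(-p.2) =
      (ψ (scale b p) - ψ (0, b)) - ψ (0, b) / √(-b) * (√(-p.2) - √(-b)) := by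
    field_simp; ring
  rw [e]
  refine (abs_sub _ _).trans ?_
  rw [abs_mul, abs_div, abs_of_pos hs, add_mul]
  refine add_le_add h2 ?_
  rw [mul_assoc, mul_assoc]
  exact mul_le_mul_of_nonneg_left h3 (by positivity)

/-- The constant of the residue of `K` at the exponent `-(n+1)/2`. -/
noncomputable def resConst (n : ℕ) (b : ℝ) : ℝ :=
  (3 ^ n : ℝ)⁻¹ * Real.pi ^ (n / 2 : ℝ) / (6 * √(-b))

/-- The integral of the weight against `√(-y)`, the model for a test function near the vertex. -/
theorem integral_weight_sqrt (hn : 0 < n) (hb : b < 0) {m : ℕ} {c s : ℝ} (hc : c < b)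
    (hs : abscissa n m < s) :
    IntegrableOn (fun p => weight n b m s p * √(-p.2)) (cylFrom n c b) ∧
      ∫ p in cylFrom n c b, weight n b m s p * √(-p.2) =
        Real.pi ^ (n / 2 : ℝ) * Real.Gamma (s + m + 1) / Real.Gamma (s + m + 1 + n / 2) *
          (tau b c ^ (2 * s + n + 1) / (2 * s + n + 1) / 3) := by
  rw [abscissa, max_lt_iff] at hs
  have hB := ball_weight hn (s := s + m) (by linarith)
  have hT := integral_tau_rpow_mul hb hc (p := 2 * s + n) (by linarith)
  have e : (fun p : Space n => weight n b m s p * √(-p.2)) = fun p =>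
      (1 - ‖p.1‖ ^ 2) ^ (s + m) * (tau b p.2 ^ (2 * s + n) * (3 * √(-p.2)) / 3) := by
    ext p; simp only [weight]; ring
  rw [e, IntegrableOn, restrict_cylFrom]
  refine ⟨hB.1.integrable.mul_prod (hT.1.integrable.div_const 3), ?_⟩
  rw [integral_prod_mul (fun x : EuclideanSpace ℝ (Fin n) => (1 - ‖x‖ ^ 2) ^ (s + m))
    (fun y => tau b y ^ (2 * s + n) * (3 * √(-y)) / 3), hB.2, integral_div, hT.2]

/-- The residue at the exponent `-(n+1)/2` is a multiple of the Dirac measure at the vertex. -/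
theorem tendsto_realK (hn : 0 < n) (hb : b < 0) {m : ℕ} {q : ℝ} (hq : q = 1 / 2 - n / 2)
    (hm : 0 < q + m) (ψ : Test n) :
    Tendsto (fun ε : ℝ => ε * realK b m (q - 1 + ε) ψ) (𝓝[>] 0)
      (𝓝 (resConst n b / Real.Gamma (m + 1 / 2) * ψ (0, b))) := by
  obtain ⟨c, hcb, hc⟩ := exists_lower_bound b ψ
  obtain ⟨C, hC0, hC⟩ := dist_axis_le (c := c) hb ψ
  have hsq : 0 < √(-b) := Real.sqrt_pos.2 (by linarith)
  have hτc := tau_pos hb hcb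
  have habs : ∀ {ε : ℝ}, 0 < ε → abscissa n m < q - 1 + ε := fun hε => by
    rw [abscissa, max_lt_iff]; constructor <;> linarith
  -- replace the test function by its value at the vertex
  have hsplit : ∀ ε > 0, ∫ p in cyl n b, weight n b m (q - 1 + ε) p * ψ (scale b p) =
      ψ (0, b) / √(-b) * (∫ p in cylFrom n c b, weight n b m (q - 1 + ε) p * √(-p.2)) +
      ∫ p in cylFrom n c b, weight n b m (q - 1 + ε) p *
        (ψ (scale b p) - ψ (0, b) / √(-b) * √(-p.2)) := fun ε hε => by
    have h1 := (integrableOn_weight_mul hn hb (habs hε) ψ).mono_set (cylFrom_subset (c := c))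
    have h2 := (integral_weight_sqrt hn hb hcb (habs hε)).1.const_mul (ψ (0, b) / √(-b))
    have h3 : ∫ p in cyl n b, weight n b m (q - 1 + ε) p * ψ (scale b p) =
        ∫ p in cylFrom n c b, weight n b m (q - 1 + ε) p * ψ (scale b p) := by
      refine setIntegral_eq_of_subset_of_forall_sdiff_eq_zero measurableSet_cyl cylFrom_subset
        fun p hp => ?_
      have hp2 : p.2 ≤ c := by
        by_contra! h
        exact hp.2 ⟨hp.1.1, h, hp.1.2⟩
      rw [hc (scale b p) hp2, mul_zero]
    rw [h3, ← integral_const_mul, ← sub_eq_iff_eq_add', ← integral_sub h1 h2]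
    refine integral_congr_ae (Eventually.of_forall fun p => ?_)
    simp only
    ring
  have hmain : Tendsto (fun ε : ℝ => (3 ^ n : ℝ)⁻¹ * Real.pi ^ (n / 2 : ℝ) / 6 *
      (Real.Gamma (m + 1 / 2 + ε))⁻¹ * tau b c ^ (2 * ε) * (ψ (0, b) / √(-b))) (𝓝[>] 0)
      (𝓝 (resConst n b / Real.Gamma (m + 1 / 2) * ψ (0, b))) := by
    have hG : ContinuousAt (fun ε : ℝ => Real.Gamma (m + 1 / 2 + ε)) 0 := by
      have : ContinuousAt Real.Gamma (m + 1 / 2 + 0) :=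
        (Real.differentiableAt_Gamma fun k => by
          have : (0 : ℝ) ≤ k := k.cast_nonneg
          have : (0 : ℝ) ≤ m := m.cast_nonneg
          intro h; linarith).continuousAt
      exact this.comp (f := fun ε : ℝ => m + 1 / 2 + ε) (by fun_prop)
    have hG0 : Real.Gamma (m + 1 / 2 + 0) ≠ 0 := (Real.Gamma_pos_of_pos (by positivity)).ne'
    have hT : ContinuousAt (fun ε : ℝ => tau b c ^ (2 * ε)) 0 :=
      (Real.continuousAt_const_rpow hτc.ne').comp (f := fun ε : ℝ => 2 * ε) (by fun_prop)
    have h : ContinuousAt (fun ε : ℝ => (3 ^ n : ℝ)⁻¹ * Real.pi ^ (n / 2 : ℝ) / 6 *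
        (Real.Gamma (m + 1 / 2 + ε))⁻¹ * tau b c ^ (2 * ε) * (ψ (0, b) / √(-b))) 0 :=
      ((continuousAt_const.mul (hG.inv₀ hG0)).mul hT).mul continuousAt_const
    have h2 := h.tendsto.mono_left (nhdsWithin_le_nhds (s := Ioi 0))
    convert h2 using 2
    simp only [resConst, add_zero, mul_zero, Real.rpow_zero]
    field_simp
  -- the remainder carries one more power of `tau`, so it stays bounded
  have hrem : Tendsto (fun ε : ℝ => ε * ((3 ^ n : ℝ)⁻¹ * (Real.Gamma (q + m + ε))⁻¹ *
      ∫ p in cylFrom n c b, weight n b m (q - 1 + ε) p *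
        (ψ (scale b p) - ψ (0, b) / √(-b) * √(-p.2)))) (𝓝[>] 0) (𝓝 0) := by
    set W : Space n → ℝ := fun p => (1 - ‖p.1‖ ^ 2) ^ (q - 1 + m) * 1
    have hW : IntegrableOn W (cylFrom n c b) := by
      rw [IntegrableOn, restrict_cylFrom]
      exact (ball_weight hn (s := q - 1 + m) (by linarith)).1.integrable.mul_prod
        (integrable_const 1)
    set B : ℝ := C * (1 + tau b c) ^ 2 * ∫ p in cylFrom n c b, W p
    have hB : ∀ ε ∈ Ioo (0 : ℝ) 1, ‖∫ p in cylFrom n c b, weight n b m (q - 1 + ε) p *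
        (ψ (scale b p) - ψ (0, b) / √(-b) * √(-p.2))‖ ≤ B := fun ε hε => by
      simp only [B]
      rw [← integral_const_mul]
      refine norm_integral_le_of_norm_le (hW.const_mul _)
        (ae_restrict_of_forall_mem measurableSet_cylFrom fun p hp => ?_)
      have hp' := cylFrom_subset hp
      have ht := tau_pos hb hp'.2
      have htc : tau b p.2 ≤ tau b c := tau_antitone hp.2.1.le (hp.2.2.trans hb).le
      have h1 := one_sub_pos hp'
      rw [norm_mul, Real.norm_of_nonneg (weight_nonneg hb hp'), Real.norm_eq_abs]
      calc weight n b m (q - 1 + ε) p * |ψ (scale b p) - ψ (0, b) / √(-b) * √(-p.2)|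
          ≤ weight n b m (q - 1 + ε) p * (C * tau b p.2) :=
            mul_le_mul_of_nonneg_left (hC p hp) (weight_nonneg hb hp')
        _ = C * tau b p.2 ^ (2 * ε) * (1 - ‖p.1‖ ^ 2) ^ (q - 1 + m + ε) := by
            have e1 : tau b p.2 ^ (2 * ε) = tau b p.2 ^ (2 * (q - 1 + ε) + n) * tau b p.2 := by
              rw [← Real.rpow_add_one ht.ne']
              congr 1; rw [hq]; ring
            rw [e1, weight, show q - 1 + ε + m = q - 1 + m + ε by ring]
            ring
        _ ≤ C * (1 + tau b c) ^ 2 * W p := by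
            have e1 : tau b p.2 ^ (2 * ε) ≤ (1 + tau b c) ^ 2 := by
              calc tau b p.2 ^ (2 * ε) ≤ (1 + tau b c) ^ (2 * ε) :=
                    Real.rpow_le_rpow ht.le (by linarith) (by linarith [hε.1])
                _ ≤ (1 + tau b c) ^ (2 : ℝ) :=
                    Real.rpow_le_rpow_of_exponent_le (by linarith) (by linarith [hε.2])
                _ = _ := Real.rpow_two _
            have e2 : (1 - ‖p.1‖ ^ 2) ^ (q - 1 + m + ε) ≤ (1 - ‖p.1‖ ^ 2) ^ (q - 1 + m) :=
              Real.rpow_le_rpow_of_exponent_ge h1 (by nlinarith [norm_nonneg p.1])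
                (by linarith [hε.1])
            have e3 : 0 ≤ (1 - ‖p.1‖ ^ 2) ^ (q - 1 + m + ε) := Real.rpow_nonneg h1.le _
            simp only [W, mul_one]
            gcongr
    have hG : ContinuousAt (fun ε : ℝ => (3 ^ n : ℝ)⁻¹ * (Real.Gamma (q + m + ε))⁻¹) 0 := by
      have : ContinuousAt Real.Gamma (q + m + 0) :=
        (Real.differentiableAt_Gamma fun k => by
          have : (0 : ℝ) ≤ k := k.cast_nonneg
          intro h; linarith).continuousAt
      have h2 : ContinuousAt (fun ε : ℝ => Real.Gamma (q + m + ε)) 0 :=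
        this.comp (f := fun ε : ℝ => q + m + ε) (by fun_prop)
      exact continuousAt_const.mul
        (h2.inv₀ (by rw [add_zero]; exact (Real.Gamma_pos_of_pos hm).ne'))
    have h0 : Tendsto (fun ε : ℝ => ε * ((3 ^ n : ℝ)⁻¹ * (Real.Gamma (q + m + ε))⁻¹)) (𝓝[>] 0)
        (𝓝 0) := by
      have h : ContinuousAt
          (fun ε : ℝ => ε * ((3 ^ n : ℝ)⁻¹ * (Real.Gamma (q + m + ε))⁻¹)) 0 := continuousAt_id.mul hG
      have h2 := h.tendsto.mono_left (nhdsWithin_le_nhds (s := Ioi (0 : ℝ)))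
      rwa [zero_mul] at h2
    have hbd : IsBoundedUnder (· ≤ ·) (𝓝[>] (0 : ℝ)) fun ε =>
        ‖∫ p in cylFrom n c b, weight n b m (q - 1 + ε) p *
          (ψ (scale b p) - ψ (0, b) / √(-b) * √(-p.2))‖ :=
      ⟨B, eventually_map.2 (by
        filter_upwards [Ioo_mem_nhdsGT one_pos] with ε hε using hB ε hε)⟩
    refine (h0.zero_mul_isBoundedUnder_le hbd).congr fun ε => ?_
    ring
  have := hmain.add hrem
  rw [add_zero] at this
  refine this.congr' ?_
  filter_upwards [self_mem_nhdsWithin] with ε (hε : 0 < ε)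
  rw [realK, hsplit ε hε, (integral_weight_sqrt hn hb hcb (habs hε)).2]
  have hG1 : Real.Gamma (q + m + ε) ≠ 0 := (Real.Gamma_pos_of_pos (by linarith)).ne'
  have hG2 : Real.Gamma (m + 1 / 2 + ε) ≠ 0 := (Real.Gamma_pos_of_pos (by positivity)).ne'
  have e1 : q - 1 + ε + m + 1 = q + m + ε := by ring
  have e2 : q + m + ε + n / 2 = m + 1 / 2 + ε := by rw [hq]; ring
  have e3 : 2 * (q - 1 + ε) + n + 1 = 2 * ε := by rw [hq]; ring
  rw [e1, e2, e3]
  field_simp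
  ring

/-! ### Integration by parts in `η` -/

/-- The power `t^z` for `t > 0`, extended by `0`. -/
noncomputable def posPow (z : ℂ) (t : ℝ) : ℂ := if 0 < t then (t : ℂ) ^ z else 0

theorem posPow_of_pos {z : ℂ} {t : ℝ} (ht : 0 < t) : posPow z t = (t : ℂ) ^ z := if_pos ht

theorem posPow_of_nonpos {z : ℂ} {t : ℝ} (ht : t ≤ 0) : posPow z t = 0 := if_neg ht.not_gt

theorem norm_posPow_le (z : ℂ) (t : ℝ) : ‖posPow z t‖ ≤ |t| ^ z.re := by
  rcases lt_or_ge 0 t with ht | ht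
  · rw [posPow_of_pos ht, Complex.norm_cpow_eq_rpow_re_of_pos ht, abs_of_pos ht]
  · rw [posPow_of_nonpos ht, norm_zero]
    positivity

/-- For `Re z > 1` the extended power is differentiable also at `0`. -/
theorem hasDerivAt_posPow {z : ℂ} (hz : 1 < z.re) (t : ℝ) :
    HasDerivAt (posPow z) (z * posPow (z - 1) t) t := by
  rcases lt_trichotomy t 0 with ht | rfl | ht
  · rw [posPow_of_nonpos ht.le, mul_zero]
    refine (hasDerivAt_const t (0 : ℂ)).congr_of_eventuallyEq ?_
    filter_upwards [gt_mem_nhds ht] with r hr using posPow_of_nonpos hr.le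
  · rw [posPow_of_nonpos le_rfl, mul_zero, hasDerivAt_iff_isLittleO]
    simp only [posPow_of_nonpos le_rfl, sub_zero, smul_zero]
    have h1 : posPow z =O[𝓝 0] fun t : ℝ => |t| ^ z.re :=
      Asymptotics.IsBigO.of_norm_le fun t => (norm_posPow_le z t)
    refine h1.trans_isLittleO ?_
    rw [← Asymptotics.isLittleO_norm_right]
    have h2 : (fun t : ℝ => |t| ^ z.re) = fun t => |t| ^ (z.re - 1) * ‖t‖ := by
      ext t
      rw [Real.norm_eq_abs]
      conv_rhs => rw [← Real.rpow_one |t|, ← Real.rpow_mul (abs_nonneg t), one_mul,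
        ← Real.rpow_add_of_nonneg (abs_nonneg t) (by linarith) zero_le_one, sub_add_cancel]
    rw [h2]
    have h3 : Tendsto (fun t : ℝ => |t| ^ (z.re - 1)) (𝓝 0) (𝓝 0) := by
      have : ContinuousAt (fun t : ℝ => |t| ^ (z.re - 1)) 0 :=
        continuous_abs.continuousAt.rpow_const (Or.inr (by linarith))
      simpa [ContinuousAt, Real.zero_rpow (sub_pos.2 hz).ne'] using this
    have h4 := (Asymptotics.isLittleO_one_iff ℝ).2 h3
    simpa using h4.mul_isBigO (Asymptotics.isBigO_refl (fun t : ℝ => ‖t‖) (𝓝 0))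
  · rw [posPow_of_pos ht]
    have h0 := (hasDerivAt_id' (t : ℂ)).cpow_const (c := z) (Or.inl (by simpa using ht))
    rw [mul_one] at h0
    have h := h0.comp_ofReal
    refine h.congr_of_eventuallyEq ?_
    filter_upwards [lt_mem_nhds ht] with r hr using posPow_of_pos hr

/-- Two holomorphic functions on a half-plane that agree on a smaller half-plane are equal. -/
theorem eq_of_eq_halfPlane {f g : ℂ → ℂ} {σ τ : ℝ} (hf : DifferentiableOn ℂ f {s | σ < s.re})
    (hg : DifferentiableOn ℂ g {s | σ < s.re}) (h : ∀ s : ℂ, τ < s.re → f s = g s) {s : ℂ}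
    (hs : σ < s.re) : f s = g s := by
  have ho (r : ℝ) : IsOpen {s : ℂ | r < s.re} := isOpen_lt continuous_const Complex.continuous_re
  have hc : IsPreconnected {s : ℂ | σ < s.re} := (convex_halfSpace_re_gt σ).isPreconnected
  have h0 : ((max σ τ + 1 : ℝ) : ℂ) ∈ {s : ℂ | σ < s.re} := by
    rw [mem_ofPred_eq, Complex.ofReal_re]; linarith [le_max_left σ τ]
  refine (hf.analyticOnNhd (ho σ)).eqOn_of_preconnected_of_eventuallyEq (hg.analyticOnNhd (ho σ))
    hc h0 ?_ hs
  filter_upwards [(ho τ).mem_nhds (show ((max σ τ + 1 : ℝ) : ℂ) ∈ {s : ℂ | τ < s.re} by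
    rw [mem_ofPred_eq, Complex.ofReal_re]; linarith [le_max_right σ τ])] with z hz using h z hz

theorem abs_coord_le (x : EuclideanSpace ℝ (Fin n)) (j : Fin n) : |x j| ≤ ‖x‖ := by
  simpa using PiLp.norm_apply_le x j

theorem integrableOn_cweight_mul (hn : 0 < n) (hb : b < 0) {m : ℕ} {s : ℂ}
    (hs : abscissa n m < s.re) (ψ : Test n) {g : Space n → ℝ} (hg : Continuous g)
    (hg1 : ∀ p ∈ cyl n b, |g p| ≤ 1) :
    IntegrableOn (fun p => cweight n b m s p * (ψ (scale b p) : ℝ) * (g p : ℝ)) (cyl n b) :=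
  (integrableOn_cweight hn hb hs ψ).mul_bdd (c := 1)
    (Complex.continuous_ofReal.comp hg).aestronglyMeasurable
    (ae_restrict_of_forall_mem measurableSet_cyl fun p hp => by simpa using hg1 p hp)

theorem cweight_succ {m : ℕ} {s : ℂ} {p : Space n} (hp : p ∈ cyl n b) :
    cweight n b (m + 1) s p = cweight n b m s p * ((1 - ‖p.1‖ ^ 2 : ℝ) : ℂ) := by
  have h : ((1 - ‖p.1‖ ^ 2 : ℝ) : ℂ) ≠ 0 := by exact_mod_cast (one_sub_pos hp).ne'
  unfold cweight
  rw [mul_assoc, show s + ((m + 1 : ℕ) : ℂ) = s + m + 1 by push_cast; ring, Complex.cpow_add _ _ h,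
    Complex.cpow_one]

/-- The function `tau^{2s+n} (1-|η|²)^z` on `y < b`, extended by zero outside the cylinder. -/
noncomputable def extWeight (n : ℕ) (b : ℝ) (s z : ℂ) (p : Space n) : ℂ :=
  if p.2 < b then (tau b p.2 : ℂ) ^ (2 * s + n) * posPow z (1 - ‖p.1‖ ^ 2) else 0

theorem extWeight_of_mem {m : ℕ} {s : ℂ} {p : Space n} (hp : p ∈ cyl n b) :
    extWeight n b s (s + m) p = cweight n b m s p := by
  rw [extWeight, if_pos (mem_Iio.1 hp.2), posPow_of_pos (one_sub_pos hp), cweight]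

theorem extWeight_of_notMem {s z : ℂ} {p : Space n} (hp : p ∉ cyl n b) :
    extWeight n b s z p = 0 := by
  rw [extWeight]
  split_ifs with h
  · rw [posPow_of_nonpos, mul_zero]
    have : 1 ≤ ‖p.1‖ := by
      by_contra! h1
      exact hp ⟨by simpa using h1, h⟩
    nlinarith
  · rfl

theorem hasLineDerivAt_extWeight {s z : ℂ} (hz : 1 < z.re) (p : Space n) (j : Fin n) :
    HasLineDerivAt ℝ (extWeight n b s z)
      (extWeight n b s (z - 1) p * (-2 * z * (p.1 j : ℝ))) p (ex j) := by
  unfold HasLineDerivAt extWeight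
  simp only [line_ex_snd, line_ex]
  split_ifs
  · have h1 : HasDerivAt (fun t : ℝ => 1 - (‖p.1‖ ^ 2 + 2 * t * p.1 j + t ^ 2)) (-2 * p.1 j) 0 := by
      have := ((((hasDerivAt_id' (0 : ℝ)).const_mul 2).mul_const (p.1 j)).const_add
        (‖p.1‖ ^ 2)).fun_add ((hasDerivAt_id' (0 : ℝ)).pow 2)
      refine (this.const_sub 1).congr_deriv ?_
      simp
    have h2 : HasDerivAt (posPow z) (z * posPow (z - 1) (1 - ‖p.1‖ ^ 2))
        (1 - (‖p.1‖ ^ 2 + 2 * 0 * p.1 j + 0 ^ 2)) := by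
      convert hasDerivAt_posPow hz (1 - ‖p.1‖ ^ 2) using 1
      ring
    refine ((h2.scomp (0 : ℝ) h1).const_mul _).congr_deriv ?_
    rw [Complex.real_smul]
    push_cast
    ring
  · simpa using hasDerivAt_const (0 : ℝ) (0 : ℂ)

theorem hasLineDerivAt_comp_scale (ψ : Test n) (p : Space n) (j : Fin n) :
    HasLineDerivAt ℝ (fun p => ((ψ (scale b p) : ℝ) : ℂ))
      ((tau b p.2 / 3 * dir (ex j) ψ (scale b p) : ℝ) : ℂ) p (ex j) := by
  unfold HasLineDerivAt
  have h1 (t : ℝ) : scale b (p + t • ex j) = scale b p + (t * (tau b p.2 / 3)) • ex j := by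
    refine Prod.ext ?_ ?_
    · simp only [scale, ex, Prod.fst_add, Prod.smul_fst, Prod.snd_add, Prod.smul_snd, smul_zero,
        add_zero]
      module
    · simp [scale, ex]
  have h2 : HasDerivAt (fun t : ℝ => scale b p + (t * (tau b p.2 / 3)) • ex j)
      ((tau b p.2 / 3) • ex j) 0 := by
    have := ((((hasDerivAt_id' (0 : ℝ)).mul_const (tau b p.2 / 3))).smul_const
      (ex j : Space n)).const_add (scale b p)
    simpa using this
  have h3 : HasFDerivAt ψ (fderiv ℝ ψ (scale b p)) (scale b p + ((0 : ℝ) * (tau b p.2 / 3)) • ex j) := by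
    rw [zero_mul, zero_smul, add_zero]
    exact ((ψ.contDiff.differentiable (by simp)) _).hasFDerivAt
  simp only [h1]
  have h4 := (h3.comp_hasDerivAt (0 : ℝ) h2).ofReal_comp
  refine h4.congr_deriv ?_
  simp [dir]

/-- Integration by parts in the variable `η_j`. -/
theorem integral_cweight_coord (hn : 0 < n) (hb : b < 0) {m : ℕ} {s : ℂ} (hs : 0 < s.re)
    (ψ : Test n) (j : Fin n) :
    ∫ p in cyl n b, cweight n b (m + 1) s p *
        ((mulTest (fun p => p.1 j) (contDiff_coord j) (∂_{ex j} ψ) (scale b p) : ℝ) : ℂ) =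
      -∫ p in cyl n b, (cweight n b (m + 1) s p * (ψ (scale b p) : ℝ) - 2 * (s + m + 1) *
        (cweight n b m s p * (ψ (scale b p) : ℝ) * ((p.1 j ^ 2 : ℝ) : ℂ))) := by
  have habs (k : ℕ) : abscissa n k < s.re := by
    rw [abscissa, max_lt_iff]
    constructor
    · have : (0 : ℝ) < n := by exact_mod_cast hn
      linarith
    · have : (0 : ℝ) ≤ k := k.cast_nonneg
      linarith
  set F : Space n → ℂ := fun p => extWeight n b s (s + (m + 1 : ℕ)) p * (p.1 j : ℝ)
  set F' : Space n → ℂ := fun p => extWeight n b s (s + (m + 1 : ℕ)) p -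
    2 * (s + m + 1) * (extWeight n b s (s + m) p * ((p.1 j ^ 2 : ℝ) : ℂ))
  set G : Space n → ℂ := fun p => ((ψ (scale b p) : ℝ) : ℂ)
  set G' : Space n → ℂ := fun p => ((tau b p.2 / 3 * dir (ex j) ψ (scale b p) : ℝ) : ℂ)
  have hF (p : Space n) : HasLineDerivAt ℝ F (F' p) p (ex j) := by
    have h1 := hasLineDerivAt_extWeight (b := b) (s := s) (z := s + (m + 1 : ℕ))
      (by
        rw [Complex.add_re, Complex.natCast_re]
        push_cast
        linarith [m.cast_nonneg (α := ℝ)]) p j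
    have h2 : HasDerivAt (fun t : ℝ => (((p + t • ex j).1 j : ℝ) : ℂ)) 1 0 := by
      have : (fun t : ℝ => (p + t • ex j).1 j) = fun t => p.1 j + t := by
        ext t; simp [ex]
      have h3 := (hasDerivAt_id' (0 : ℝ)).const_add (p.1 j)
      rw [← this] at h3
      simpa only [Complex.ofReal_one] using h3.ofReal_comp
    unfold HasLineDerivAt at h1 ⊢
    refine (h1.fun_mul h2).congr_deriv ?_
    simp only [F', zero_smul, add_zero]
    rw [show s + ((m + 1 : ℕ) : ℂ) - 1 = s + m by push_cast; ring]
    push_cast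
    ring
  have hcyl {H : Space n → ℂ} (h0 : ∀ p ∉ cyl n b, H p = 0) : ∫ p, H p = ∫ p in cyl n b, H p :=
    (setIntegral_eq_integral_of_forall_compl_eq_zero h0).symm
  have hcylI {H : Space n → ℂ} (h0 : ∀ p ∉ cyl n b, H p = 0) (hi : IntegrableOn H (cyl n b)) :
      Integrable H := (integrableOn_iff_integrable_of_support_subset
        (Function.support_subset_iff'.2 h0)).1 hi
  have hFG' : ∀ p ∈ cyl n b, F p * G' p = cweight n b (m + 1) s p *
      ((mulTest (fun p => p.1 j) (contDiff_coord j) (∂_{ex j} ψ) (scale b p) : ℝ) : ℂ) := by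
    intro p hp
    simp only [F, G']
    rw [extWeight_of_mem hp, mulTest_apply, lineDeriv_test_apply]
    simp only [scale, PiLp.smul_apply, smul_eq_mul]
    push_cast
    ring
  have hF'G : ∀ p ∈ cyl n b, F' p * G p = cweight n b (m + 1) s p * (ψ (scale b p) : ℝ) -
      2 * (s + m + 1) * (cweight n b m s p * (ψ (scale b p) : ℝ) * ((p.1 j ^ 2 : ℝ) : ℂ)) := by
    intro p hp
    simp only [F', G]
    rw [extWeight_of_mem hp, extWeight_of_mem hp]
    ring
  have hFG : ∀ p ∈ cyl n b, F p * G p = cweight n b (m + 1) s p * (ψ (scale b p) : ℝ) *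
      ((p.1 j : ℝ) : ℂ) := by
    intro p hp
    simp only [F, G]
    rw [extWeight_of_mem hp]
    ring
  have z1 : ∀ p ∉ cyl n b, F p * G' p = 0 := fun p hp => by
    simp only [F, extWeight_of_notMem hp, zero_mul]
  have z2 : ∀ p ∉ cyl n b, F' p * G p = 0 := fun p hp => by
    simp only [F', extWeight_of_notMem hp, zero_mul, mul_zero, sub_zero]
  have z3 : ∀ p ∉ cyl n b, F p * G p = 0 := fun p hp => by
    simp only [F, extWeight_of_notMem hp, zero_mul]
  have hc1 : ∀ p ∈ cyl n b, |p.1 j| ≤ 1 := fun p hp =>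
    (abs_coord_le p.1 j).trans (by simpa using (mem_ball_zero_iff.1 hp.1).le)
  have hc2 : ∀ p ∈ cyl n b, |p.1 j ^ 2| ≤ 1 := fun p hp => by
    rw [abs_pow]; exact pow_le_one₀ (abs_nonneg _) (hc1 p hp)
  have i1 : Integrable fun p => F p * G' p :=
    hcylI z1 ((integrableOn_cweight hn hb (habs _) _).congr_fun
      (fun p hp => (hFG' p hp).symm) measurableSet_cyl)
  have i2 : Integrable fun p => F' p * G p :=
    hcylI z2 (((integrableOn_cweight hn hb (habs _) _).sub
      ((integrableOn_cweight_mul hn hb (habs _) ψ ((contDiff_coord j).continuous.pow 2)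
        hc2).const_mul (2 * (s + m + 1)))).congr_fun
      (fun p hp => (hF'G p hp).symm) measurableSet_cyl)
  have i3 : Integrable fun p => F p * G p :=
    hcylI z3 ((integrableOn_cweight_mul hn hb (habs _) ψ (contDiff_coord j).continuous
        hc1).congr_fun (fun p hp => (hFG p hp).symm) measurableSet_cyl)
  have : (volume : Measure (Space n)).IsAddHaarMeasure :=
    Measure.prod.instIsAddHaarMeasure volume volume
  have key := integral_bilinear_hasLineDerivAt_right_eq_neg_left_of_integrable
    (B := ContinuousLinearMap.mul ℝ ℂ) (μ := (volume : Measure (Space n)))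
    (f := F) (f' := F') (g := G) (g' := G') (v := ex j) i2 i1 i3
    (fun p _ => hF p) (fun p _ => hasLineDerivAt_comp_scale ψ p j)
  simp only [ContinuousLinearMap.mul_apply'] at key
  rw [hcyl z1, hcyl z2, setIntegral_congr_fun measurableSet_cyl hFG',
    setIntegral_congr_fun measurableSet_cyl hF'G] at key
  exact key

/-! ### Analytic continuation -/

theorem abscissa_lt_of_pos (m : ℕ) {s : ℝ} (hs : 0 < s) : abscissa n m < s := by
  rw [abscissa, max_lt_iff]
  constructor
  · linarith [n.cast_nonneg (α := ℝ)]
  · linarith [m.cast_nonneg (α := ℝ)]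

theorem abscissa_succ_le (m : ℕ) : abscissa n (m + 1) ≤ abscissa n m := by
  refine max_le_max le_rfl ?_
  push_cast
  linarith

theorem abscissa_self (n : ℕ) : abscissa n n = -((n : ℝ) + 1) / 2 := by
  rw [abscissa, max_eq_left]
  linarith [n.cast_nonneg (α := ℝ)]

theorem euler_apply_eq_sum (φ : Test n) (p : Space n) :
    euler n φ p = ∑ j : Fin n, mulTest (fun p => p.1 j) (contDiff_coord j) (∂_{ex j} φ) p := by
  rw [euler_apply]
  refine Finset.sum_congr rfl fun j _ => ?_
  rw [mulTest_apply, lineDeriv_test_apply]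

/-- Integration by parts in `η`, at exponents where the boundary terms vanish. -/
theorem K_eq_succ_of_pos (hn : 0 < n) (hb : b < 0) (m : ℕ) {s : ℂ} (hs : 0 < s.re) (ψ : Test n) :
    K b m s ψ = (s + m + 1 + n / 2) * K b (m + 1) s ψ + 1 / 2 * K b (m + 1) s (euler n ψ) := by
  have habs (k : ℕ) : abscissa n k < s.re := abscissa_lt_of_pos k hs
  have hI (k : ℕ) (φ : Test n) := integrableOn_cweight hn hb (habs k) φ
  have hc2 (j : Fin n) : ∀ p ∈ cyl n b, |p.1 j ^ 2| ≤ 1 := fun p hp => by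
    rw [abs_pow]
    exact pow_le_one₀ (abs_nonneg _)
      ((abs_coord_le p.1 j).trans (by simpa using (mem_ball_zero_iff.1 hp.1).le))
  have hJ (j : Fin n) : IntegrableOn (fun p => cweight n b m s p * (ψ (scale b p) : ℝ) *
      ((p.1 j ^ 2 : ℝ) : ℂ)) (cyl n b) :=
    integrableOn_cweight_mul hn hb (habs m) ψ ((contDiff_coord j).continuous.pow 2) (hc2 j)
  -- the sum over the coordinates
  have h1 : ∫ p in cyl n b, cweight n b (m + 1) s p * (euler n ψ (scale b p) : ℝ) =
      -(n * ∫ p in cyl n b, cweight n b (m + 1) s p * (ψ (scale b p) : ℝ)) +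
        2 * (s + m + 1) * ∫ p in cyl n b, (cweight n b m s p * (ψ (scale b p) : ℝ) -
          cweight n b (m + 1) s p * (ψ (scale b p) : ℝ)) := by
    have e1 : ∀ p, cweight n b (m + 1) s p * (euler n ψ (scale b p) : ℝ) =
        ∑ j, cweight n b (m + 1) s p *
          ((mulTest (fun p => p.1 j) (contDiff_coord j) (∂_{ex j} ψ) (scale b p) : ℝ) : ℂ) := by
      intro p
      rw [euler_apply_eq_sum, Complex.ofReal_sum, Finset.mul_sum]
    simp only [e1]
    rw [integral_finsetSum _ fun j _ => hI _ _]
    simp only [integral_cweight_coord hn hb hs]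
    have e2 (j : Fin n) : ∫ p in cyl n b, (cweight n b (m + 1) s p * (ψ (scale b p) : ℝ) -
        2 * (s + m + 1) * (cweight n b m s p * (ψ (scale b p) : ℝ) * ((p.1 j ^ 2 : ℝ) : ℂ))) =
        (∫ p in cyl n b, cweight n b (m + 1) s p * (ψ (scale b p) : ℝ)) - 2 * (s + m + 1) *
        ∫ p in cyl n b, (cweight n b m s p * (ψ (scale b p) : ℝ) * ((p.1 j ^ 2 : ℝ) : ℂ)) := by
      rw [integral_sub (hI _ _) ((hJ j).const_mul _), integral_const_mul]
    simp only [e2]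
    have e3 : ∑ j, ∫ p in cyl n b,
        (cweight n b m s p * (ψ (scale b p) : ℝ) * ((p.1 j ^ 2 : ℝ) : ℂ)) =
        ∫ p in cyl n b, (cweight n b m s p * (ψ (scale b p) : ℝ) -
          cweight n b (m + 1) s p * (ψ (scale b p) : ℝ)) := by
      rw [← integral_finsetSum _ fun j _ => hJ j]
      refine setIntegral_congr_fun measurableSet_cyl fun p hp => ?_
      simp only
      rw [← Finset.mul_sum, ← Complex.ofReal_sum, sum_sq, cweight_succ hp]
      push_cast
      ring
    rw [Finset.sum_neg_distrib, Finset.sum_sub_distrib, ← Finset.mul_sum, e3]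
    simp
    ring
  rw [integral_sub (hI _ _) (hI _ _)] at h1
  have hz : s + m + 1 ≠ 0 := fun h => by
    have := congrArg Complex.re h
    simp at this
    linarith [m.cast_nonneg (α := ℝ)]
  have hΓ : Complex.Gamma (s + (m + 1 : ℕ) + 1) = (s + m + 1) * Complex.Gamma (s + m + 1) := by
    rw [← Complex.Gamma_add_one _ hz]
    push_cast
    ring_nf
  have hΓ0 : Complex.Gamma (s + m + 1) ≠ 0 := Complex.Gamma_ne_zero_of_re_pos (by
    simp; linarith [m.cast_nonneg (α := ℝ)])
  rw [K, K, K, h1, hΓ]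
  field_simp
  ring

theorem K_eq_succ (hn : 0 < n) (hb : b < 0) (m : ℕ) {s : ℂ} (hs : abscissa n m < s.re)
    (ψ : Test n) :
    K b m s ψ = (s + m + 1 + n / 2) * K b (m + 1) s ψ + 1 / 2 * K b (m + 1) s (euler n ψ) := by
  have hd (φ : Test n) : DifferentiableOn ℂ (fun s => K b (m + 1) s φ) {s | abscissa n m < s.re} :=
    (differentiableOn_K hn hb (m + 1) φ).mono fun s hs => (abscissa_succ_le m).trans_lt hs
  exact eq_of_eq_halfPlane (τ := 0) (differentiableOn_K hn hb m ψ)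
    (((show Differentiable ℂ fun s : ℂ => s + m + 1 + n / 2 by fun_prop).differentiableOn.mul
      (hd ψ)).add ((hd (euler n ψ)).const_mul (1 / 2)))
    (fun s hs => K_eq_succ_of_pos hn hb m hs ψ) hs

/-- The functional `K b m`, continued to smaller exponents by `k` integrations by parts. -/
noncomputable def cont (b : ℝ) : ℕ → ℕ → ℂ → Test n → ℂ
  | 0, m, s, ψ => K b m s ψ
  | k + 1, m, s, ψ =>
    (s + m + 1 + n / 2) * cont b k (m + 1) s ψ + 1 / 2 * cont b k (m + 1) s (euler n ψ)

theorem cont_eq_K (hn : 0 < n) (hb : b < 0) (k m : ℕ) {s : ℂ} (hs : abscissa n m < s.re)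
    (ψ : Test n) : cont b k m s ψ = K b m s ψ := by
  induction k generalizing m ψ with
  | zero => rfl
  | succ k ih =>
    have := (abscissa_succ_le m).trans_lt hs
    rw [cont, ih _ this, ih _ this, ← K_eq_succ hn hb m hs]

theorem differentiableOn_cont (hn : 0 < n) (hb : b < 0) (k m : ℕ) (ψ : Test n) :
    DifferentiableOn ℂ (fun s => cont b k m s ψ) {s | abscissa n (m + k) < s.re} := by
  induction k generalizing m ψ with
  | zero => exact differentiableOn_K hn hb m ψ
  | succ k ih =>
    have h (φ : Test n) : DifferentiableOn ℂ (fun s => cont b k (m + 1) s φ)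
        {s | abscissa n (m + (k + 1)) < s.re} := by
      rw [show m + (k + 1) = m + 1 + k by ring]
      exact ih (m + 1) φ
    exact ((show Differentiable ℂ fun s : ℂ => s + m + 1 + n / 2 by
      fun_prop).differentiableOn.mul (h ψ)).add ((h (euler n ψ)).const_mul (1 / 2))

/-- At a real exponent the continued functional is a distribution. -/
theorem exists_distribution_cont (hn : 0 < n) (hb : b < 0) (k m : ℕ) {s : ℝ}
    (hs : abscissa n (m + k) < s) :
    ∃ T : Distr n, ∀ ψ : Test n, cont b k m s ψ = (T ψ : ℝ) := by
  induction k generalizing m with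
  | zero => exact exists_distribution_K hn hb hs
  | succ k ih =>
    obtain ⟨T, hT⟩ := ih (m + 1) (by rwa [show m + 1 + k = m + (k + 1) by ring])
    refine ⟨(s + m + 1 + n / 2) • T + (1 / 2 : ℝ) • (euler n).precompCompactConvergenceCLM _ T,
      fun ψ => ?_⟩
    rw [cont, hT, hT]
    change _ = (((s + m + 1 + n / 2) * T ψ + 1 / 2 * T (euler n ψ) : ℝ) : ℂ)
    push_cast
    rfl

/-- The residue of the continued functional at `-(n+1)/2` is a multiple of the Dirac measure at
the vertex. -/
theorem tendsto_cont (hn : 0 < n) (hb : b < 0) (k m : ℕ) {q : ℝ} (hq : q = 1 / 2 - n / 2)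
    (hm : 0 < q + m + k) (ψ : Test n) :
    Tendsto (fun ε : ℝ => (ε : ℂ) * cont b k m ((q - 1 + ε : ℝ) : ℂ) ψ) (𝓝[>] 0)
      (𝓝 ((resConst n b / Real.Gamma (m + 1 / 2) * ψ (0, b) : ℝ) : ℂ)) := by
  induction k generalizing m ψ with
  | zero =>
    have h := tendsto_realK hn hb hq (m := m) (by simpa using hm) ψ
    refine ((Complex.continuous_ofReal.tendsto _).comp h).congr fun ε => ?_
    rw [Function.comp_apply, cont, K_ofReal hb]
    push_cast
    rfl
  | succ k ih =>
    have hm' : 0 < q + (m + 1 : ℕ) + k := by push_cast at hm ⊢; linarith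
    have h1 := ih (m + 1) hm' ψ
    have h2 := ih (m + 1) hm' (euler n ψ)
    rw [euler_axis, mul_zero] at h2
    have h3 : Tendsto (fun ε : ℝ => ((q - 1 + ε : ℝ) : ℂ) + m + 1 + n / 2) (𝓝[>] 0)
        (𝓝 (((q - 1 + 0 : ℝ) : ℂ) + m + 1 + n / 2)) := by
      have : Continuous fun ε : ℝ => ((q - 1 + ε : ℝ) : ℂ) + m + 1 + n / 2 := by fun_prop
      exact (this.tendsto 0).mono_left nhdsWithin_le_nhds
    have h4 := (h3.mul h1).add (h2.const_mul (1 / 2))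
    have e : resConst n b / Real.Gamma (m + 1 / 2) =
        (m + 1 / 2) * (resConst n b / Real.Gamma ((m + 1 : ℕ) + 1 / 2)) := by
      have h0 : (m + 1 / 2 : ℝ) ≠ 0 := by positivity
      have h5 : Real.Gamma ((m + 1 : ℕ) + 1 / 2) = (m + 1 / 2) * Real.Gamma (m + 1 / 2) := by
        rw [← Real.Gamma_add_one h0]
        push_cast
        ring_nf
      have h6 : Real.Gamma (m + 1 / 2) ≠ 0 := (Real.Gamma_pos_of_pos (by positivity)).ne'
      rw [h5]
      field_simp
    have e2 : ((q - 1 + 0 : ℝ) : ℂ) + m + 1 + n / 2 = ((m + 1 / 2 : ℝ) : ℂ) := by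
      rw [hq]
      push_cast
      ring
    rw [e2] at h4
    rw [e, mul_assoc, Complex.ofReal_mul]
    have h7 := h4.congr (f₂ := fun ε : ℝ => (ε : ℂ) * cont b (k + 1) m ((q - 1 + ε : ℝ) : ℂ) ψ)
      fun ε => by rw [cont]; ring
    simpa using h7

/-! ### From the conoid to the cylinder -/

/-- Change of variables `x = r(y) η` in the slices `y = const`. -/
theorem integral_eq_of_slice_dilation {f g : Space n → ℂ} {r : ℝ → ℝ} (hr : ∀ y < b, 0 < r y)
    (h : ∀ y < b, ∀ η, (r y : ℂ) ^ n * f (r y • η, y) = g (η, y))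
    (hf0 : ∀ y, b ≤ y → ∀ x, f (x, y) = 0) (hg0 : ∀ y, b ≤ y → ∀ x, g (x, y) = 0)
    (hf : AEStronglyMeasurable f) (hg : Integrable g) :
    Integrable f ∧ ∫ p, f p = ∫ p, g p := by
  have hv : (volume : Measure (Space n)) = (volume : Measure (EuclideanSpace ℝ (Fin n))).prod
    (volume : Measure ℝ) := rfl
  have hscale {E : Type} [NormedAddCommGroup E] [NormedSpace ℝ E]
      (k : EuclideanSpace ℝ (Fin n) → E) {y : ℝ} (hy : y < b) :
      ∫ x, k x = ∫ η, (r y) ^ n • k (r y • η) := by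
    have h1 := Measure.integral_comp_smul (volume : Measure (EuclideanSpace ℝ (Fin n))) k (r y)
    have h2 : 0 < (r y) ^ n := pow_pos (hr y hy) n
    rw [integral_smul, h1, finrank_euclideanSpace_fin, abs_of_pos (inv_pos.2 h2), smul_smul,
      mul_inv_cancel₀ h2.ne', one_smul]
  have hint (y : ℝ) : ∫ x, f (x, y) = ∫ η, g (η, y) := by
    rcases lt_or_ge y b with hy | hy
    · rw [hscale _ hy]
      refine integral_congr_ae (Eventually.of_forall fun η => ?_)
      simp only
      rw [← h y hy, Complex.real_smul, Complex.ofReal_pow]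
    · simp [hf0 y hy, hg0 y hy]
  have hnorm (y : ℝ) : ∫ x, ‖f (x, y)‖ = ∫ η, ‖g (η, y)‖ := by
    rcases lt_or_ge y b with hy | hy
    · rw [hscale _ hy]
      refine integral_congr_ae (Eventually.of_forall fun η => ?_)
      simp only
      rw [← h y hy, norm_mul, norm_pow, Complex.norm_real, Real.norm_of_nonneg (hr y hy).le,
        smul_eq_mul]
    · simp [hf0 y hy, hg0 y hy]
  have hg' := hg
  rw [hv, integrable_prod_iff' (by rw [← hv]; exact hg.aestronglyMeasurable)] at hg'
  have hfi : Integrable f := by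
    rw [hv, integrable_prod_iff' (by rw [← hv]; exact hf)]
    refine ⟨?_, by simpa only [hnorm] using hg'.2⟩
    filter_upwards [hg'.1] with y hy
    rcases lt_or_ge y b with hyb | hyb
    · have h3 := hr y hyb
      have h4 : Integrable fun η => f (r y • η, y) := by
        refine (hy.const_mul ((r y : ℂ) ^ n)⁻¹).congr (Eventually.of_forall fun η => ?_)
        have h5 : (r y : ℂ) ^ n ≠ 0 := pow_ne_zero _ (by exact_mod_cast h3.ne')
        simp only
        rw [← h y hyb, inv_mul_cancel_left₀ h5]
      exact (integrable_comp_smul_iff volume (fun x => f (x, y)) h3.ne').1 h4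
    · simp [hf0 y hyb]
  refine ⟨hfi, ?_⟩
  have hfi2 : Integrable f ((volume : Measure (EuclideanSpace ℝ (Fin n))).prod
    (volume : Measure ℝ)) := hfi
  have hg2 : Integrable g ((volume : Measure (EuclideanSpace ℝ (Fin n))).prod
    (volume : Measure ℝ)) := hg
  rw [hv, integral_prod_symm _ hfi2, integral_prod_symm _ hg2]
  simp only [hint]

theorem neg_u_scale (hb : b < 0) {p : Space n} (hp : p.2 < b) :
    -u b (scale b p) = tau b p.2 * tau b p.2 * (1 - ‖p.1‖ ^ 2) := by
  have h : ‖(tau b p.2 / 3) • p.1‖ = tau b p.2 / 3 * ‖p.1‖ := by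
    rw [norm_smul, Real.norm_of_nonneg (by linarith [tau_pos hb hp])]
  rw [u_eq (by simp only [scale]; linarith)]
  simp only [scale]
  rw [h]
  ring

theorem scale_mem_D_iff (hb : b < 0) {p : Space n} (hp : p.2 < b) :
    scale b p ∈ D n b ↔ p ∈ cyl n b := by
  have ht := tau_pos hb hp
  have h : ‖(tau b p.2 / 3) • p.1‖ = tau b p.2 / 3 * ‖p.1‖ := by
    rw [norm_smul, Real.norm_of_nonneg (by linarith)]
  rw [mem_D_iff hb]
  simp only [scale]
  rw [h]
  simp only [cyl, mem_prod, mem_ball_zero_iff, mem_Iio]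
  constructor
  · rintro ⟨-, h2⟩
    refine ⟨?_, hp⟩
    by_contra! h3
    nlinarith
  · rintro ⟨h1, -⟩
    exact ⟨hp, by nlinarith⟩

/-- For `Re s > -1` the functional `K b 0 s` is integration against `(-u)^s / Γ(s+1)` over the
conoid. -/
theorem integral_D_eq_K (hn : 0 < n) (hb : b < 0) {s : ℂ} (hs : -1 < s.re) (ψ : Test n) :
    IntegrableOn (fun p => ((-u b p : ℝ) : ℂ) ^ s / Complex.Gamma (s + 1) * (ψ p : ℝ)) (D n b) ∧
      ∫ p in D n b, ((-u b p : ℝ) : ℂ) ^ s / Complex.Gamma (s + 1) * (ψ p : ℝ) = K b 0 s ψ := by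
  have habs : abscissa n 0 < s.re := by
    rw [abscissa, max_lt_iff]
    have : (1 : ℝ) ≤ n := by exact_mod_cast hn
    constructor
    · linarith
    · simpa using hs
  have hDm : MeasurableSet (D n b) := isOpen_D.measurableSet
  set F : Space n → ℂ := (D n b).indicator
    fun p => ((-u b p : ℝ) : ℂ) ^ s / Complex.Gamma (s + 1) * (ψ p : ℝ)
  set G : Space n → ℂ := (cyl n b).indicator fun p => (3 ^ n : ℂ)⁻¹ * (Complex.Gamma (s + 1))⁻¹ *
    (cweight n b 0 s p * (ψ (scale b p) : ℝ))
  have hFm : AEStronglyMeasurable F volume := by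
    have h1 : Measurable fun p : Space n => ((-u b p : ℝ) : ℂ) :=
      Complex.measurable_ofReal.comp continuous_u.measurable.neg
    have h2 : Measurable fun p => ((ψ p : ℝ) : ℂ) :=
      Complex.measurable_ofReal.comp ψ.continuous.measurable
    exact ((((h1.pow_const s).div_const _).mul h2).indicator hDm).aestronglyMeasurable
  have hG : Integrable G := (integrable_indicator_iff measurableSet_cyl).2
    ((integrableOn_cweight hn hb habs ψ).const_mul _)
  have key := integral_eq_of_slice_dilation (b := b) (f := F) (g := G) (r := fun y => tau b y / 3)
    (fun y hy => by linarith [tau_pos hb hy]) ?_ ?_ ?_ hFm hG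
  · refine ⟨(integrable_indicator_iff hDm).1 key.1, ?_⟩
    rw [← integral_indicator hDm, key.2, integral_indicator measurableSet_cyl, integral_const_mul,
      K]
    simp
  · intro y hy η
    have hmem := scale_mem_D_iff (n := n) hb (p := (η, y)) hy
    change ((tau b y / 3 : ℝ) : ℂ) ^ n * F (scale b (η, y)) = _
    by_cases hp : ((η, y) : Space n) ∈ cyl n b
    · simp only [F, G]
      rw [indicator_of_mem hp, indicator_of_mem (hmem.2 hp), neg_u_scale hb hy, cweight]
      have ht := tau_pos hb hy
      have ht0 : (tau b y : ℂ) ≠ 0 := by exact_mod_cast ht.ne'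
      have h1 := one_sub_pos hp
      simp only at h1 ⊢
      rw [Complex.ofReal_mul, Complex.mul_cpow_ofReal_nonneg (mul_nonneg ht.le ht.le) h1.le,
        Complex.ofReal_mul, Complex.mul_cpow_ofReal_nonneg ht.le ht.le, Complex.cpow_add _ _ ht0,
        two_mul, Complex.cpow_add _ _ ht0, Complex.cpow_natCast]
      push_cast
      rw [add_zero, div_pow]
      ring
    · simp only [F, G]
      rw [indicator_of_notMem hp, indicator_of_notMem (fun h => hp (hmem.1 h)), mul_zero]
  · intro y hy x
    exact indicator_of_notMem (fun h => hy.not_gt h.2) _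
  · intro y hy x
    exact indicator_of_notMem (fun h => hy.not_gt h.2) _

/-! ### Integration by parts on the conoid -/

theorem hasDerivAt_indicator_zero {f : ℝ → ℂ} {t : ℝ} (S : Set ℝ) (h : HasDerivAt f 0 t)
    (h0 : f t = 0) : HasDerivAt (S.indicator f) 0 t := by
  have e : S.indicator f t = 0 := by
    by_cases ht : t ∈ S
    · rw [indicator_of_mem ht, h0]
    · exact indicator_of_notMem ht f
  rw [hasDerivAt_iff_isLittleO] at h ⊢
  simp only [h0, e, smul_zero, sub_zero] at h ⊢
  exact (Asymptotics.IsBigO.of_norm_le fun x => norm_indicator_le_norm_self f x).trans_isLittleO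
    h.norm_left

theorem dir_mul {g h : Space n → ℝ} (hg : ContDiff ℝ ∞ g) (hh : ContDiff ℝ ∞ h) (e p : Space n) :
    dir e (fun p => g p * h p) p = dir e g p * h p + g p * dir e h p := by
  have := fderiv_fun_mul (hg.differentiable (by simp) p) (hh.differentiable (by simp) p)
  simp only [dir, this]
  simp
  ring

theorem hasDerivAt_line {g : Space n → ℝ} (hg : ContDiff ℝ ∞ g) (e p : Space n) :
    HasDerivAt (fun t : ℝ => g (p + t • e)) (dir e g p) 0 := by
  have h1 : HasDerivAt (fun t : ℝ => p + t • e) e 0 := by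
    simpa using ((hasDerivAt_id' (0 : ℝ)).smul_const e).const_add p
  have h2 : HasFDerivAt g (fderiv ℝ g p) (p + (0 : ℝ) • e) := by
    rw [zero_smul, add_zero]
    exact (hg.differentiable (by simp) p).hasFDerivAt
  exact h2.comp_hasDerivAt 0 h1

/-- `(-U)^s ψ`, cut off to the conoid, is differentiable everywhere along lines. -/
theorem hasLineDerivAt_indicator_posPow (hb : b < 0) {U ψ : Space n → ℝ} (hU : ContDiff ℝ ∞ U)
    (hUu : ∀ p ∈ closure (D n b), U p = u b p) (hψ : ContDiff ℝ ∞ ψ) {s : ℂ} (hs : 1 < s.re)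
    (e p : Space n) :
    HasLineDerivAt ℝ ((D n b).indicator fun p => posPow s (-U p) * (ψ p : ℝ))
      ((D n b).indicator (fun p => posPow s (-U p) * (dir e ψ p : ℝ) -
        s * (posPow (s - 1) (-U p) * ((dir e U p * ψ p : ℝ) : ℂ))) p) p e := by
  have hline : Continuous fun t : ℝ => p + t • e := by fun_prop
  have h0 : p + (0 : ℝ) • e = p := by simp
  have hd : HasDerivAt (fun t : ℝ => posPow s (-U (p + t • e)) * ((ψ (p + t • e) : ℝ) : ℂ))
      (posPow s (-U p) * (dir e ψ p : ℝ) -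
        s * (posPow (s - 1) (-U p) * ((dir e U p * ψ p : ℝ) : ℂ))) 0 := by
    have h1 : HasDerivAt (posPow s) (s * posPow (s - 1) (-U p)) (-U (p + (0 : ℝ) • e)) := by
      rw [h0]; exact hasDerivAt_posPow hs _
    have h2 := (h1.scomp (0 : ℝ) (hasDerivAt_line hU e p).fun_neg).fun_mul
      (hasDerivAt_line hψ e p).ofReal_comp
    refine h2.congr_deriv ?_
    simp only [Function.comp_apply, h0, Complex.real_smul]
    push_cast
    ring
  unfold HasLineDerivAt
  by_cases hp : p ∈ D n b
  · rw [indicator_of_mem hp]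
    refine hd.congr_of_eventuallyEq ?_
    have : ∀ᶠ t in 𝓝 (0 : ℝ), p + t • e ∈ D n b :=
      hline.continuousAt.eventually_mem (isOpen_D.mem_nhds (by rwa [h0]))
    filter_upwards [this] with t ht
    rw [indicator_of_mem ht]
  rw [indicator_of_notMem hp]
  by_cases hpc : p ∈ closure (D n b)
  · have hU0 : U p = 0 := by rw [hUu p hpc, u_eq_zero_of_mem_closure hb hpc hp]
    rw [hU0, neg_zero, posPow_of_nonpos le_rfl, posPow_of_nonpos le_rfl, zero_mul, zero_mul,
      mul_zero, sub_zero] at hd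
    refine hasDerivAt_indicator_zero ((fun t : ℝ => p + t • e) ⁻¹' D n b) hd ?_
    simp only [h0, hU0, neg_zero, posPow_of_nonpos le_rfl, zero_mul]
  · refine (hasDerivAt_const (0 : ℝ) (0 : ℂ)).congr_of_eventuallyEq ?_
    have : ∀ᶠ t in 𝓝 (0 : ℝ), p + t • e ∈ (closure (D n b))ᶜ :=
      hline.continuousAt.eventually_mem (isClosed_closure.isOpen_compl.mem_nhds (by rwa [h0]))
    filter_upwards [this] with t ht
    exact indicator_of_notMem (fun h => ht (subset_closure h)) _

theorem K_congr (hn : 0 < n) (hb : b < 0) {s : ℂ} (hs : -1 < s.re) {φ ψ : Test n}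
    (h : ∀ p ∈ D n b, φ p = ψ p) : K b 0 s φ = K b 0 s ψ := by
  rw [← (integral_D_eq_K hn hb hs φ).2, ← (integral_D_eq_K hn hb hs ψ).2]
  refine setIntegral_congr_fun isOpen_D.measurableSet fun p hp => ?_
  simp only [h p hp]

theorem Gamma_succ {s : ℂ} (hs : 0 < s.re) :
    Complex.Gamma (s + 1) = s * Complex.Gamma s ∧ Complex.Gamma s ≠ 0 ∧ s ≠ 0 := by
  have h0 : s ≠ 0 := fun h => by simp [h] at hs
  exact ⟨Complex.Gamma_add_one s h0, Complex.Gamma_ne_zero_of_re_pos hs, h0⟩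

/-- Integration by parts: the derivative of `(-u)^s / Γ(s+1)` is `-∂u (-u)^{s-1} / Γ(s)`. -/
theorem K_lineDeriv (hn : 0 < n) (hb : b < 0) {U : Space n → ℝ} (hU : ContDiff ℝ ∞ U)
    (hUu : ∀ p ∈ closure (D n b), U p = u b p) {s : ℂ} (hs : 1 < s.re) (e : Space n)
    (ψ : Test n) :
    K b 0 s (∂_{e} ψ) = K b 0 (s - 1) (mulTest (dir e U) (ContDiff.dir hU e) ψ) := by
  have hs1 : -1 < s.re := by linarith
  have hs2 : -1 < (s - 1).re := by simp; linarith
  obtain ⟨hΓ, hΓ0, hs0⟩ := Gamma_succ (s := s) (by linarith)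
  have h1 := integral_D_eq_K hn hb hs1 (∂_{e} ψ)
  have h2 := integral_D_eq_K hn hb hs2 (mulTest (dir e U) (ContDiff.dir hU e) ψ)
  have h3 := integral_D_eq_K hn hb hs1 ψ
  set F : Space n → ℂ := (D n b).indicator fun p => posPow s (-U p) * (ψ p : ℝ)
  set F' : Space n → ℂ := (D n b).indicator fun p => posPow s (-U p) * (dir e ψ p : ℝ) -
        s * (posPow (s - 1) (-U p) * ((dir e U p * ψ p : ℝ) : ℂ))
  have hDm : MeasurableSet (D n b) := isOpen_D.measurableSet
  have hpow (z : ℂ) : ∀ p ∈ D n b, posPow z (-U p) = ((-u b p : ℝ) : ℂ) ^ z := fun p hp => by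
    rw [hUu p (subset_closure hp), posPow_of_pos (by linarith [hp.1])]
  have hF : EqOn (fun p => Complex.Gamma (s + 1) *
      (((-u b p : ℝ) : ℂ) ^ s / Complex.Gamma (s + 1) * (ψ p : ℝ)))
      (fun p => posPow s (-U p) * (ψ p : ℝ)) (D n b) := fun p hp => by
    simp only [hpow s p hp, hΓ]
    field_simp
  have hF' : EqOn (fun p => Complex.Gamma (s + 1) *
      (((-u b p : ℝ) : ℂ) ^ s / Complex.Gamma (s + 1) * ((∂_{e} ψ : Test n) p : ℝ) -
        ((-u b p : ℝ) : ℂ) ^ (s - 1) / Complex.Gamma (s - 1 + 1) *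
          (mulTest (dir e U) (ContDiff.dir hU e) ψ p : ℝ)))
      (fun p => posPow s (-U p) * (dir e ψ p : ℝ) -
        s * (posPow (s - 1) (-U p) * ((dir e U p * ψ p : ℝ) : ℂ))) (D n b) := fun p hp => by
    simp only [hpow _ p hp, lineDeriv_test_apply, mulTest_apply, sub_add_cancel, hΓ]
    field_simp
  have iF : Integrable F := (integrable_indicator_iff hDm).2
    (IntegrableOn.congr_fun (h3.1.const_mul (Complex.Gamma (s + 1))) hF hDm)
  have iF' : Integrable F' := (integrable_indicator_iff hDm).2
    (IntegrableOn.congr_fun ((h1.1.sub h2.1).const_mul (Complex.Gamma (s + 1))) hF' hDm)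
  have : (volume : Measure (Space n)).IsAddHaarMeasure :=
    Measure.prod.instIsAddHaarMeasure volume volume
  have key := integral_bilinear_hasLineDerivAt_right_eq_neg_left_of_integrable
    (B := ContinuousLinearMap.mul ℝ ℂ) (μ := (volume : Measure (Space n)))
    (f := F) (f' := F') (g := fun _ => 1) (g' := fun _ => 0) (v := e)
    (by simpa using iF') (by simp) (by simpa using iF)
    (fun p _ => hasLineDerivAt_indicator_posPow hb hU hUu ψ.contDiff hs e p)
    (fun p _ => by simpa [HasLineDerivAt] using hasDerivAt_const (0 : ℝ) (1 : ℂ))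
  simp only [ContinuousLinearMap.mul_apply', mul_zero, integral_zero, mul_one] at key
  have h4 : ∫ p, F' p = Complex.Gamma (s + 1) * (K b 0 s (∂_{e} ψ) -
      K b 0 (s - 1) (mulTest (dir e U) (ContDiff.dir hU e) ψ)) := by
    rw [integral_indicator hDm, ← setIntegral_congr_fun hDm hF', integral_const_mul,
      integral_sub h1.1 h2.1, h1.2, h2.2]
  rw [h4] at key
  have hΓ1 : Complex.Gamma (s + 1) ≠ 0 := by rw [hΓ]; exact mul_ne_zero hs0 hΓ0
  have h5 := neg_eq_zero.1 key.symm
  exact sub_eq_zero.1 ((mul_eq_zero.1 h5).resolve_left hΓ1)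

/-- Multiplication by `u` raises the exponent. -/
theorem K_mul_u (hn : 0 < n) (hb : b < 0) {U : Space n → ℝ} (hU : ContDiff ℝ ∞ U)
    (hUu : ∀ p ∈ closure (D n b), U p = u b p) {s : ℂ} (hs : 0 < s.re) (ψ : Test n) :
    K b 0 (s - 1) (mulTest U hU ψ) = -s * K b 0 s ψ := by
  obtain ⟨hΓ, hΓ0, hs0⟩ := Gamma_succ hs
  rw [← (integral_D_eq_K hn hb (by simp; linarith) (mulTest U hU ψ)).2,
    ← (integral_D_eq_K hn hb (by linarith) ψ).2, ← integral_const_mul]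
  refine setIntegral_congr_fun isOpen_D.measurableSet fun p hp => ?_
  have h0 : ((-u b p : ℝ) : ℂ) ≠ 0 := by exact_mod_cast (neg_pos.2 hp.1).ne'
  rw [mulTest_apply, hUu p (subset_closure hp), sub_add_cancel, hΓ, Complex.cpow_sub _ _ h0,
    Complex.cpow_one]
  have h1 : (u b p : ℂ) ≠ 0 := by simpa using h0
  push_cast at h0 ⊢
  field_simp

theorem exists_linear_K (hn : 0 < n) (hb : b < 0) {s : ℂ} (hs : -1 < s.re) :
    ∃ L : Test n →ₗ[ℝ] ℂ, ∀ ψ, L ψ = K b 0 s ψ := by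
  have h := fun ψ => integral_D_eq_K hn hb hs ψ
  refine ⟨{ toFun := fun ψ => K b 0 s ψ, map_add' := fun φ ψ => ?_, map_smul' := fun c φ => ?_ },
    fun ψ => rfl⟩
  · rw [← (h _).2, ← (h _).2, ← (h _).2, ← integral_add (h _).1 (h _).1]
    refine integral_congr_ae (Eventually.of_forall fun p => ?_)
    simp only
    rw [show (φ + ψ) p = φ p + ψ p from rfl]
    push_cast
    ring
  · rw [← (h _).2, ← (h _).2, RingHom.id_apply, Complex.real_smul, ← integral_const_mul]
    refine integral_congr_ae (Eventually.of_forall fun p => ?_)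
    simp only
    rw [show (c • φ) p = c * φ p from rfl]
    push_cast
    ring

/-! ### The Tricomi operator applied to `(-u)^s` times the amplitude -/

theorem sum_test_apply {ι : Type*} (S : Finset ι) (F : ι → Test n) (p : Space n) :
    (∑ j ∈ S, F j) p = ∑ j ∈ S, F j p := by
  classical
  induction S using Finset.induction_on with
  | empty => simp
  | insert i S hi ih => rw [Finset.sum_insert hi, Finset.sum_insert hi, ← ih]; rfl

theorem add_test_apply (φ ψ : Test n) (p : Space n) : (φ + ψ) p = φ p + ψ p := rfl

theorem sub_test_apply (φ ψ : Test n) (p : Space n) : (φ - ψ) p = φ p - ψ p := rfl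

theorem smul_test_apply (c : ℝ) (φ : Test n) (p : Space n) : (c • φ) p = c * φ p := rfl

theorem neg_test_apply (φ : Test n) (p : Space n) : (-φ) p = -φ p := rfl

theorem lineDeriv_mulTest {g : Space n → ℝ} (hg : ContDiff ℝ ∞ g) (φ : Test n) (e : Space n) :
    (∂_{e} (mulTest g hg φ) : Test n) =
      mulTest (dir e g) (ContDiff.dir hg e) φ + mulTest g hg (∂_{e} φ) := by
  ext p
  rw [lineDeriv_test_apply, add_test_apply, mulTest_apply, mulTest_apply, lineDeriv_test_apply]
  exact dir_mul hg φ.contDiff e p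

/-- The functionals at the exponents `s`, `s - 1`, `s - 2`, as linear maps. -/
theorem exists_linear_K_le (hn : 0 < n) (hb : b < 0) {s : ℂ} (hs : 3 < s.re) :
    ∃ L : ℕ → Test n →ₗ[ℝ] ℂ, ∀ k ≤ 2, ∀ ψ, L k ψ = K b 0 (s - k) ψ := by
  have h (k : ℕ) : ∃ L : Test n →ₗ[ℝ] ℂ, k ≤ 2 → ∀ ψ, L ψ = K b 0 (s - k) ψ := by
    by_cases hk : k ≤ 2
    · have : -1 < (s - k).re := by
        have : (k : ℝ) ≤ 2 := by exact_mod_cast hk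
        simp
        linarith
      obtain ⟨L, hL⟩ := exists_linear_K hn hb this
      exact ⟨L, fun _ => hL⟩
    · exact ⟨0, fun h => absurd h hk⟩
  choose L hL using h
  exact ⟨L, hL⟩

/-- Two integrations by parts in one direction, the weight `w` being constant in that direction. -/
theorem K_lineDeriv_lineDeriv (hn : 0 < n) (hb : b < 0) {U A w : Space n → ℝ}
    (hU : ContDiff ℝ ∞ U) (hUu : ∀ p ∈ closure (D n b), U p = u b p) (hA : ContDiff ℝ ∞ A)
    (hw : ContDiff ℝ ∞ w) {e : Space n} (hwe : ∀ x, dir e w x = 0) {s : ℂ} (hs : 3 < s.re)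
    (φ : Test n) :
    K b 0 s (mulTest (fun p => w p * A p) (hw.mul hA) (∂_{e} (∂_{e} φ))) =
      K b 0 (s - 2) (mulTest (fun p => w p * A p * (dir e U p * dir e U p))
        ((hw.mul hA).mul ((ContDiff.dir hU e).mul (ContDiff.dir hU e))) φ) -
      K b 0 (s - 1) (mulTest (fun p => w p * (dir e (dir e U) p * A p + 2 * (dir e U p * dir e A p)))
        (hw.mul (((ContDiff.dir (ContDiff.dir hU e) e).mul hA).add
          (contDiff_const.mul ((ContDiff.dir hU e).mul (ContDiff.dir hA e))))) φ) +
      K b 0 s (mulTest (fun p => w p * dir e (dir e A) p)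
        (hw.mul (ContDiff.dir (ContDiff.dir hA e) e)) φ) := by
  obtain ⟨L, hL⟩ := exists_linear_K_le hn hb hs
  have hL0 := hL 0 (by norm_num)
  have hL1 := hL 1 (by norm_num)
  have hL2 := hL 2 (by norm_num)
  simp only [Nat.cast_zero, sub_zero, Nat.cast_one, Nat.cast_ofNat] at hL0 hL1 hL2
  have hUe := ContDiff.dir hU e
  have hAe := ContDiff.dir hA e
  have hUee := ContDiff.dir hUe e
  have hI0 (ψ : Test n) : L 0 (∂_{e} ψ) = L 1 (mulTest (dir e U) hUe ψ) := by
    rw [hL0, hL1]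
    exact K_lineDeriv hn hb hU hUu (by linarith) e ψ
  have hI1 (ψ : Test n) : L 1 (∂_{e} ψ) = L 2 (mulTest (dir e U) hUe ψ) := by
    rw [hL1, hL2, show s - 2 = s - 1 - 1 by ring]
    exact K_lineDeriv hn hb hU hUu (by simp; linarith) e ψ
  set ψ₁ : Test n := mulTest (fun p => w p * A p) (hw.mul hA) (∂_{e} φ)
  set ψ₂ : Test n := mulTest (fun p => w p * dir e A p) (hw.mul hAe) φ
  set ψ₃ : Test n := mulTest (fun p => dir e U p * (w p * A p)) (hUe.mul (hw.mul hA)) φ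
  have hwA (p : Space n) : dir e (fun p => w p * A p) p = w p * dir e A p := by
    rw [dir_mul hw hA, hwe]; ring
  have hwAe (p : Space n) : dir e (fun p => w p * dir e A p) p = w p * dir e (dir e A) p := by
    rw [dir_mul hw hAe, hwe]; ring
  have e1 : mulTest (fun p => w p * A p) (hw.mul hA) (∂_{e} (∂_{e} φ)) =
      ∂_{e} ψ₁ - ∂_{e} ψ₂ + mulTest (fun p => w p * dir e (dir e A) p)
        (hw.mul (ContDiff.dir hAe e)) φ := by
    ext p
    simp only [ψ₁, ψ₂, lineDeriv_mulTest, add_test_apply, sub_test_apply, mulTest_apply, hwA, hwAe]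
    ring
  have e2 : mulTest (dir e U) hUe ψ₁ - mulTest (dir e U) hUe ψ₂ = ∂_{e} ψ₃ -
      mulTest (fun p => w p * (dir e (dir e U) p * A p + 2 * (dir e U p * dir e A p)))
        (hw.mul ((hUee.mul hA).add (contDiff_const.mul (hUe.mul hAe)))) φ := by
    ext p
    simp only [ψ₁, ψ₂, ψ₃, lineDeriv_mulTest, add_test_apply, sub_test_apply, mulTest_apply,
      dir_mul hUe (hw.mul hA), hwA]
    ring
  have e3 : mulTest (dir e U) hUe ψ₃ = mulTest (fun p => w p * A p * (dir e U p * dir e U p))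
        ((hw.mul hA).mul (hUe.mul hUe)) φ := by
    ext p
    simp only [ψ₃, mulTest_apply]
    ring
  rw [← hL0, ← hL0, ← hL1, ← hL2, e1, map_add, map_sub, hI0, hI0, ← map_sub, e2, map_sub, hI1, e3]

/-- The Tricomi operator on test functions. -/
noncomputable def tricomiTest (φ : Test n) : Test n :=
  ∑ j : Fin n, mulYTest n (∂_{ex j} (∂_{ex j} φ)) + ∂_{ey n} (∂_{ey n} φ)

theorem dir_snd_ex (j : Fin n) (p : Space n) : dir (ex j) Prod.snd p = 0 := by
  have h : HasFDerivAt (fun p : Space n => p.2) (ContinuousLinearMap.snd ℝ _ ℝ) p :=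
    hasFDerivAt_snd
  simp [dir, h.fderiv, ex]

theorem dir_eq_of_eqOn_D {f g : Space n → ℝ} (h : ∀ p ∈ D n b, f p = g p) (e : Space n) :
    ∀ p ∈ D n b, dir e f p = dir e g p := fun _ hp =>
  (dir_congr (eventually_of_mem (isOpen_D.mem_nhds hp) h) e).self_of_nhds

/-- The Tricomi operator applied to `(-u)^s / Γ(s+1)` times the amplitude, at large `Re s`. The terms
in `(-u)^{s-2}` reduce to `(-u)^{s-1}` by the eikonal equation; the transport equation then
leaves the common factor `s - q`. -/
theorem K_tricomiTest (hn : 0 < n) (hn' : Even n) (hb : b < 0) {A : Space n → ℝ}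
    (hA : ContDiff ℝ ∞ A) (hAa : ∀ p ∈ closure (D n b), A p = amplitude b p) {q : ℝ}
    (hq : q = 1 / 2 - n / 2) {s : ℂ} (hs : 3 < s.re) (φ : Test n) :
    q * K b 0 s (mulTest A hA (tricomiTest φ)) = (s - q) *
      (q * K b 0 (s - 1) (mulTest (fun p => 36 * -p.2 * A p)
        ((contDiff_const.mul contDiff_snd.neg).mul hA) φ) -
      K b 0 s (mulTest (tricomiFun A) (ContDiff.tricomiFun hA) φ)) := by
  obtain ⟨U, hU, hUu⟩ := exists_smooth_u (n := n) hb
  obtain ⟨L, hL⟩ := exists_linear_K_le hn hb hs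
  have hL0 := hL 0 (by norm_num)
  have hL1 := hL 1 (by norm_num)
  have hL2 := hL 2 (by norm_num)
  simp only [Nat.cast_zero, sub_zero, Nat.cast_one, Nat.cast_ofNat] at hL0 hL1 hL2
  have hUe := fun e => ContDiff.dir hU e
  have hAe := fun e => ContDiff.dir hA e
  have hUee := fun e => ContDiff.dir (hUe e) e
  have hAee := fun e => ContDiff.dir (hAe e) e
  have hone : ContDiff ℝ ∞ fun _ : Space n => (1 : ℝ) := contDiff_const
  have hy : ContDiff ℝ ∞ fun p : Space n => p.2 := contDiff_snd
  set B : Test n := mulTest (fun p => 36 * -p.2 * A p)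
    ((contDiff_const.mul contDiff_snd.neg).mul hA) φ
  set C : Test n := mulTest (tricomiFun A) (ContDiff.tricomiFun hA) φ
  set X2 : Test n := (∑ j : Fin n, mulTest (fun p => p.2 * A p * (dir (ex j) U p * dir (ex j) U p))
      ((hy.mul hA).mul ((hUe _).mul (hUe _))) φ) +
    mulTest (fun p => 1 * A p * (dir (ey n) U p * dir (ey n) U p))
      ((hone.mul hA).mul ((hUe _).mul (hUe _))) φ
  set X1 : Test n := (∑ j : Fin n, mulTest (fun p => p.2 * (dir (ex j) (dir (ex j) U) p * A p +
      2 * (dir (ex j) U p * dir (ex j) A p)))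
      (hy.mul (((hUee _).mul hA).add (contDiff_const.mul ((hUe _).mul (hAe _))))) φ) +
    mulTest (fun p => 1 * (dir (ey n) (dir (ey n) U) p * A p +
      2 * (dir (ey n) U p * dir (ey n) A p)))
      (hone.mul (((hUee _).mul hA).add (contDiff_const.mul ((hUe _).mul (hAe _))))) φ
  have h1 : mulTest A hA (tricomiTest φ) =
      (∑ j : Fin n, mulTest (fun p => p.2 * A p) (hy.mul hA) (∂_{ex j} (∂_{ex j} φ))) +
        mulTest (fun p => 1 * A p) (hone.mul hA) (∂_{ey n} (∂_{ey n} φ)) := by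
    ext p
    simp only [tricomiTest, mulTest_apply, add_test_apply, sum_test_apply, mulYTest_apply,
      mul_add, Finset.mul_sum, one_mul]
    congr 1
    exact Finset.sum_congr rfl fun j _ => by ring
  have hC : (∑ j : Fin n, mulTest (fun p => p.2 * dir (ex j) (dir (ex j) A) p)
      (hy.mul (hAee _)) φ) + mulTest (fun p => 1 * dir (ey n) (dir (ey n) A) p)
      (hone.mul (hAee _)) φ = C := by
    ext p
    simp only [C, mulTest_apply, add_test_apply, sum_test_apply, tricomiFun, ← Finset.sum_mul,
      ← Finset.mul_sum]
    ring
  -- two integrations by parts in every direction, sorted by the power of `-u`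
  have h2 : L 0 (mulTest A hA (tricomiTest φ)) = L 2 X2 - L 1 X1 + L 0 C := by
    rw [h1, ← hC]
    simp only [X1, X2, map_add, map_sum]
    simp only [hL0, hL1, hL2]
    rw [K_lineDeriv_lineDeriv hn hb hU hUu hA hone (fun _ => by simp [dir]) hs φ,
      Finset.sum_congr rfl fun j _ => K_lineDeriv_lineDeriv hn hb hU hUu hA hy
        (fun p => dir_snd_ex j p) hs φ, Finset.sum_add_distrib, Finset.sum_sub_distrib]
    ring
  have hUD : ∀ p ∈ D n b, U p = u b p := fun p hp => hUu p (subset_closure hp)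
  have hAD : ∀ p ∈ D n b, A p = amplitude b p := fun p hp => hAa p (subset_closure hp)
  have hU1 := fun e => dir_eq_of_eqOn_D hUD e
  have hA1 := fun e => dir_eq_of_eqOn_D hAD e
  have hU2 := fun e => dir_eq_of_eqOn_D (hU1 e) e
  have hA2 := fun e => dir_eq_of_eqOn_D (hA1 e) e
  have h3 : L 2 X2 = (s - 1) * L 1 B := by
    have e1 : L 2 X2 = L 2 (-mulTest U hU B) := by
      rw [hL2, hL2]
      refine K_congr hn hb (by simp; linarith) fun p hp => ?_
      have hp0 : p.2 < 0 := hp.2.trans hb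
      have hg := gradForm_u_u (b := b) hp0
      simp only [gradForm] at hg
      simp only [X2, B, neg_test_apply, mulTest_apply, add_test_apply, sum_test_apply, hU1 _ p hp,
        ← Finset.sum_mul, ← Finset.mul_sum, hUD p hp]
      linear_combination A p * φ p * hg
    rw [e1, map_neg, hL2, show s - 2 = s - 1 - 1 by ring,
      K_mul_u hn hb hU hUu (by simp; linarith), hL1]
    ring
  have h4 : q * L 1 X1 = q * (q - 1) * L 1 B + s * L 0 C := by
    have e1 : L 1 (q • X1) = L 1 ((q * (q - 1)) • B - mulTest U hU C) := by
      rw [hL1, hL1]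
      refine K_congr hn hb (by simp; linarith) fun p hp => ?_
      have h := tricomi_amplitude hn' (closure_D_subset_ampDomain hb (subset_closure hp)) hq
      have hT : tricomiFun A p = tricomiFun (amplitude b) p := by
        simp only [tricomiFun, hA2 _ p hp]
      simp only [X1, B, C, smul_test_apply, mulTest_apply, add_test_apply, sub_test_apply,
        sum_test_apply, hU1 _ p hp, hA1 _ p hp, hU2 _ p hp, hUD p hp, hAD p hp, hT]
      have e2 : ∑ j : Fin n, p.2 * (dir (ex j) (dir (ex j) (u b)) p * amplitude b p +
          2 * (dir (ex j) (u b) p * dir (ex j) (amplitude b) p)) * φ p =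
          (p.2 * (∑ j : Fin n, dir (ex j) (dir (ex j) (u b)) p) * amplitude b p +
          2 * (p.2 * ∑ j : Fin n, dir (ex j) (u b) p * dir (ex j) (amplitude b) p)) * φ p := by
        rw [← Finset.sum_mul, ← Finset.mul_sum, Finset.sum_add_distrib, ← Finset.sum_mul,
          ← Finset.mul_sum]
        ring
      rw [e2]
      simp only [gradForm] at h
      rw [tricomiFun] at h
      linear_combination (-φ p) * h
    rw [map_smul, map_sub, map_smul, Complex.real_smul, Complex.real_smul, hL1 (mulTest U hU C),
      K_mul_u hn hb hU hUu (by linarith), ← hL0] at e1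
    rw [e1]
    push_cast
    ring
  rw [← hL0, ← hL0, ← hL1, h2, h3]
  linear_combination -h4

/-! ### The forward distribution and the Dirac measure -/

/-- The continuation to `Re s > -(n+1)/2` of the integral of `ψ` against `(-u)^s / Γ(s+1)`. -/
noncomputable def riesz (b : ℝ) (s : ℂ) (ψ : Test n) : ℂ := cont b n 0 s ψ

theorem differentiableOn_riesz (hn : 0 < n) (hb : b < 0) (ψ : Test n) :
    DifferentiableOn ℂ (fun s => riesz b s ψ) {s | -((n : ℝ) + 1) / 2 < s.re} := by
  have h := differentiableOn_cont hn hb n 0 ψ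
  rwa [zero_add, abscissa_self] at h

theorem riesz_eq_K (hn : 0 < n) (hb : b < 0) {s : ℂ} (hs : -1 < s.re) (ψ : Test n) :
    riesz b s ψ = K b 0 s ψ := by
  refine cont_eq_K hn hb n 0 ?_ ψ
  rw [abscissa, max_lt_iff]
  have : (1 : ℝ) ≤ n := by exact_mod_cast hn
  exact ⟨by linarith, by simpa using hs⟩

theorem riesz_congr (hn : 0 < n) (hb : b < 0) {s : ℂ} (hs : -((n : ℝ) + 1) / 2 < s.re)
    {φ ψ : Test n} (h : ∀ p ∈ D n b, φ p = ψ p) : riesz b s φ = riesz b s ψ := by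
  refine eq_of_eq_halfPlane (τ := -1) (differentiableOn_riesz hn hb φ)
    (differentiableOn_riesz hn hb ψ) (fun s hs => ?_) hs
  rw [riesz_eq_K hn hb hs, riesz_eq_K hn hb hs, K_congr hn hb hs h]

/-- Multiplication by `u` raises the exponent. -/
theorem riesz_mul_u (hn : 0 < n) (hb : b < 0) {U : Space n → ℝ} (hU : ContDiff ℝ ∞ U)
    (hUu : ∀ p ∈ closure (D n b), U p = u b p) {s : ℂ} (hs : -((n : ℝ) + 1) / 2 < s.re)
    (ψ : Test n) : riesz b s (mulTest U hU ψ) = -(s + 1) * riesz b (s + 1) ψ := by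
  have h1 : DifferentiableOn ℂ (fun s => riesz b (s + 1) ψ) {s | -((n : ℝ) + 1) / 2 < s.re} :=
    (differentiableOn_riesz hn hb ψ).comp (f := fun s : ℂ => s + 1)
      (show Differentiable ℂ fun s : ℂ => s + 1 by fun_prop).differentiableOn
      fun s hs => by
        have : -((n : ℝ) + 1) / 2 < s.re := hs
        simp only [mem_ofPred_eq, Complex.add_re, Complex.one_re]
        linarith
  refine eq_of_eq_halfPlane (τ := -1) (differentiableOn_riesz hn hb _)
    ((show Differentiable ℂ fun s : ℂ => -(s + 1) by fun_prop).differentiableOn.mul h1)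
    (fun s hs => ?_) hs
  have h2 : 0 < (s + 1).re := by simp; linarith
  simp only [Pi.mul_apply]
  rw [riesz_eq_K hn hb hs, riesz_eq_K hn hb (by linarith), ← K_mul_u hn hb hU hUu h2,
    add_sub_cancel_right]

/-- The identity for the Tricomi operator, continued to `Re s > q`, that is, to all `s` for which
`riesz b (s - 1)` is defined. -/
theorem riesz_tricomiTest (hn : 0 < n) (hn' : Even n) (hb : b < 0) {A : Space n → ℝ}
    (hA : ContDiff ℝ ∞ A) (hAa : ∀ p ∈ closure (D n b), A p = amplitude b p) {q : ℝ}
    (hq : q = 1 / 2 - n / 2) {s : ℂ} (hs : q < s.re) (φ : Test n) :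
    q * riesz b s (mulTest A hA (tricomiTest φ)) = (s - q) *
      (q * riesz b (s - 1) (mulTest (fun p => 36 * -p.2 * A p)
        ((contDiff_const.mul contDiff_snd.neg).mul hA) φ) -
      riesz b s (mulTest (tricomiFun A) (ContDiff.tricomiFun hA) φ)) := by
  have h0 (ψ : Test n) : DifferentiableOn ℂ (fun s => riesz b s ψ) {s | q < s.re} :=
    (differentiableOn_riesz hn hb ψ).mono fun s (hs : q < s.re) => by
      simp only [mem_ofPred_eq]
      linarith
  have h1 (ψ : Test n) : DifferentiableOn ℂ (fun s => riesz b (s - 1) ψ) {s | q < s.re} :=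
    (differentiableOn_riesz hn hb ψ).comp (f := fun s : ℂ => s - 1)
      (show Differentiable ℂ fun s : ℂ => s - 1 by fun_prop).differentiableOn
      fun s (hs : q < s.re) => by
        simp only [mem_ofPred_eq, Complex.sub_re, Complex.one_re]
        linarith
  refine eq_of_eq_halfPlane (τ := 3) ((h0 _).const_mul (q : ℂ))
    ((show Differentiable ℂ fun s : ℂ => s - q by fun_prop).differentiableOn.mul
      (((h1 _).const_mul (q : ℂ)).sub (h0 _))) (fun s hs => ?_) hs
  simp only [Pi.mul_apply, Pi.sub_apply]
  rw [riesz_eq_K hn hb (by linarith), riesz_eq_K hn hb (by simp; linarith),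
    riesz_eq_K hn hb (by linarith), K_tricomiTest hn hn' hb hA hAa hq hs]

/-- The Tricomi operator applied to the amplitude times `(-u)^q`, at the exponent `q = (1-n)/2`:
the zero of the factor `s - q` cancels the pole at `s - 1 = -(n+1)/2`. -/
theorem riesz_tricomiTest_eq (hn : 0 < n) (hn' : Even n) (hb : b < 0) {A : Space n → ℝ}
    (hA : ContDiff ℝ ∞ A) (hAa : ∀ p ∈ closure (D n b), A p = amplitude b p) {q : ℝ}
    (hq : q = 1 / 2 - n / 2) (φ : Test n) :
    riesz b q (mulTest A hA (tricomiTest φ)) =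
      ((resConst n b / Real.Gamma (1 / 2) * (36 * -b * A (0, b) * φ (0, b)) : ℝ) : ℂ) := by
  have hq0 : (q : ℂ) ≠ 0 := by
    have h := half_even_ne hn' 1
    rw [Complex.ofReal_ne_zero, hq]
    intro h0
    exact h (by push_cast; linarith)
  set B : Test n := mulTest (fun p => 36 * -p.2 * A p)
    ((contDiff_const.mul contDiff_snd.neg).mul hA) φ with hB
  set C : Test n := mulTest (tricomiFun A) (ContDiff.tricomiFun hA) φ
  have hcont (ψ : Test n) :
      Tendsto (fun ε : ℝ => riesz b ((q + ε : ℝ) : ℂ) ψ) (𝓝[>] 0) (𝓝 (riesz b q ψ)) := by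
    have h1 : ContinuousAt (fun s => riesz b s ψ) ((q + 0 : ℝ) : ℂ) := by
      refine ((differentiableOn_riesz hn hb ψ).differentiableAt
        ((isOpen_lt continuous_const Complex.continuous_re).mem_nhds ?_)).continuousAt
      simp only [mem_ofPred_eq, Complex.ofReal_re]
      linarith
    have h2 : ContinuousAt (fun ε : ℝ => ((q + ε : ℝ) : ℂ)) 0 := by fun_prop
    have h3 := (ContinuousAt.comp (f := fun ε : ℝ => ((q + ε : ℝ) : ℂ)) h1 h2).tendsto.mono_left
      (nhdsWithin_le_nhds (s := Ioi 0))
    simpa [Function.comp_def] using h3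
  have hL := (hcont (mulTest A hA (tricomiTest φ))).const_mul (q : ℂ)
  have hε : Tendsto (fun ε : ℝ => (ε : ℂ)) (𝓝[>] 0) (𝓝 0) := by
    have : Continuous fun ε : ℝ => (ε : ℂ) := by fun_prop
    simpa using (this.tendsto 0).mono_left (nhdsWithin_le_nhds (s := Ioi 0))
  have hR := ((tendsto_cont hn hb n 0 hq (by
    have : (0 : ℝ) < n := by exact_mod_cast hn
    push_cast; linarith) B).const_mul (q : ℂ)).sub (hε.mul (hcont C))
  rw [zero_mul, sub_zero] at hR
  have hLR := tendsto_nhds_unique (hR.congr' ?_) hL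
  · have := mul_left_cancel₀ hq0 hLR
    rw [← this, hB, mulTest_apply]
    simp
  · filter_upwards [self_mem_nhdsWithin] with ε (hε : 0 < ε)
    rw [riesz_tricomiTest hn hn' hb hA hAa hq (by rw [Complex.ofReal_re]; linarith)]
    rw [show ((q + ε : ℝ) : ℂ) - 1 = ((q - 1 + ε : ℝ) : ℂ) by push_cast; ring]
    rw [show ((q + ε : ℝ) : ℂ) - q = ε by push_cast; ring]
    simp only [riesz, B, C]
    ring

theorem amplitude_vertex (hb : b < 0) :
    amplitude b ((0, b) : Space n) = (2 ^ (2 / 3 : ℝ) * √(-b))⁻¹ := by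
  have hb' : 0 < -b := by linarith
  have hu : u b ((0, b) : Space n) = 0 := by
    rw [u_eq hb.le, tau_self]; simp
  have hv : -v b ((0, b) : Space n) = 2 ^ (4 : ℝ) * (-b) ^ (3 : ℝ) := by
    have h := u_sub_v (b := b) ((0, b) : Space n)
    have h2 : (-b) ^ (3 / 2 : ℝ) * (-b) ^ (3 / 2 : ℝ) = (-b) ^ (3 : ℝ) := by
      rw [← Real.rpow_add hb']; norm_num
    rw [hu, zero_sub] at h
    rw [h, a, ← h2]
    norm_num
    ring
  have hh : ordinaryHypergeometric (2 / 3 - n / 2 : ℝ) (1 / 6 : ℝ) (3 / 2 - n / 2 : ℝ) (0 : ℝ) = 1 :=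
    hyp_zero n
  rw [amplitude, hu, zero_div, hh, mul_one, hv, Real.mul_rpow (by positivity) (by positivity),
    ← Real.rpow_mul (by norm_num), ← Real.rpow_mul hb'.le, mul_inv, ← Real.rpow_neg (by norm_num),
    Real.sqrt_eq_rpow, ← Real.rpow_neg hb'.le]
  norm_num

/-- The constant `c(n)` normalizes the residue at the vertex to the Dirac measure. -/
theorem normalization (hn : Even n) (hb : b < 0) :
    c n * Real.Gamma (3 / 2 - n / 2) *
      (resConst n b / Real.Gamma (1 / 2) * (36 * -b * amplitude b ((0, b) : Space n))) = 1 := by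
  have hΓ : Real.Gamma (3 / 2 - n / 2) ≠ 0 := Real.Gamma_ne_zero fun m h =>
    half_even_ne hn (-m) (by rw [h]; push_cast; ring)
  have hs : 0 < √(-b) := Real.sqrt_pos.2 (by linarith)
  have hs2 : √(-b) * √(-b) = -b := Real.mul_self_sqrt (by linarith)
  have hπ : Real.pi ^ (1 / 2 - n / 2 : ℝ) * Real.pi ^ (n / 2 : ℝ) = √Real.pi := by
    rw [← Real.rpow_add Real.pi_pos, Real.sqrt_eq_rpow]; ring_nf
  have h3 : (3 : ℝ) ^ (1 - n : ℝ) * 3 ^ n = 3 := by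
    rw [← Real.rpow_natCast 3 n, ← Real.rpow_add (by norm_num)]; simp
  have h2 : (2 : ℝ) ^ (1 / 3 : ℝ) * 2 ^ (2 / 3 : ℝ) = 2 := by
    rw [← Real.rpow_add (by norm_num)]; norm_num
  have hsπ : √Real.pi ≠ 0 := (Real.sqrt_pos.2 Real.pi_pos).ne'
  rw [amplitude_vertex hb, Real.Gamma_one_half_eq, c, resConst]
  generalize Real.Gamma (3 / 2 - n / 2) = G at hΓ
  calc _ = (Real.pi ^ (1 / 2 - n / 2 : ℝ) * Real.pi ^ (n / 2 : ℝ)) * (6 * -b) /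
        (((3 : ℝ) ^ (1 - n : ℝ) * 3 ^ n) * ((2 : ℝ) ^ (1 / 3 : ℝ) * 2 ^ (2 / 3 : ℝ)) *
          (√(-b) * √(-b)) * √Real.pi) := by
        field_simp
        ring
    _ = 1 := by
        rw [hπ, h3, h2, hs2]
        have := hb.ne
        field_simp
        norm_num

/-- The continuation in the definition of the forward distribution is `riesz`. -/
theorem isForwardDistribution_iff (hn : 0 < n) (hb : b < 0) {A : Space n → ℝ}
    (hA : ContDiff ℝ ∞ A) (hAa : ∀ p ∈ closure (D n b), A p = amplitude b p) {q : ℝ}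
    (hq : q = 1 / 2 - n / 2) (E : Distr n) :
    IsForwardDistribution b E ↔ ∀ φ : Test n, ((E φ : ℝ) : ℂ) =
      ((c n * Real.Gamma (3 / 2 - n / 2) : ℝ) : ℂ) * riesz b q (mulTest A hA φ) := by
  have hqc : (1 / 2 - n / 2 : ℂ) = (q : ℂ) := by rw [hq]; push_cast; rfl
  have heq (φ : Test n) (s : ℂ) : EqOn
      (fun p => ((-u b p : ℝ) : ℂ) ^ s / Complex.Gamma (s + 1) * ((mulTest A hA φ p : ℝ) : ℂ))
      (fun p => ((-u b p : ℝ) : ℂ) ^ s / Complex.Gamma (s + 1) *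
        ((amplitude b p * φ p : ℝ) : ℂ)) (D n b) := fun p hp => by
    simp only [mulTest_apply, hAa p (subset_closure hp)]
  have hpair (φ : Test n) (s : ℂ) (hs : -1 < s.re) :
      riesz b s (mulTest A hA φ) = pairing b φ s := by
    rw [riesz_eq_K hn hb hs, ← (integral_D_eq_K hn hb hs _).2, pairing]
    exact setIntegral_congr_fun isOpen_D.measurableSet (heq φ s)
  refine ⟨fun h φ => ?_, fun h φ => ⟨fun s => riesz b s (mulTest A hA φ), ⟨?_, ?_⟩, ?_⟩⟩
  · obtain ⟨Z, ⟨hZ, hZp⟩, hE⟩ := h φ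
    rw [hE, hqc]
    congr 1
    refine eq_of_eq_halfPlane (τ := -1) hZ (differentiableOn_riesz hn hb _) (fun s hs => ?_) ?_
    · rw [(hZp s hs).2, hpair φ s hs]
    · rw [Complex.ofReal_re]; linarith
  · exact differentiableOn_riesz hn hb _
  · exact fun s hs => ⟨(integral_D_eq_K hn hb hs (mulTest A hA φ)).1.congr_fun (heq φ s)
      isOpen_D.measurableSet, hpair φ s hs⟩
  · rw [h φ, hqc]

/-- The coordinate `y` is constant in the directions `x_j`. -/
theorem lineDeriv_mulY_ex (φ : Test n) (j : Fin n) :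
    (∂_{ex j} (mulYTest n φ) : Test n) = mulYTest n (∂_{ex j} φ) := by
  ext p
  rw [lineDeriv_test_apply, mulYTest_apply, lineDeriv_test_apply]
  have h := dir_mul (g := fun p : Space n => p.2) contDiff_snd φ.contDiff (ex j) p
  have h0 : dir (ex j) (fun p : Space n => p.2) p = 0 := dir_snd_ex j p
  rw [h0, zero_mul, zero_add] at h
  exact h

theorem tricomi_apply (E : Distr n) (φ : Test n) : tricomi E φ = E (tricomiTest φ) := by
  have h (v : Space n) (T : Distr n) (ψ : Test n) : (∂_{v} (∂_{v} T)) ψ = T (∂_{v} (∂_{v} ψ)) := by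
    rw [Distribution.lineDerivOp_apply_apply, map_neg, Distribution.lineDerivOp_apply_apply,
      map_neg, neg_neg]
  have hs (S : Finset (Fin n)) (F : Fin n → Distr n) (ψ : Test n) :
      (∑ j ∈ S, F j) ψ = ∑ j ∈ S, F j ψ := by
    classical
    induction S using Finset.induction_on with
    | empty => simp
    | insert i S hi ih => rw [Finset.sum_insert hi, Finset.sum_insert hi, ← ih]; rfl
  rw [tricomi, tricomiTest, map_add, map_sum]
  change mulY _ φ + (∂_{ey n} (∂_{ey n} E)) φ = _
  rw [mulY_apply, hs, h]
  congr 1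
  refine Finset.sum_congr rfl fun j _ => ?_
  rw [h, lineDeriv_mulY_ex, lineDeriv_mulY_ex]

theorem isFundamentalSolution (hn : 0 < n) (hn' : Even n) (hb : b < 0) {E : Distr n}
    (hE : IsForwardDistribution b E) : IsFundamentalSolution E (0, b) := by
  obtain ⟨A, hA, hAa⟩ := exists_smooth_amplitude hn' hb
  rw [isForwardDistribution_iff hn hb hA hAa rfl] at hE
  unfold IsFundamentalSolution
  ext φ
  rw [tricomi_apply, Distribution.delta_apply, ← Complex.ofReal_inj, hE,
    riesz_tricomiTest_eq hn hn' hb hA hAa rfl, ← Complex.ofReal_mul, Complex.ofReal_inj,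
    hAa _ (vertex_mem_closure_D hb)]
  linear_combination φ (0, b) * normalization hn' hb

theorem existsUnique_isForwardDistribution (hn : 0 < n) (hn' : Even n) (hb : b < 0) :
    ∃! E : Distr n, IsForwardDistribution b E := by
  obtain ⟨A, hA, hAa⟩ := exists_smooth_amplitude hn' hb
  obtain ⟨T, hT⟩ := exists_distribution_cont hn hb n 0 (s := 1 / 2 - n / 2) (by
    rw [zero_add, abscissa_self]; linarith)
  refine ⟨(c n * Real.Gamma (3 / 2 - n / 2)) • (mulTest A hA).precompCompactConvergenceCLM _ T,
    ?_, fun E hE => ?_⟩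
  · simp only
    rw [isForwardDistribution_iff hn hb hA hAa rfl]
    intro φ
    rw [riesz, hT, ← Complex.ofReal_mul]
    rfl
  · replace hE := (isForwardDistribution_iff hn hb hA hAa rfl E).1 hE
    ext φ
    rw [← Complex.ofReal_inj, hE, riesz, hT, ← Complex.ofReal_mul]
    rfl

/-! ### The support -/

/-- The amplitude vanishes on no open subset of the conoid: the hypergeometric function is analytic,
and `u / v` is not locally constant. -/
theorem exists_amplitude_ne_zero (hn : 0 < n) (hn' : Even n) (hb : b < 0) {V : Set (Space n)}
    (hV : IsOpen V) (hVD : (V ∩ D n b).Nonempty) : ∃ p ∈ V ∩ D n b, amplitude b p ≠ 0 := by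
  by_contra! hzero
  obtain ⟨p, hp⟩ := hVD
  have hamp {x : Space n} (hx : x ∈ D n b) : x ∈ ampDomain n b :=
    closure_D_subset_ampDomain hb (subset_closure hx)
  have hyp0 : ∀ x ∈ V ∩ D n b, hyp n (u b x / v b x) = 0 := fun x hx => by
    have h1 : 0 < -v b x := by linarith [(hamp hx.2).2.1]
    exact (mul_eq_zero.1 (hzero x hx)).resolve_left (Real.rpow_pos_of_pos h1 _).ne'
  let j : Fin n := ⟨0, hn⟩
  have hline : Continuous fun t : ℝ => p + t • (ex j : Space n) := by fun_prop
  have h0 : p + (0 : ℝ) • (ex j : Space n) = p := by simp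
  have hmem : ∀ᶠ t in 𝓝 (0 : ℝ), p + t • ex j ∈ V ∩ D n b :=
    hline.continuousAt.eventually_mem ((hV.inter isOpen_D).mem_nhds (by rwa [h0]))
  set z : ℝ → ℝ := fun t => u b (p + t • ex j) / v b (p + t • ex j)
  have hv0 := (hamp hp.2).2.1
  have hzt : ContinuousAt z 0 :=
    (continuous_u.comp hline).continuousAt.div (continuous_v.comp hline).continuousAt (by
      simp only [h0]
      exact hv0.ne)
  have hne : ∀ᶠ t in 𝓝[≠] (0 : ℝ), t ≠ -(2 * p.1 j) := by
    rcases eq_or_ne (p.1 j) 0 with h | h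
    · filter_upwards [self_mem_nhdsWithin] with t ht
      simpa [h] using ht
    · exact mem_nhdsWithin_of_mem_nhds (isOpen_ne.mem_nhds (by simpa using h))
  have hz : Tendsto z (𝓝[≠] 0) (𝓝[≠] (z 0)) := by
    refine tendsto_nhdsWithin_iff.2 ⟨hzt.tendsto.mono_left nhdsWithin_le_nhds, ?_⟩
    filter_upwards [hne, self_mem_nhdsWithin, mem_nhdsWithin_of_mem_nhds hmem] with t ht1 ht0 htm
    intro heq
    have hvt := (hamp htm.2).2.1
    have hy : p.2 < 0 := hp.2.2.trans hb
    have hc : 0 < 24 * a b * (-p.2) ^ (3 / 2 : ℝ) := by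
      have := Real.rpow_pos_of_pos (show 0 < -p.2 by linarith) (3 / 2)
      have := a_pos hb
      positivity
    have e1 := u_sub_v (b := b) p
    have e2 := u_sub_v (b := b) (p + t • ex j)
    have e3 : v b (p + t • ex j) - v b p = 9 * (t * (t + 2 * p.1 j)) := by
      simp only [v, line_ex, line_ex_snd]
      ring
    rw [line_ex_snd] at e2
    simp only [z, h0] at heq
    rw [mem_singleton_iff, div_eq_div_iff hvt.ne hv0.ne, eq_add_of_sub_eq e1,
      eq_add_of_sub_eq e2] at heq
    have e4 : 24 * a b * (-p.2) ^ (3 / 2 : ℝ) * (9 * (t * (t + 2 * p.1 j))) = 0 := by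
      rw [← e3]; linear_combination -heq
    have e5 : t * (t + 2 * p.1 j) = 0 := by
      have := (mul_eq_zero.1 e4).resolve_left hc.ne'
      linarith
    rcases mul_eq_zero.1 e5 with h | h
    · exact ht0 h
    · exact ht1 (by linarith)
  have hfreq : ∃ᶠ w in 𝓝[≠] (z 0), hyp n w = 0 := by
    refine hz.frequently (Eventually.frequently ?_)
    filter_upwards [mem_nhdsWithin_of_mem_nhds hmem] with t ht using hyp0 _ ht
  have h1 := (hyp_analyticOnNhd hn').eqOn_zero_of_preconnected_of_frequently_eq_zero
    isPreconnected_Ioo (by simp only [z, h0]; exact ratio_mem (hamp hp.2)) hfreq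
    (show (0 : ℝ) ∈ Ioo (-1 : ℝ) 1 by constructor <;> norm_num)
  rw [hyp_zero] at h1
  exact one_ne_zero h1

/-- Each factor `u` in the test function raises the exponent by one, at the cost of a factor
`-(s+1)`, which does not vanish at half-integers. -/
theorem riesz_iterate_mul_u_ne_zero (hn : 0 < n) (hb : b < 0) {U : Space n → ℝ}
    (hU : ContDiff ℝ ∞ U) (hUu : ∀ p ∈ closure (D n b), U p = u b p) (χ : Test n) (k : ℕ) {s : ℂ}
    (hs : -((n : ℝ) + 1) / 2 < s.re) (hs' : ∀ i : ℕ, s + 1 + i ≠ 0) (h : riesz b (s + k) χ ≠ 0) :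
    riesz b s ((mulTest U hU)^[k] χ) ≠ 0 := by
  induction k generalizing s with
  | zero => simpa using h
  | succ k ih =>
    rw [Function.iterate_succ_apply', riesz_mul_u hn hb hU hUu hs]
    refine mul_ne_zero (neg_ne_zero.2 (by simpa using hs' 0)) (ih ?_ ?_ ?_)
    · simp; linarith
    · intro i
      have := hs' (i + 1)
      push_cast at this
      rwa [add_assoc (s + 1) 1, add_comm (1 : ℂ)]
    · rwa [add_assoc, add_comm (1 : ℂ), ← Nat.cast_succ]

/-- At a positive exponent the pairing with a nonnegative function supported in the conoid is
positive. -/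
theorem riesz_ne_zero_of_nonneg (hn : 0 < n) (hb : b < 0) {χ : Test n} (h0 : ∀ p, 0 ≤ χ p)
    (hsupp : ∀ p ∉ D n b, χ p = 0) {p : Space n} (hp : χ p ≠ 0) {s : ℝ} (hs : 0 < s) :
    riesz b s χ ≠ 0 := by
  have hsre : -1 < (s : ℂ).re := by rw [Complex.ofReal_re]; linarith
  have hΓ := Real.Gamma_pos_of_pos (show 0 < s + 1 by linarith)
  set g : Space n → ℝ := fun x => (-u b x) ^ s * χ x
  have hcont : Continuous g :=
    ((Real.continuous_rpow_const hs.le).comp continuous_u.neg).mul χ.continuous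
  have hcs : HasCompactSupport g := χ.hasCompactSupport.mul_left
  have hg0 : 0 ≤ g := fun x => by
    by_cases hx : x ∈ D n b
    · exact mul_nonneg (Real.rpow_nonneg (by linarith [hx.1]) _) (h0 x)
    · simp [g, hsupp x hx]
  have hpD : p ∈ D n b := by
    by_contra h
    exact hp (hsupp p h)
  have hgp : g p ≠ 0 := mul_ne_zero (Real.rpow_pos_of_pos (by linarith [hpD.1]) _).ne' hp
  have : (volume : Measure (Space n)).IsAddHaarMeasure :=
    Measure.prod.instIsAddHaarMeasure volume volume
  have hpos : 0 < ∫ x, g x :=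
    hcont.integral_pos_of_hasCompactSupport_nonneg_nonzero hcs hg0 hgp
  have hgD : ∫ x in D n b, g x = ∫ x, g x :=
    setIntegral_eq_integral_of_forall_compl_eq_zero fun x hx => by simp [g, hsupp x hx]
  have e : riesz b s χ = (((∫ x, g x) / Real.Gamma (s + 1) : ℝ) : ℂ) := by
    rw [riesz_eq_K hn hb hsre, ← (integral_D_eq_K hn hb hsre χ).2, ← hgD, ← integral_div,
      ← integral_complex_ofReal]
    refine setIntegral_congr_fun isOpen_D.measurableSet fun x hx => ?_
    simp only [g]
    rw [← Complex.ofReal_cpow (by linarith [hx.1]), ← Complex.ofReal_one, ← Complex.ofReal_add,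
      Complex.Gamma_ofReal]
    push_cast
    ring
  rw [e, Complex.ofReal_ne_zero]
  exact (div_pos hpos hΓ).ne'

theorem exists_test_bump {V : Set (Space n)} (hV : IsOpen V) {p : Space n} (hp : p ∈ V) :
    ∃ φ : Test n, tsupport φ ⊆ V ∧ (∀ x, 0 ≤ φ x) ∧ φ p ≠ 0 := by
  obtain ⟨f, hf1, hf2, hf3, hf4, hf5⟩ := exists_contDiff_tsupport_subset (n := ⊤) (hV.mem_nhds hp)
  refine ⟨⟨f, hf3, hf2, fun _ _ => trivial⟩, hf1, fun x => (hf4 (mem_range_self x)).1, ?_⟩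
  change f p ≠ 0
  rw [hf5]
  exact one_ne_zero

theorem tsupport_mulTest_subset {g : Space n → ℝ} (hg : ContDiff ℝ ∞ g) (φ : Test n) :
    tsupport (mulTest g hg φ) ⊆ tsupport φ :=
  tsupport_mul_subset_right (f := g) (g := φ)

/-- Off the closed conoid the distribution vanishes by construction. Near a point of it, test
functions `u ^ n A φ` with `φ ≥ 0` supported in the conoid give a nonzero multiple of the integral of
a nonnegative function. -/
theorem dsupport_eq (hn : 0 < n) (hn' : Even n) (hb : b < 0) {E : Distr n}
    (hE : IsForwardDistribution b E) : Distribution.dsupport E = closure (D n b) := by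
  obtain ⟨A, hA, hAa⟩ := exists_smooth_amplitude hn' hb
  obtain ⟨U, hU, hUu⟩ := exists_smooth_u (n := n) hb
  obtain ⟨q, hq⟩ : ∃ q : ℝ, q = 1 / 2 - n / 2 := ⟨_, rfl⟩
  rw [isForwardDistribution_iff hn hb hA hAa hq] at hE
  have hqre : -((n : ℝ) + 1) / 2 < (q : ℂ).re := by rw [Complex.ofReal_re]; linarith
  have hconst : ((c n * Real.Gamma (3 / 2 - n / 2) : ℝ) : ℂ) ≠ 0 := by
    rw [Complex.ofReal_ne_zero]
    intro h
    have := normalization (n := n) hn' hb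
    rw [h, zero_mul] at this
    exact zero_ne_one this
  refine subset_antisymm (fun p hp => ?_) fun p hp => ?_
  · refine (Distribution.mem_dsupport_iff p).1 hp _ ?_ isClosed_closure
    intro φ hφ
    have h0 : ∀ x ∈ D n b, mulTest A hA φ x = mulTest A hA 0 x := fun x hx => by
      have : φ x = 0 := by
        by_contra h
        exact hφ (subset_tsupport _ h) (subset_closure hx)
      rw [mulTest_apply, mulTest_apply, this]
      rfl
    rw [← Complex.ofReal_inj, hE, riesz_congr hn hb hqre h0, ← hE, map_zero]
  · rw [Distribution.mem_dsupport_iff_forall_exists_ne]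
    intro V hpV hV
    obtain ⟨p₀, hp₀, hne⟩ := exists_amplitude_ne_zero hn hn' hb hV
      (mem_closure_iff.1 hp V hV hpV)
    obtain ⟨φ, hφV, hφ0, hφp⟩ := exists_test_bump (hV.inter isOpen_D) hp₀
    -- multiplying the test function by `u ^ n` moves the exponent from `q` to `q + n > 0`
    refine ⟨(mulTest U hU)^[n] (mulTest A hA φ), ?_, ?_⟩
    · have h : ∀ k : ℕ, tsupport ((mulTest U hU)^[k] (mulTest A hA φ)) ⊆ tsupport φ := by
        intro k
        induction k with
        | zero => exact tsupport_mulTest_subset hA φ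
        | succ k ih =>
          rw [Function.iterate_succ_apply']
          exact (tsupport_mulTest_subset hU _).trans ih
      exact (h n).trans (hφV.trans inter_subset_left)
    · have hcomm : Function.Commute (mulTest A hA) (mulTest U hU) := fun ψ => by
        ext x
        simp only [mulTest_apply]
        ring
      have h1 : mulTest A hA ((mulTest U hU)^[n] (mulTest A hA φ)) =
          (mulTest U hU)^[n] (mulTest A hA (mulTest A hA φ)) := hcomm.iterate_right n _
      rw [← Complex.ofReal_ne_zero, hE, h1]
      refine mul_ne_zero hconst (riesz_iterate_mul_u_ne_zero hn hb hU hUu _ n hqre ?_ ?_)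
      · intro i h
        have h2 : q + 1 + i = 0 := by exact_mod_cast h
        refine half_even_ne hn' (-i) ?_
        push_cast
        linarith
      · have h2 : (q : ℂ) + n = ((q + n : ℝ) : ℂ) := by push_cast; rfl
        rw [h2]
        have hA0 : A p₀ ≠ 0 := by rwa [hAa _ (subset_closure hp₀.2)]
        refine riesz_ne_zero_of_nonneg hn hb (p := p₀) (fun x => ?_) (fun x hx => ?_) ?_ ?_
        · rw [mulTest_apply, mulTest_apply, ← mul_assoc]
          exact mul_nonneg (mul_self_nonneg _) (hφ0 x)
        · have : φ x = 0 := by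
            by_contra h
            exact hx (hφV (subset_tsupport _ h)).2
          rw [mulTest_apply, mulTest_apply, this, mul_zero, mul_zero]
        · rw [mulTest_apply, mulTest_apply]
          exact mul_ne_zero hA0 (mul_ne_zero hA0 hφp)
        · have : (0 : ℝ) < n := by exact_mod_cast hn
          linarith

end Tricomi

theorem theorem5p1 (n : ℕ) (hn : Even n) (hpos : 0 < n) (b : ℝ) (hb : b < 0) :
    (∃! E : Tricomi.Distr n, Tricomi.IsForwardDistribution b E) ∧
      ∀ E : Tricomi.Distr n, Tricomi.IsForwardDistribution b E →
        Tricomi.IsFundamentalSolution E (0, b) ∧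
          Distribution.dsupport E = closure (Tricomi.D n b) :=
  ⟨Tricomi.existsUnique_isForwardDistribution hpos hn hb, fun _ hE =>
    ⟨Tricomi.isFundamentalSolution hpos hn hb hE, Tricomi.dsupport_eq hpos hn hb hE⟩⟩
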